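/- \textbf{Theorem.} The problem $\textsc{Bisim}(\text{Trees},\text{Graphs})$ is in logspace-uniform ${\sf AC}^1$. Here a finite edge-labelled graph $G=(V,E)$ has a finite node set $V$ and labelled edges $E\subseteq V\times A\times V$ for a finite label set $A$ (which is part of the input). It is a tree if the relations $E_a=\{(u,v)\mid (u,a,v)\in E\}$, $a\in A$, are pairwise disjoint and there is a root $r$ such that for every node $v$ there is exactly one path from $r$ to $v$ in $(V,\bigcup_a E_a)$. A bisimulation on a graph is a relation $R\subseteq V\times V$ such that for all $(u,v)\in R$: for every $(u,a,u')\in E$ there is $(v,a,v')\in E$ with $(u',v')\in R$, and for every $(v,a,v')\in E$ there is $(u,a,u')\in E$ with $(u',v')\in R$. Two nodes are bisimilar if some bisimulation contains the pair. An instance of $\textsc{Bisim}(\text{Trees},\text{Graphs})$ consists of a finite tree $T$, an arbitrary finite graph $G$, a node $v_1$ of $T$ and a node $v_2$ of $G$, encoded as a word over $\{0,1\}$ with $T$ and $G$ given as pointer structures (a list of node names and a list of edges $(u,a,v)$). The question is whether $v_1$ and $v_2$ are bisimilar in the disjoint union of $T$ and $G$. As a language, the problem consists of the encodings of all instances with answer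 yes. A language $L\subseteq\{0,1\}^*$ is in logspace-uniform ${\sf AC}^1$ if there is a family $(C_n)_{n\in\mathbb N}$ of acyclic Boolean circuits such that $C_n$ has input gates $x_1,\dots,x_n,\neg x_1,\dots,\neg x_n$, $\wedge$-gates and $\vee$-gates of unbounded fan-in (possibly $0$, which gives the constants), and an output gate; $C_n$ has size $n^{O(1)}$ and depth $O(\log n)$; $C_n$ accepts $x\in\{0,1\}^n$ if and only if $x\in L$; and some deterministic logspace transducer computes a description of $C_n$ from the unary encoding of $n$. -/

import Mathlib

namespace BisimAC

/-! ### Edge-labelled graphs, trees, bisimulation -/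

/-- An edge-labelled graph with node set `V` and edge set `E ⊆ V × A × V`. -/
structure LGraph (V A : Type) where
  /-- `E u a v` means that there is an edge from `u` to `v` labelled by `a`. -/
  E : V → A → V → Prop

namespace LGraph

variable {V W A : Type}

/-- `v` is a successor of `u` in the underlying unlabelled graph. -/
def Succ (G : LGraph V A) (u v : V) : Prop := ∃ a, G.E u a v

/-- The node sequence `p` is a path (of length `p.length - 1 ≥ 0`) from `u` to `v`. -/
def IsPath (G : LGraph V A) (u v : V) (p : List V) : Prop :=
  p.head? = some u ∧ p.getLast? = some v ∧ p.IsChain G.Succ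

/-- Edge-labelled rooted trees: the edge relations `E_a` are pairwise disjoint, and there is a
root from which every node is reached by exactly one path. -/
def IsTree (G : LGraph V A) : Prop :=
  (∀ u v a b, G.E u a v → G.E u b v → a = b) ∧ ∃ r, ∀ v, ∃! p, G.IsPath r v p

/-- The disjoint union of two edge-labelled graphs. -/
inductive DisjE (G : LGraph V A) (H : LGraph W A) : V ⊕ W → A → V ⊕ W → Prop
  | inl {u a v} : G.E u a v → DisjE G H (Sum.inl u) a (Sum.inl v)
  | inr {u a v} : H.E u a v → DisjE G H (Sum.inr u) a (Sum.inr v)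

/-- The disjoint union of two edge-labelled graphs. -/
def disjUnion (G : LGraph V A) (H : LGraph W A) : LGraph (V ⊕ W) A := ⟨DisjE G H⟩

/-- `R` is a bisimulation on `G`. -/
def IsBisimulation (G : LGraph V A) (R : V → V → Prop) : Prop :=
  ∀ u v, R u v →
    (∀ a u', G.E u a u' → ∃ v', G.E v a v' ∧ R u' v') ∧
    (∀ a v', G.E v a v' → ∃ u', G.E u a u' ∧ R u' v')

/-- Two nodes of `G` are bisimilar if some bisimulation relates them. -/
def Bisimilar (G : LGraph V A) (u v : V) : Prop := ∃ R, G.IsBisimulation R ∧ R u v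

end LGraph

/-! ### Graphs as pointer structures and the bisimulation problem as a language -/

/-- Names (of nodes, of edge labels, of gates) are arbitrary bit strings. -/
abbrev Name := List Bool

/-- A finite edge-labelled graph as a pointer structure: a list of node names and a list of
edges `(u, a, v)`. The lists stand for the sets of their members. -/
structure PointerGraph where
  nodes : List Name
  edges : List (Name × Name × Name)
  source_mem : ∀ e ∈ edges, e.1 ∈ nodes
  target_mem : ∀ e ∈ edges, e.2.2 ∈ nodes

/-- The nodes of a pointer structure. -/
abbrev PointerGraph.Vertex (G : PointerGraph) : Type := {u : Name // u ∈ G.nodes}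

/-- The edge-labelled graph given by a pointer structure. -/
def PointerGraph.toLGraph (G : PointerGraph) : LGraph G.Vertex Name :=
  ⟨fun u a v => (u.1, a, v.1) ∈ G.edges⟩

/-- The alphabet in which inputs are written: bits, a separator within an edge, an end marker for
list entries, and an end marker for lists. -/
inductive Sym
  | bit (b : Bool)
  | comma
  | semi
  | bar

/-- The block code of the input alphabet, three bits per symbol. -/
def Sym.toBits : Sym → List Bool
  | .bit b => [false, false, b]
  | .comma => [false, true, false]
  | .semi => [false, true, true]
  | .bar => [true, false, false]

/-- A name as a word over the input alphabet. -/
def nameSyms (u : Name) : List Sym := u.map Sym.bit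

/-- A pointer structure is written `u₁; u₂; … | u,a,v; u',a',v'; … |`. -/
def PointerGraph.syms (G : PointerGraph) : List Sym :=
  G.nodes.flatMap (fun u => nameSyms u ++ [Sym.semi]) ++ [Sym.bar] ++
  G.edges.flatMap (fun e => nameSyms e.1 ++ [Sym.comma] ++ nameSyms e.2.1 ++ [Sym.comma] ++
    nameSyms e.2.2 ++ [Sym.semi]) ++ [Sym.bar]

/-- The bit string that encodes two graphs and a node of each: the two pointer structures one
after the other, followed by `v₁; v₂;`. -/
def encodeInstance (G₁ G₂ : PointerGraph) (v₁ v₂ : Name) : List Bool :=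
  (G₁.syms ++ G₂.syms ++ nameSyms v₁ ++ [Sym.semi] ++ nameSyms v₂ ++ [Sym.semi]).flatMap Sym.toBits

/-- The bisimulation problem for two classes of graphs: given `G₁ ∈ C₁`, `G₂ ∈ C₂` and nodes
`v₁` of `G₁` and `v₂` of `G₂`, are `v₁` and `v₂` bisimilar (in the disjoint union)? -/
def bisim (C₁ C₂ : Set PointerGraph) : Language Bool :=
  {w | ∃ G₁ ∈ C₁, ∃ G₂ ∈ C₂, ∃ (v₁ : G₁.Vertex) (v₂ : G₂.Vertex),
    w = encodeInstance G₁ G₂ v₁.1 v₂.1 ∧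
    (G₁.toLGraph.disjUnion G₂.toLGraph).Bisimilar (Sum.inl v₁) (Sum.inr v₂)}

/-- The class of all finite edge-labelled graphs. -/
def graphs : Set PointerGraph := Set.univ

/-- The class of all finite edge-labelled trees. -/
def trees : Set PointerGraph := {G | G.toLGraph.IsTree}

/-! ### Boolean circuits of unbounded fan-in -/

/-- A gate of a circuit with `n` input bits: the literal `x_i` (`lit i true`) or `¬ x_i`
(`lit i false`), or a conjunction or disjunction of any finite number of gates. The constants
`1` and `0` are the conjunction and the disjunction of no gates. -/
inductive Gate (n : ℕ)
  | lit (i : Fin n) (b : Bool)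
  | and (ins : List Name)
  | or (ins : List Name)

namespace Gate

variable {n : ℕ}

/-- The gates that feed a gate. -/
def inputs : Gate n → List Name
  | lit _ _ => []
  | and ins => ins
  | or ins => ins

/-- The value of a gate on input `x`, given the values of the gates that feed it. -/
def eval (x : Fin n → Bool) (val : Name → Bool) : Gate n → Bool
  | lit i b => x i == b
  | and ins => ins.all val
  | or ins => ins.any val

/-- The length of a longest path that ends in a gate, given these lengths for the gates that
feed it. -/
def depth (d : Name → ℕ) (g : Gate n) : ℕ :=
  (g.inputs.map fun h => d h + 1).foldr max 0

end Gate

/-- A circuit with `n` input bits: its gates with their names, and the name of its output gate.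
Acyclicity is expressed by the order of the list: a gate is listed after all gates that feed it. -/
structure Circuit (n : ℕ) where
  gates : List (Name × Gate n)
  output : Name
  nodup : (gates.map Prod.fst).Nodup
  acyclic : ∀ l₁ e l₂, gates = l₁ ++ e :: l₂ → ∀ h ∈ e.2.inputs, h ∈ l₁.map Prod.fst
  output_mem : output ∈ gates.map Prod.fst

namespace Circuit

variable {n : ℕ}

/-- The values of all gates on input `x`, computed along the list of gates. -/
def values (C : Circuit n) (x : Fin n → Bool) : Name → Bool :=
  C.gates.foldl (fun val e => Function.update val e.1 (e.2.eval x val)) (fun _ => false)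

/-- The circuit accepts the input `x`. -/
def Accepts (C : Circuit n) (x : Fin n → Bool) : Prop := C.values x C.output = true

/-- The depths of all gates, computed along the list of gates. -/
def depths (C : Circuit n) : Name → ℕ :=
  C.gates.foldl (fun d e => Function.update d e.1 (e.2.depth d)) (fun _ => 0)

/-- The depth of a circuit is the length of a longest path in it. -/
def depth (C : Circuit n) : ℕ := (C.gates.map fun e => C.depths e.1).foldr max 0

/-- The size of a circuit is its number of gates. -/
def size (C : Circuit n) : ℕ := C.gates.length

end Circuit

/-- The alphabet in which circuits are written. -/
inductive CSym
  | bit (b : Bool)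
  | pos
  | neg
  | and
  | or
  | comma
  | semi

/-- A gate, written as its type and its arguments: the index of an input bit in binary (least
significant bit first), or the names of the gates that feed it. -/
def Gate.syms {n : ℕ} : Gate n → List CSym
  | .lit i b => (if b then CSym.pos else CSym.neg) :: (Nat.bits i).map CSym.bit
  | .and ins => CSym.and :: ins.flatMap fun h => h.map CSym.bit ++ [CSym.comma]
  | .or ins => CSym.or :: ins.flatMap fun h => h.map CSym.bit ++ [CSym.comma]

/-- A circuit, written as the name of its output gate followed by the list of its gates. -/
def Circuit.syms {n : ℕ} (C : Circuit n) : List CSym :=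
  C.output.map CSym.bit ++ [CSym.semi] ++
  C.gates.flatMap fun e => e.1.map CSym.bit ++ e.2.syms ++ [CSym.semi]

/-! ### Logspace transducers -/

/-- Head movements. -/
inductive Move
  | left
  | stay
  | right

/-- A head movement on the cells `0, 1, 2, …`; a head on cell `0` cannot move left. -/
def Move.apply : Move → ℕ → ℕ
  | .left, p => p - 1
  | .stay, p => p
  | .right, p => p + 1

/-- What the input head reads: a letter of the input, or one of the two end markers. -/
inductive InSym (I : Type)
  | leftEnd
  | letter (a : I)
  | rightEnd

/-- The content of cell `p` of the input tape, which holds `w` between two end markers. -/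
def readInput {I : Type} (w : List I) : ℕ → InSym I
  | 0 => .leftEnd
  | p + 1 => match w[p]? with
    | some a => .letter a
    | none => .rightEnd

/-- A deterministic Turing machine with a read-only two-way input tape, finitely many one-way
infinite work tapes and a write-only output tape. In each step it reads the scanned input symbol
and the scanned work symbols, and either halts or changes its state, moves the input head,
overwrites the scanned work symbols, moves the work heads and appends at most one letter to the
output. -/
structure Transducer (I O : Type) where
  /-- states -/
  Q : Type
  /-- work symbols -/
  Γ : Type
  finite_Q : Finite Q
  finite_Γ : Finite Γ
  /-- number of work tapes -/
  k : ℕ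
  start : Q
  blank : Γ
  δ : Q → InSym I → (Fin k → Γ) → Option (Q × Move × (Fin k → Γ × Move) × Option O)

namespace Transducer

variable {I O : Type}

/-- Configurations of a transducer. -/
structure Config (M : Transducer I O) where
  state : M.Q
  inHead : ℕ
  heads : Fin M.k → ℕ
  tapes : Fin M.k → ℕ → M.Γ
  out : List O

/-- The initial configuration: the input head is on the left end marker, the work tapes are
blank. -/
def init (M : Transducer I O) : M.Config where
  state := M.start
  inHead := 0
  heads := fun _ => 0
  tapes := fun _ _ => M.blank
  out := []

/-- One step on input `w`; `none` if the machine halts. The input head does not move beyond the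
right end marker. -/
def step (M : Transducer I O) (w : List I) (c : M.Config) : Option M.Config :=
  (M.δ c.state (readInput w c.inHead) (fun i => c.tapes i (c.heads i))).map fun r =>
    { state := r.1
      inHead := min (r.2.1.apply c.inHead) (w.length + 1)
      heads := fun i => (r.2.2.1 i).2.apply (c.heads i)
      tapes := fun i => Function.update (c.tapes i) (c.heads i) (r.2.2.1 i).1
      out := c.out ++ r.2.2.2.toList }

/-- On input `w` the machine halts with output `y`, and visits only the first `s` cells of each
work tape. -/
def ComputesInSpace (M : Transducer I O) (w : List I) (y : List O) (s : ℕ) : Prop :=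
  (∃ c, StateTransition.Reaches (M.step w) M.init c ∧ M.step w c = none ∧ c.out = y) ∧
  ∀ c, StateTransition.Reaches (M.step w) M.init c → ∀ i, c.heads i < s

end Transducer

/-- The functions computed by a logspace transducer. -/
def LogspaceComputable {I O : Type} (f : List I → List O) : Prop :=
  ∃ (M : Transducer I O) (c : ℕ), ∀ w, M.ComputesInSpace w (f w) (c * (Nat.log 2 w.length + 1))

/-! ### The circuit complexity classes -/

/-- A circuit family is logspace-uniform if a logspace transducer computes (a description of) the
`n`-th circuit from the unary encoding of `n`. -/
def LogspaceUniform (C : ∀ n, Circuit n) : Prop :=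
  LogspaceComputable fun w : List Unit => (C w.length).syms

/-- Logspace-uniform `AC^i`: the languages accepted by logspace-uniform circuit families of
unbounded fan-in, size `n^{O(1)}` and depth `O((log n)^i)`. -/
def AC (i : ℕ) : Set (Language Bool) :=
  {L | ∃ C : ∀ n, Circuit n,
    (∃ c, ∀ n, (C n).size ≤ c * (n + 1) ^ c) ∧
    (∃ c, ∀ n, (C n).depth ≤ c * (Nat.log 2 n + 1) ^ i) ∧
    (∀ w : List Bool, (C w.length).Accepts w.get ↔ w ∈ L) ∧
    LogspaceUniform C}

end BisimAC

namespace BisimAC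

/-! ### Counter programs -/

/-! A tree node `t` and a node `h` fail to be bisimilar if and only if some child of `t` differs
from all equally labelled successors of `h`, or some successor of `h` differs from all equally
labelled children of `t`. Evaluated level by level, this recursion takes as many rounds as the tree
is high. Tree contraction makes the number of rounds logarithmic.

Fix a child `c` of `t` and suppose that everything about its siblings is known. Then "`t` differs
from `h`" can be written as "for some `h'` there is a step from `h` to `h'`, and `c` differs from
`h'`", where the step depends on the siblings only. The obstacle is the universal reason "`c`
differs from every `a`-successor of `h`". If some `a`-successor `h'` differs from all `a`-labelled
siblings of `c`, then it is enough that `c` differs from this one `h'`. Otherwise every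
`a`-successor is bisimilar to a sibling `s`, and by transitivity `c` differs from it if and only if
`c` differs from `s`, which is a fact about `s`. Steps that hold unconditionally lead to the node
`bot`, which differs from every tree node. This is `Arena.Forest.apart_iff_step`. The influence of a
descendant `u` on `t` is therefore reachability by such steps, and it composes with a single
existential quantifier (`Arena.Forest.reduce_comp`, `Arena.Forest.apart_iff_reduce`).

By induction on `j`, `O(j)` rounds of inference settle all subtrees with at most `2 ^ j` nodes and
all paths from `t` to `u` that skip at most `2 ^ j` nodes (`Arena.Forest.known`). A larger subtree
is cut at a node that is heavy while its children are light (`Arena.Forest.exists_centroid`), a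
longer path at an edge (`Arena.exists_split`). Evaluation in rounds starts from empty relations and
can only add facts, so the rules must be positive. This is why difference and bisimilarity, and
possible and impossible reductions, are inferred as separate relations.

The rules, and the test that the input encodes an instance whose first graph is a tree, are
first-order formulas over input positions (`Fml.sat_rules`, `Fml.sat_valid`, `Fml.sat_answer`).
Unfolding a fixed system of such formulas for `O(log n)` rounds gives circuits with one gate for
each round, subformula and assignment, hence of polynomial size and logarithmic depth
(`FmlSystem.values_circuit`). Their descriptions are written by nested loops over counters of size
`O(n)`, and such counter programs are compiled to transducers that keep the counters in binary
(`logspaceComputable_of_exec`). -/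

/-- Operations on a single counter. -/
inductive CounterOp (O : Type)
  | inc
  | dec
  | bits (f : Bool → O)

/-- Structured counter programs with counters `ι` and output letters `O`. -/
inductive Cmd (ι O : Type)
  | skip
  | prim (i : ι) (op : CounterOp O)
  | out (o : O)
  | load (i : ι)
  | seq (p q : Cmd ι O)
  | ite (i : ι) (p q : Cmd ι O)
  | loop (i : ι) (p : Cmd ι O)

section Exec

variable {ι O : Type} [DecidableEq ι]

/-- `Exec B p σ o σ'`: the program `p`, started with counters `σ`, ends with counters `σ'` and
writes `o`; no counter exceeds `B` in between. -/
inductive Exec (B : ℕ) : Cmd ι O → (ι → ℕ) → List O → (ι → ℕ) → Prop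
  | skip {σ} : Exec B .skip σ [] σ
  | inc {σ i} : σ i + 1 ≤ B → Exec B (.prim i .inc) σ [] (Function.update σ i (σ i + 1))
  | dec {σ i v} : σ i = v + 1 → σ i ≤ B → Exec B (.prim i .dec) σ [] (Function.update σ i v)
  | bits {σ i f} : σ i ≤ B → Exec B (.prim i (.bits f)) σ ((Nat.bits (σ i)).map f) σ
  | out {σ o} : Exec B (.out o) σ [o] σ
  | seq {p q σ σ' σ'' o o'} : Exec B p σ o σ' → Exec B q σ' o' σ'' →
      Exec B (.seq p q) σ (o ++ o') σ''
  | ite_zero {i p q σ σ' o} : σ i = 0 → Exec B p σ o σ' → Exec B (.ite i p q) σ o σ'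
  | ite_pos {i p q σ σ' o} : σ i ≠ 0 → Exec B q σ o σ' → Exec B (.ite i p q) σ o σ'
  | loop_zero {i p σ} : σ i = 0 → Exec B (.loop i p) σ [] σ
  | loop_pos {i p σ σ' σ'' o o'} : σ i ≠ 0 → Exec B p σ o σ' → Exec B (.loop i p) σ' o' σ'' →
      Exec B (.loop i p) σ (o ++ o') σ''

end Exec

/-! ### Compilation of counter programs to transducers -/

/-- Work tape symbols. -/
inductive Cell
  | blank
  | digit (b : Bool)
  | mark

/-- The phases in the execution of a single command. -/
inductive Phase
  | boot
  | entry
  | walk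
  | back
  | peek
  | trim

instance : Finite Cell :=
  Finite.of_surjective (fun x : Option (Option Bool) => match x with
    | none => Cell.blank | some none => .mark | some (some b) => .digit b)
    (by rintro (_ | b | _); exacts [⟨none, rfl⟩, ⟨some (some b), rfl⟩, ⟨some none, rfl⟩])

instance : Finite Phase :=
  Finite.of_surjective (fun x : Fin 6 => match x with
    | 0 => Phase.boot | 1 => .entry | 2 => .walk | 3 => .back | 4 => .peek | 5 => .trim)
    (by rintro (_ | _ | _ | _ | _ | _)
        exacts [⟨0, rfl⟩, ⟨1, rfl⟩, ⟨2, rfl⟩, ⟨3, rfl⟩, ⟨4, rfl⟩, ⟨5, rfl⟩])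

section Compile

variable {ι O I : Type}

/-- The continuations that can occur when `p` is run with continuation `k`. -/
def conts : Cmd ι O → List (Cmd ι O) → Set (List (Cmd ι O))
  | .seq p q, k => insert (.seq p q :: k) (conts p (q :: k) ∪ conts q k)
  | .ite i p q, k => insert (.ite i p q :: k) (conts p k ∪ conts q k)
  | .loop i p, k => insert (.loop i p :: k) (conts p (.loop i p :: k))
  | .load i, k => {.load i :: k, .prim i .inc :: .load i :: k}
  | .skip, k => {.skip :: k}
  | .prim i op, k => {.prim i op :: k}
  | .out o, k => {.out o :: k}

/-- The control of the compiled machine is finite: `conts` recurses on the command, and the body of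
a loop runs with the loop itself put back on the continuation, so repetition creates no new
continuations. -/
theorem conts_finite (p : Cmd ι O) : ∀ k, (conts p k).Finite := by
  induction p with
  | seq p q hp hq => exact fun k => ((hp _).union (hq _)).insert _
  | ite i p q hp hq => exact fun k => ((hp _).union (hq _)).insert _
  | loop i p hp => exact fun k => (hp _).insert _
  | _ => intro k; simp [conts]

theorem mem_conts (p : Cmd ι O) (k : List (Cmd ι O)) : p :: k ∈ conts p k := by
  cases p <;> simp [conts]

/-- The continuations of the compiled machine. -/
def allConts (p : Cmd ι O) : Set (List (Cmd ι O)) := insert [] (conts p [])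

open Classical in
/-- A list of commands as a continuation of the compiled machine. -/
noncomputable def toCont (p : Cmd ι O) (k : List (Cmd ι O)) : allConts p :=
  if h : k ∈ allConts p then ⟨k, h⟩ else ⟨[], Or.inl rfl⟩

theorem coe_toCont {p : Cmd ι O} {k : List (Cmd ι O)} (h : k ∈ allConts p) :
    (toCont p k).1 = k := by
  simp [toCont, h]

variable [Fintype ι]

/-- Write `g` on the tape of counter `i` and move its head; the other tapes are left alone. -/
noncomputable def onTape (r : Fin (Fintype.card ι) → Cell) (i : ι) (g : Cell) (m : Move) :
    Fin (Fintype.card ι) → Cell × Move :=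
  fun j => if j = Fintype.equivFin ι i then (g, m) else (r j, .stay)

/-- The transition function of the compiled machine, before states are restricted to a finite
set. -/
noncomputable def trans (ph : Phase) (k : List (Cmd ι O)) (a : InSym I)
    (r : Fin (Fintype.card ι) → Cell) :
    Option ((Phase × List (Cmd ι O)) × Move × (Fin (Fintype.card ι) → Cell × Move) × Option O) :=
  let idle : Fin (Fintype.card ι) → Cell × Move := fun j => (r j, .stay)
  match ph, k with
  | .boot, k => some ((.entry, k), .stay, fun _ => (.mark, .stay), none)
  | .entry, .skip :: k => some ((.entry, k), .stay, idle, none)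
  | .entry, .out o :: k => some ((.entry, k), .stay, idle, some o)
  | .entry, .seq p q :: k => some ((.entry, p :: q :: k), .stay, idle, none)
  | .entry, .load i :: k => match a with
    | .leftEnd => some ((.entry, .load i :: k), .right, idle, none)
    | .letter _ => some ((.entry, .prim i .inc :: .load i :: k), .right, idle, none)
    | .rightEnd => some ((.entry, k), .stay, idle, none)
  | .entry, .prim i op :: k => some ((.walk, .prim i op :: k), .stay,
      onTape r i (r (Fintype.equivFin ι i)) .right, none)
  | .entry, .ite i p q :: k => some ((.walk, .ite i p q :: k), .stay,
      onTape r i (r (Fintype.equivFin ι i)) .right, none)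
  | .entry, .loop i p :: k => some ((.walk, .loop i p :: k), .stay,
      onTape r i (r (Fintype.equivFin ι i)) .right, none)
  | .walk, .ite i p q :: k => match r (Fintype.equivFin ι i) with
    | .blank => some ((.entry, p :: k), .stay, onTape r i .blank .left, none)
    | g => some ((.entry, q :: k), .stay, onTape r i g .left, none)
  | .walk, .loop i p :: k => match r (Fintype.equivFin ι i) with
    | .blank => some ((.entry, k), .stay, onTape r i .blank .left, none)
    | g => some ((.entry, p :: .loop i p :: k), .stay, onTape r i g .left, none)
  | .walk, .prim i .inc :: k => match r (Fintype.equivFin ι i) with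
    | .digit true => some ((.walk, .prim i .inc :: k), .stay, onTape r i (.digit false) .right, none)
    | _ => some ((.back, .prim i .inc :: k), .stay, onTape r i (.digit true) .left, none)
  | .walk, .prim i .dec :: k => match r (Fintype.equivFin ι i) with
    | .digit false => some ((.walk, .prim i .dec :: k), .stay, onTape r i (.digit true) .right, none)
    | _ => some ((.peek, .prim i .dec :: k), .stay, onTape r i (.digit false) .right, none)
  | .walk, .prim i (.bits f) :: k => match r (Fintype.equivFin ι i) with
    | .digit b => some ((.walk, .prim i (.bits f) :: k), .stay, onTape r i (.digit b) .right,
        some (f b))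
    | g => some ((.back, .prim i (.bits f) :: k), .stay, onTape r i g .left, none)
  | .peek, .prim i op :: k => match r (Fintype.equivFin ι i) with
    | .blank => some ((.trim, .prim i op :: k), .stay, onTape r i .blank .left, none)
    | g => some ((.back, .prim i op :: k), .stay, onTape r i g .left, none)
  | .trim, .prim i op :: k =>
      some ((.back, .prim i op :: k), .stay, onTape r i .blank .left, none)
  | .back, .prim i op :: k => match r (Fintype.equivFin ι i) with
    | .mark => some ((.entry, k), .stay, onTape r i .mark .stay, none)
    | g => some ((.back, .prim i op :: k), .stay, onTape r i g .left, none)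
  | _, _ => none

/-- The transducer that runs a counter program. -/
noncomputable def compile (I : Type) (p : Cmd ι O) : Transducer I O where
  Q := Phase × allConts p
  Γ := Cell
  finite_Q := by
    have : Finite (allConts p) := ((conts_finite p []).insert []).to_subtype
    infer_instance
  finite_Γ := inferInstance
  k := Fintype.card ι
  start := (.boot, toCont p [p])
  blank := .blank
  δ q a r := (trans q.1 q.2.1 a r).map fun x => ((x.1.1, toCont p x.1.2), x.2)

/-- Cells with the binary digits of a number. -/
def digitCell : Option Bool → Cell
  | none => .blank
  | some b => .digit b

/-- A tape that holds a list of digits after the mark. -/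
def digitTape (l : List Bool) : ℕ → Cell
  | 0 => .mark
  | j + 1 => digitCell l[j]?

theorem update_digitTape (pre l : List Bool) (b b' : Bool) :
    Function.update (digitTape (pre ++ b :: l)) (pre.length + 1) (.digit b') =
      digitTape (pre ++ b' :: l) := by
  funext j
  rcases j with _ | j
  · simp [digitTape]
  · by_cases h : j = pre.length
    · subst h; simp [digitTape, digitCell]
    · rw [Function.update_of_ne (by simpa using h)]
      simp only [digitTape, List.getElem?_append]
      split_ifs with h'
      · rfl
      · obtain ⟨m, hm⟩ : ∃ m, j - pre.length = m + 1 := ⟨j - pre.length - 1, by omega⟩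
        simp [hm]

theorem update_digitTape_append (pre : List Bool) (b : Bool) :
    Function.update (digitTape pre) (pre.length + 1) (.digit b) = digitTape (pre ++ [b]) := by
  funext j
  rcases j with _ | j
  · simp [digitTape]
  · by_cases h : j = pre.length
    · subst h; simp [digitTape, digitCell]
    · rw [Function.update_of_ne (by simpa using h)]
      simp only [digitTape, List.getElem?_append]
      split_ifs with h'
      · rfl
      · obtain ⟨m, hm⟩ : ∃ m, j - pre.length = m + 1 := ⟨j - pre.length - 1, by omega⟩
        rw [List.getElem?_eq_none (by omega)]
        simp [hm]

theorem update_digitTape_blank (pre : List Bool) (b : Bool) :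
    Function.update (digitTape (pre ++ [b])) (pre.length + 1) .blank = digitTape pre := by
  rw [← update_digitTape_append]
  simp only [Function.update_idem]
  refine Function.update_eq_self_iff.2 ?_
  simp [digitTape, digitCell]

/-- A configuration at phase `ph` with continuation `k`, input head at `x`, counters `σ`, except
that tape `i` holds `t` with its head on cell `a`; the output so far is `o`. -/
noncomputable def midConf (I : Type) (p : Cmd ι O) (ph : Phase) (k : List (Cmd ι O)) (x : ℕ)
    (σ : ι → ℕ) (i : ι) (a : ℕ) (t : ℕ → Cell) (o : List O) : (compile I p).Config where
  state := (ph, toCont p k)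
  inHead := x
  heads := fun j : Fin (Fintype.card ι) => if j = Fintype.equivFin ι i then a else 0
  tapes := fun j : Fin (Fintype.card ι) => if j = Fintype.equivFin ι i then t else
    digitTape (Nat.bits (σ ((Fintype.equivFin ι).symm j)))
  out := o

/-- A configuration at which all work heads are on cell `0`. -/
noncomputable def restConf (I : Type) (p : Cmd ι O) (ph : Phase) (k : List (Cmd ι O)) (x : ℕ)
    (σ : ι → ℕ) (o : List O) : (compile I p).Config where
  state := (ph, toCont p k)
  inHead := x
  heads _ := 0
  tapes := fun j : Fin (Fintype.card ι) => digitTape (Nat.bits (σ ((Fintype.equivFin ι).symm j)))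
  out := o

variable [DecidableEq ι]

theorem midConf_update (p : Cmd ι O) (ph : Phase) (k : List (Cmd ι O)) (x : ℕ)
    (σ : ι → ℕ) (i : ι) (v : ℕ) (o : List O) :
    midConf I p ph k x σ i 0 (digitTape (Nat.bits v)) o =
      restConf I p ph k x (Function.update σ i v) o := by
  have h1 : (fun j : Fin (Fintype.card ι) => if j = Fintype.equivFin ι i then 0 else 0) =
      fun _ => 0 := by simp
  have h2 : (fun j : Fin (Fintype.card ι) => if j = Fintype.equivFin ι i then
      digitTape (Nat.bits v) else digitTape (Nat.bits (σ ((Fintype.equivFin ι).symm j)))) =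
      fun j => digitTape (Nat.bits (Function.update σ i v ((Fintype.equivFin ι).symm j))) := by
    funext j
    by_cases h : j = Fintype.equivFin ι i
    · simp [h]
    · rw [if_neg h, Function.update_of_ne]
      intro h'; apply h; rw [← h']; simp
  simp only [midConf, restConf]
  congr 1

theorem midConf_self (p : Cmd ι O) (ph : Phase) (k : List (Cmd ι O)) (x : ℕ)
    (σ : ι → ℕ) (i : ι) (o : List O) :
    midConf I p ph k x σ i 0 (digitTape (Nat.bits (σ i))) o = restConf I p ph k x σ o := by
  rw [midConf_update, Function.update_eq_self]

/-! ### Runs in bounded space. -/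

namespace Transducer

/-- Steps of a machine that start with all work heads among the first `s` cells. -/
def BoundedStep (M : Transducer I O) (w : List I) (s : ℕ) (c c' : M.Config) : Prop :=
  M.step w c = some c' ∧ ∀ i, c.heads i < s

/-- Runs of a machine within the first `s` cells of each work tape. -/
abbrev BoundedRun (M : Transducer I O) (w : List I) (s : ℕ) : M.Config → M.Config → Prop :=
  Relation.ReflTransGen (M.BoundedStep w s)

/-- The machine is deterministic: every reachable configuration lies on the one halting run, so the
bound along this run covers them all. -/
theorem computesInSpace_of_boundedRun {M : Transducer I O} {w : List I} {s : ℕ} {c : M.Config}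
    (h : M.BoundedRun w s M.init c) (hc : M.step w c = none) (hs : ∀ i, c.heads i < s) :
    M.ComputesInSpace w c.out s := by
  refine ⟨⟨c, ?_, hc, rfl⟩, ?_⟩
  · exact Relation.ReflTransGen.mono (fun a b hab => by simpa using hab.1) _ _ h
  · intro d hd
    have key : M.BoundedRun w s d c := by
      induction hd with
      | refl => exact h
      | tail _ hstep ih =>
        rcases Relation.ReflTransGen.cases_head ih with h | ⟨e, he, hec⟩
        · subst h; simp [hc] at hstep
        · have := he.1.symm.trans hstep
          simp only [Option.some.injEq] at this
          exact this ▸ hec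
    rcases Relation.ReflTransGen.cases_head key with h | ⟨e, he, _⟩
    · exact h ▸ hs
    · exact he.2

end Transducer

/-! ### Simulation of counter programs by the compiled machine. -/

open Transducer

variable {P : Cmd ι O} {w : List I} {s : ℕ}

/-- A phase that works on a counter touches one tape only, so a transition has to be checked only
against the symbol under the head of that tape. The bound on `x` makes the truncation at the right
end marker harmless. -/
theorem step_midConf {ph ph' : Phase} {k k' : List (Cmd ι O)} {x : ℕ} {σ : ι → ℕ} {i : ι}
    {a : ℕ} {t : ℕ → Cell} {o : List O} {g : Cell} {m : Move} {e : Option O}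
    (hk : k ∈ allConts P) (hs : a < s) (hx : x ≤ w.length + 1)
    (h : ∀ (b : InSym I) r, r (Fintype.equivFin ι i) = t a →
      trans ph k b r = some ((ph', k'), .stay, onTape r i g m, e)) :
    (compile I P).BoundedStep w s (midConf I P ph k x σ i a t o)
      (midConf I P ph' k' x σ i (m.apply a) (Function.update t a g) (o ++ e.toList)) := by
  refine ⟨?_, fun j => ?_⟩
  · simp only [Transducer.step, compile, midConf, coe_toCont hk]
    rw [h _ _ (by simp)]
    simp only [Option.map_some, Option.some.injEq, Move.apply]
    congr 1
    · omega
    · funext j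
      simp only [onTape]; split_ifs <;> rfl
    · funext j
      by_cases hj : j = Fintype.equivFin ι i
      · simp [onTape, hj]
      · simp [onTape, hj]
  · simp only [midConf]
    split_ifs
    · exact hs
    · omega

theorem step_restConf {ph ph' : Phase} {k k' : List (Cmd ι O)} {x : ℕ} {σ : ι → ℕ}
    {o : List O} {m : Move} {e : Option O}
    (hk : k ∈ allConts P) (hs : 0 < s)
    (h : ∀ r : Fin (Fintype.card ι) → Cell,
      trans ph k (readInput w x) r = some ((ph', k'), m, fun j => (r j, .stay), e)) :
    (compile I P).BoundedStep w s (restConf I P ph k x σ o)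
      (restConf I P ph' k' (min (m.apply x) (w.length + 1)) σ (o ++ e.toList)) := by
  refine ⟨?_, fun j => hs⟩
  simp only [Transducer.step, compile, restConf, coe_toCont hk]
  rw [h]
  simp [Move.apply]

theorem run_back {i : ι} {op : CounterOp O} {k : List (Cmd ι O)} {x : ℕ} {σ : ι → ℕ} {v : ℕ}
    {o : List O} (hk : .prim i op :: k ∈ allConts P) (hx : x ≤ w.length + 1) (a : ℕ)
    (hs : a < s) :
    (compile I P).BoundedRun w s
      (midConf I P .back (.prim i op :: k) x σ i a (digitTape (Nat.bits v)) o)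
      (restConf I P .entry k x (Function.update σ i v) o) := by
  induction a with
  | zero =>
    rw [← midConf_update]
    refine .single ?_
    have := step_midConf (w := w) (i := i) (P := P) (ph := .back) (ph' := .entry) (k' := k) (x := x) (σ := σ)
      (t := digitTape (Nat.bits v)) (o := o) (g := .mark) (m := .stay) (e := none) hk hs hx
      (by intro b r hr; simp [trans, hr, digitTape])
    have h1 : digitTape (Nat.bits v) 0 = .mark := rfl
    rw [← h1, Function.update_eq_self] at this
    simpa [Move.apply] using this
  | succ a ih =>
    refine .head ?_ (ih (by omega))
    have := step_midConf (w := w) (i := i) (P := P) (ph := .back) (ph' := .back) (k' := .prim i op :: k)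
      (x := x) (σ := σ)
      (t := digitTape (Nat.bits v)) (o := o) (g := digitTape (Nat.bits v) (a + 1)) (m := .left)
      (e := none) hk hs hx
      (by
        intro b r hr
        simp only [trans, hr]
        simp only [digitTape]
        cases (Nat.bits v)[a]? <;> simp [digitCell])
    simpa [Move.apply] using this

/-- The binary successor on lists of digits, least significant digit first. -/
def incDigits : List Bool → List Bool
  | [] => [true]
  | false :: l => true :: l
  | true :: l => false :: incDigits l

theorem bits_succ (v : ℕ) : Nat.bits (v + 1) = incDigits (Nat.bits v) := by
  induction v using Nat.binaryRec' with
  | zero => simp [incDigits]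
  | bit b n h ih =>
    rw [Nat.bits_append_bit n b h]
    cases b
    · have : Nat.bit false n + 1 = Nat.bit true n := by simp [Nat.bit]
      rw [this, Nat.bits_append_bit n true (by simp)]; rfl
    · have : Nat.bit true n + 1 = Nat.bit false (n + 1) := by simp [Nat.bit]; omega
      rw [this, Nat.bits_append_bit _ false (by simp), ih]; rfl

theorem length_le_length_incDigits (l : List Bool) : l.length ≤ (incDigits l).length := by
  induction l using incDigits.induct <;> simp_all [incDigits]

/-- `pre` is the part that the carry has already rewritten, `l` the part still ahead. -/
theorem run_inc {i : ι} {k : List (Cmd ι O)} {x : ℕ} {σ : ι → ℕ} {v : ℕ} {o : List O}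
    (hk : .prim i .inc :: k ∈ allConts P) (hx : x ≤ w.length + 1) (l : List Bool) :
    ∀ pre : List Bool, pre ++ incDigits l = Nat.bits v → (Nat.bits v).length + 2 < s →
    (compile I P).BoundedRun w s
      (midConf I P .walk (.prim i .inc :: k) x σ i (pre.length + 1) (digitTape (pre ++ l)) o)
      (restConf I P .entry k x (Function.update σ i v) o) := by
  -- The carry stops at the first cell that is not `true`; a digit `false` and the blank behind the
  -- last digit are treated alike.
  have key : ∀ (pre : List Bool) (t : ℕ → Cell), t (pre.length + 1) ≠ .digit true →
      Function.update t (pre.length + 1) (.digit true) = digitTape (Nat.bits v) →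
      pre.length + 1 < s →
      (compile I P).BoundedRun w s
        (midConf I P .walk (.prim i .inc :: k) x σ i (pre.length + 1) t o)
        (restConf I P .entry k x (Function.update σ i v) o) := by
    intro pre t ht htv hs
    refine .head ?_ (run_back (P := P) hk hx pre.length (by omega))
    have := step_midConf (w := w) (i := i) (P := P) (ph := .walk) (ph' := .back) (k' := .prim i .inc :: k)
      (x := x) (σ := σ) (t := t) (o := o) (g := .digit true) (m := .left) (e := none) hk hs hx
      (by
        intro b r hr
        simp only [trans, hr])
    simpa [Move.apply, htv] using this
  induction l using incDigits.induct with
  | case1 =>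
    intro pre h hs
    simp only [incDigits] at h
    apply key
    · simp [digitTape, digitCell]
    · rw [List.append_nil, update_digitTape_append, h]
    · simp only [← h, List.length_append] at hs; omega
  | case2 l =>
    intro pre h hs
    simp only [incDigits] at h
    apply key
    · simp [digitTape, digitCell]
    · rw [update_digitTape, h]
    · simp only [← h, List.length_append] at hs; omega
  | case3 l ih =>
    intro pre h hs
    simp only [incDigits] at h
    have h2 := ih (pre ++ [false]) (by simpa using h) hs
    refine .head ?_ h2
    have := step_midConf (w := w) (i := i) (P := P) (ph := .walk) (ph' := .walk) (k' := .prim i .inc :: k)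
      (x := x) (σ := σ) (a := pre.length + 1) (s := s)
      (t := digitTape (pre ++ true :: l)) (o := o) (g := .digit false) (m := .right)
      (e := none) hk (by simp only [← h, List.length_append] at hs; omega) hx
      (by
        intro b r hr
        simp [trans, hr, digitTape, digitCell])
    simpa [Move.apply, update_digitTape] using this

/-- The most significant digit is `true`. Decrementing needs this to decide when a digit has to be
erased. -/
theorem bits_ne_append_false (v : ℕ) (l : List Bool) : Nat.bits v ≠ l ++ [false] := by
  induction l generalizing v with
  | nil =>
    induction v using Nat.binaryRec' with
    | zero => simp
    | bit b n h ih => 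
      rw [Nat.bits_append_bit n b h]
      intro h'
      simp only [List.nil_append, List.cons.injEq] at h'
      have : n = 0 := by
        have := h'.2
        rcases n with _ | n
        · rfl
        · rw [bits_succ] at this
          cases hh : Nat.bits n with
          | nil => simp [hh, incDigits] at this
          | cons b l => cases b <;> simp [hh, incDigits] at this
      simp [h'.1] at h; exact h this
  | cons a l ih =>
    induction v using Nat.binaryRec' with
    | zero => simp
    | bit b n h _ =>
      rw [Nat.bits_append_bit n b h]
      intro h'
      simp only [List.cons_append, List.cons.injEq] at h'
      exact ih n h'.2

/-- Decrementing undoes `incDigits`: the borrow turns `false` into `true` up to the first `true`,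
which becomes `false`. If this was the last digit, it is now a leading zero; the phase `peek` looks
one cell ahead to find out, and `trim` erases it. -/
theorem run_dec {i : ι} {k : List (Cmd ι O)} {x : ℕ} {σ : ι → ℕ} {v : ℕ} {o : List O}
    (hk : .prim i .dec :: k ∈ allConts P) (hx : x ≤ w.length + 1) (l : List Bool) :
    ∀ pre : List Bool, pre ++ l = Nat.bits v → (Nat.bits (v + 1)).length + 2 < s →
    (compile I P).BoundedRun w s
      (midConf I P .walk (.prim i .dec :: k) x σ i (pre.length + 1)
        (digitTape (pre ++ incDigits l)) o)
      (restConf I P .entry k x (Function.update σ i v) o) := by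
  intro pre h hs
  have hlen : (Nat.bits v).length ≤ (Nat.bits (v + 1)).length := by
    rw [bits_succ]; exact length_le_length_incDigits _
  induction l using incDigits.induct generalizing pre with
  | case1 =>
    simp only [List.append_nil] at h
    subst h
    have h1 := step_midConf (w := w) (i := i) (P := P) (ph := .walk) (ph' := .peek) (k' := .prim i .dec :: k)
      (x := x) (σ := σ) (a := (Nat.bits v).length + 1) (s := s)
      (t := digitTape (Nat.bits v ++ [true])) (o := o) (g := .digit false) (m := .right)
      (e := none) hk (by omega) hx
      (by
        intro b r hr
        simp [trans, hr, digitTape, digitCell])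
    have h2 := step_midConf (w := w) (i := i) (P := P) (ph := .peek) (ph' := .trim) (k' := .prim i .dec :: k)
      (x := x) (σ := σ) (a := (Nat.bits v).length + 2) (s := s)
      (t := digitTape (Nat.bits v ++ [false])) (o := o) (g := .blank) (m := .left)
      (e := none) hk (by omega) hx
      (by
        intro b r hr
        simp [trans, hr, digitTape, digitCell])
    have h3 := step_midConf (w := w) (i := i) (P := P) (ph := .trim) (ph' := .back) (k' := .prim i .dec :: k)
      (x := x) (σ := σ) (a := (Nat.bits v).length + 1) (s := s)
      (t := digitTape (Nat.bits v ++ [false])) (o := o) (g := .blank) (m := .left)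
      (e := none) hk (by omega) hx
      (by
        intro b r hr
        simp [trans])
    have h4 : Function.update (digitTape (Nat.bits v ++ [false])) ((Nat.bits v).length + 2) .blank
        = digitTape (Nat.bits v ++ [false]) := by
      refine Function.update_eq_self_iff.2 ?_
      simp [digitTape, digitCell]
    simp only [Move.apply, update_digitTape, h4, update_digitTape_blank, Option.toList_none,
      List.append_nil] at h1 h2 h3
    exact .head h1 (.head h2 (.head h3 (run_back (P := P) hk hx _ (by simp; omega))))
  | case2 l =>
    simp only [incDigits]
    have hl : pre.length + 1 ≤ (Nat.bits v).length := by
      rw [← h]; simp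
    have h1 := step_midConf (w := w) (i := i) (P := P) (ph := .walk) (ph' := .peek) (k' := .prim i .dec :: k)
      (x := x) (σ := σ) (a := pre.length + 1) (s := s)
      (t := digitTape (pre ++ true :: l)) (o := o) (g := .digit false) (m := .right)
      (e := none) hk (by omega) hx
      (by
        intro b r hr
        simp [trans, hr, digitTape, digitCell])
    -- There is a digit ahead, so nothing is trimmed: otherwise the binary expansion of `v` would
    -- end in `false`.
    obtain ⟨b, l', rfl⟩ : ∃ b l', l = b :: l' := by
      rcases l with _ | ⟨b, l'⟩
      · exact absurd h.symm (bits_ne_append_false v pre)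
      · exact ⟨b, l', rfl⟩
    have h5 : digitTape (pre ++ false :: b :: l') (pre.length + 2) = .digit b := by
      simp [digitTape, digitCell]
    have h2 := step_midConf (w := w) (i := i) (P := P) (ph := .peek) (ph' := .back) (k' := .prim i .dec :: k)
      (x := x) (σ := σ) (a := pre.length + 2) (s := s)
      (t := digitTape (pre ++ false :: b :: l')) (o := o) (g := .digit b) (m := .left)
      (e := none) hk (by omega) hx
      (by
        intro b' r hr
        rw [h5] at hr
        simp [trans, hr])
    have h4 : Function.update (digitTape (pre ++ false :: b :: l')) (pre.length + 2) (.digit b)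
        = digitTape (pre ++ false :: b :: l') := Function.update_eq_self_iff.2 h5.symm
    simp only [Move.apply, update_digitTape, h4, Option.toList_none,
      List.append_nil] at h1 h2
    refine .head h1 (.head h2 ?_)
    rw [h]
    exact run_back (P := P) hk hx _ (by omega)
  | case3 l ih =>
    simp only [incDigits]
    have h2 := ih (pre ++ [true]) (by simpa using h)
    refine .head ?_ h2
    have hl : pre.length + 1 ≤ (Nat.bits v).length := by
      rw [← h]; simp
    have := step_midConf (w := w) (i := i) (P := P) (ph := .walk) (ph' := .walk) (k' := .prim i .dec :: k)
      (x := x) (σ := σ) (a := pre.length + 1) (s := s)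
      (t := digitTape (pre ++ false :: incDigits l)) (o := o) (g := .digit true) (m := .right)
      (e := none) hk (by omega) hx
      (by
        intro b r hr
        simp [trans, hr, digitTape, digitCell])
    simpa [Move.apply, update_digitTape] using this

theorem run_bits {i : ι} {f : Bool → O} {k : List (Cmd ι O)} {x : ℕ} {σ : ι → ℕ}
    (hk : .prim i (.bits f) :: k ∈ allConts P) (hx : x ≤ w.length + 1)
    (hs : (Nat.bits (σ i)).length + 2 < s) (l : List Bool) :
    ∀ (pre : List Bool) (o : List O), pre ++ l = Nat.bits (σ i) →
    (compile I P).BoundedRun w s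
      (midConf I P .walk (.prim i (.bits f) :: k) x σ i (pre.length + 1)
        (digitTape (Nat.bits (σ i))) o)
      (restConf I P .entry k x σ (o ++ l.map f)) := by
  induction l with
  | nil =>
    intro pre o h
    simp only [List.append_nil] at h
    subst h
    have h1 : digitTape (Nat.bits (σ i)) ((Nat.bits (σ i)).length + 1) = .blank := by
      simp [digitTape, digitCell]
    have := step_midConf (w := w) (i := i) (P := P) (ph := .walk) (ph' := .back)
      (k' := .prim i (.bits f) :: k)
      (x := x) (σ := σ) (a := (Nat.bits (σ i)).length + 1) (s := s)
      (t := digitTape (Nat.bits (σ i))) (o := o) (g := .blank) (m := .left)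
      (e := none) hk (by omega) hx
      (by
        intro b r hr
        rw [h1] at hr
        simp [trans, hr])
    rw [← h1, Function.update_eq_self] at this
    refine .head this ?_
    have := run_back (P := P) (w := w) (σ := σ) (v := σ i) (s := s) (o := o) hk hx
      (Nat.bits (σ i)).length (by omega)
    simpa [Move.apply] using this
  | cons b l ih =>
    intro pre o h
    have h2 := ih (pre ++ [b]) (o ++ [f b]) (by simpa using h)
    have h1 : digitTape (Nat.bits (σ i)) (pre.length + 1) = .digit b := by
      simp [digitTape, digitCell, ← h]
    have hl : pre.length + 1 ≤ (Nat.bits (σ i)).length := by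
      rw [← h]; simp
    have := step_midConf (w := w) (i := i) (P := P) (ph := .walk) (ph' := .walk)
      (k' := .prim i (.bits f) :: k)
      (x := x) (σ := σ) (a := pre.length + 1) (s := s)
      (t := digitTape (Nat.bits (σ i))) (o := o) (g := .digit b) (m := .right)
      (e := some (f b)) hk (by omega) hx
      (by
        intro b r hr
        rw [h1] at hr
        simp [trans, hr])
    rw [← h1, Function.update_eq_self] at this
    refine .head this ?_
    simpa [Move.apply] using h2

/-- The step from the start of a command that inspects counter `i`. -/
theorem step_entry {c : Cmd ι O} {i : ι} {k : List (Cmd ι O)} {x : ℕ} {σ : ι → ℕ} {o : List O}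
    (hk : c :: k ∈ allConts P) (hx : x ≤ w.length + 1) (hs : 0 < s)
    (hc : (∃ op, c = .prim i op) ∨ (∃ p q, c = .ite i p q) ∨ ∃ p, c = .loop i p) :
    (compile I P).BoundedStep w s (restConf I P .entry (c :: k) x σ o)
      (midConf I P .walk (c :: k) x σ i 1 (digitTape (Nat.bits (σ i))) o) := by
  rw [← midConf_self (i := i)]
  have := step_midConf (w := w) (i := i) (P := P) (ph := .entry) (ph' := .walk) (k' := c :: k)
      (x := x) (σ := σ) (a := 0) (s := s)
      (t := digitTape (Nat.bits (σ i))) (o := o) (g := .mark) (m := .right)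
      (e := none) hk hs hx
      (by
        intro b r hr
        rcases hc with ⟨op, rfl⟩ | ⟨p, q, rfl⟩ | ⟨p, rfl⟩ <;> simp [trans, hr, digitTape])
  have h1 : digitTape (Nat.bits (σ i)) 0 = .mark := rfl
  rw [← h1, Function.update_eq_self] at this
  simpa [Move.apply] using this

/-- The step in which a branching command inspects the first digit of counter `i`. -/
theorem step_branch {c : Cmd ι O} {i : ι} {k kz kp : List (Cmd ι O)} {x : ℕ} {σ : ι → ℕ}
    {o : List O} (hk : c :: k ∈ allConts P) (hx : x ≤ w.length + 1) (hs : 1 < s)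
    (hc : (∃ p q, c = .ite i p q ∧ kz = p :: k ∧ kp = q :: k) ∨
      ∃ p, c = .loop i p ∧ kz = k ∧ kp = p :: c :: k) :
    (compile I P).BoundedStep w s
      (midConf I P .walk (c :: k) x σ i 1 (digitTape (Nat.bits (σ i))) o)
      (restConf I P .entry (if σ i = 0 then kz else kp) x σ o) := by
  rw [← midConf_self (i := i)]
  have := step_midConf (w := w) (i := i) (P := P) (ph := .walk) (ph' := .entry)
      (k' := if σ i = 0 then kz else kp)
      (x := x) (σ := σ) (a := 1) (s := s) (k := c :: k)
      (t := digitTape (Nat.bits (σ i))) (o := o) (g := digitTape (Nat.bits (σ i)) 1) (m := .left)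
      (e := none) hk hs hx
      (by
        intro b r hr
        have h0 : σ i = 0 ∧ Nat.bits (σ i) = [] ∨
            σ i ≠ 0 ∧ ∃ b l, Nat.bits (σ i) = b :: l := by
          rcases h : σ i with _ | v
          · simp
          · right
            refine ⟨by simp, ?_⟩
            rw [bits_succ]
            cases Nat.bits v with
            | nil => exact ⟨_, _, rfl⟩
            | cons b l => cases b <;> exact ⟨_, _, rfl⟩
        rcases h0 with ⟨h0, h1⟩ | ⟨h0, b, l, h1⟩ <;>
        rcases hc with ⟨p, q, rfl, rfl, rfl⟩ | ⟨p, rfl, rfl, rfl⟩ <;>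
          simp [trans, hr, digitTape, digitCell, h0, h1])
  rw [Function.update_eq_self] at this
  simpa [Move.apply] using this

theorem length_bits_le {v B : ℕ} (h : v ≤ B) : (Nat.bits v).length ≤ B.size := by
  rw [Nat.size_eq_bits_len]; exact Nat.size_le_size h

/-- Induction on the execution with an arbitrary continuation: what remains to be done is part of
the state, so no stack is needed on the tapes. The two cells beyond `B.size` are the mark and the
blank that the head visits behind the last digit. -/
theorem run_of_exec {B : ℕ} (hB : B.size + 2 < s) {p : Cmd ι O} {σ σ' : ι → ℕ} {o' : List O}
    (h : Exec B p σ o' σ') : ∀ (k : List (Cmd ι O)) (x : ℕ) (o : List O),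
      conts p k ⊆ allConts P → k ∈ allConts P → x ≤ w.length + 1 →
      (compile I P).BoundedRun w s (restConf I P .entry (p :: k) x σ o)
        (restConf I P .entry k x σ' (o ++ o')) := by
  induction h with
  | @skip σ =>
    intro k x o hp hk hx
    have := step_restConf (P := P) (w := w) (s := s) (ph := .entry) (ph' := .entry) (k' := k)
      (x := x) (m := .stay) (e := none) (o := o) (σ := σ) (hp (mem_conts _ _)) (by omega)
      (fun r => by simp [trans])
    simpa [Move.apply, hx] using Relation.ReflTransGen.single this
  | out =>
    rename_i σ a
    intro k x o hp hk hx
    have := step_restConf (P := P) (w := w) (s := s) (ph := .entry) (ph' := .entry) (k' := k)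
      (x := x) (m := .stay) (e := some a) (o := o) (σ := σ) (hp (mem_conts _ _)) (by omega)
      (fun r => by simp [trans])
    simpa [Move.apply, hx] using Relation.ReflTransGen.single this
  | @inc σ i hv =>
    intro k x o hp hk hx
    have hp := hp (mem_conts _ _)
    refine .head (step_entry hp hx (by omega) (Or.inl ⟨_, rfl⟩)) ?_
    have := run_inc (P := P) (w := w) (s := s) (v := σ i + 1) hp hx (Nat.bits (σ i)) [] (bits_succ _).symm
      (by have := length_bits_le hv; omega) (σ := σ) (o := o)
    simpa using this
  | @dec σ i v h0 hv =>
    intro k x o hp hk hx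
    have hp := hp (mem_conts _ _)
    refine .head (step_entry hp hx (by omega) (Or.inl ⟨_, rfl⟩)) ?_
    have := run_dec (P := P) (w := w) (s := s) (v := v) hp hx (Nat.bits v) []
      (List.nil_append _)
      (by rw [h0] at hv; have := length_bits_le hv; omega) (σ := σ) (o := o)
    simpa [h0, bits_succ] using this
  | @bits σ i f hv =>
    intro k x o hp hk hx
    have hp := hp (mem_conts _ _)
    refine .head (step_entry hp hx (by omega) (Or.inl ⟨_, rfl⟩)) ?_
    have := run_bits (P := P) (w := w) (s := s) (σ := σ) hp hx
      (by have := length_bits_le hv; omega) (Nat.bits (σ i)) [] o (List.nil_append _)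
    simpa using this
  | @seq p q σ σ' σ'' o₁ o₂ _ _ ih₁ ih₂ =>
    intro k x o hp hk hx
    have h1 := step_restConf (P := P) (w := w) (s := s) (ph := .entry) (ph' := .entry)
      (k' := p :: q :: k)
      (x := x) (m := .stay) (e := none) (o := o) (σ := σ) (hp (mem_conts _ _)) (by omega)
      (fun r => by simp [trans])
    simp only [Move.apply, min_eq_left hx, Option.toList_none, List.append_nil] at h1
    simp only [conts, Set.insert_subset_iff, Set.union_subset_iff] at hp
    refine .head h1 ((ih₁ (q :: k) x o hp.2.1 (hp.2.2 (mem_conts _ _)) hx).trans ?_)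
    rw [← List.append_assoc]
    exact ih₂ k x _ hp.2.2 hk hx
  | ite_zero h0 _ ih =>
    intro k x o hp hk hx
    have hp' := hp (mem_conts _ _)
    refine .head (step_entry hp' hx (by omega) (.inr (.inl ⟨_, _, rfl⟩)))
      (.head (step_branch hp' hx (by omega) (.inl ⟨_, _, rfl, rfl, rfl⟩)) ?_)
    simp only [conts, Set.insert_subset_iff, Set.union_subset_iff] at hp
    rw [if_pos h0]
    exact ih k x o hp.2.1 hk hx
  | ite_pos h0 _ ih =>
    intro k x o hp hk hx
    have hp' := hp (mem_conts _ _)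
    refine .head (step_entry hp' hx (by omega) (.inr (.inl ⟨_, _, rfl⟩)))
      (.head (step_branch hp' hx (by omega) (.inl ⟨_, _, rfl, rfl, rfl⟩)) ?_)
    simp only [conts, Set.insert_subset_iff, Set.union_subset_iff] at hp
    rw [if_neg h0]
    exact ih k x o hp.2.2 hk hx
  | loop_zero h0 =>
    intro k x o hp hk hx
    have hp' := hp (mem_conts _ _)
    refine .head (step_entry hp' hx (by omega) (.inr (.inr ⟨_, rfl⟩)))
      (.head (step_branch hp' hx (by omega) (.inr ⟨_, rfl, rfl, rfl⟩)) ?_)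
    rw [if_pos h0, List.append_nil]
  | loop_pos h0 _ _ ih₁ ih₂ =>
    intro k x o hp hk hx
    have hp' := hp (mem_conts _ _)
    refine .head (step_entry hp' hx (by omega) (.inr (.inr ⟨_, rfl⟩)))
      (.head (step_branch hp' hx (by omega) (.inr ⟨_, rfl, rfl, rfl⟩)) ?_)
    rw [if_neg h0, ← List.append_assoc]
    exact (ih₁ _ x o (fun a ha => hp (Or.inr ha)) hp' hx).trans (ih₂ k x _ hp hk hx)

/-- `load` has no rule in `Exec`, as it is the only command that looks at the input. The input head
crosses the word once, with one increment per letter. -/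
theorem run_load {B : ℕ} (hB : B.size + 2 < s) {i : ι} {k : List (Cmd ι O)} {o : List O}
    (hw : w.length ≤ B) (hp : conts (.load i) k ⊆ allConts P) (hk : k ∈ allConts P) {σ : ι → ℕ}
    (hσ : σ i = 0) :
    (compile I P).BoundedRun w s (restConf I P .entry (.load i :: k) 0 σ o)
      (restConf I P .entry k (w.length + 1) (Function.update σ i w.length) o) := by
  have hp0 := hp (mem_conts _ _)
  have hp1 : .prim i .inc :: .load i :: k ∈ allConts P := hp (by simp [conts])
  have h1 := step_restConf (P := P) (w := w) (s := s) (ph := .entry) (ph' := .entry)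
    (k' := .load i :: k)
    (x := 0) (m := .right) (e := none) (o := o) (σ := σ) hp0 (by omega)
    (fun r => by simp [trans, readInput])
  simp only [Move.apply, Option.toList_none, List.append_nil] at h1
  refine .head h1 ?_
  have key : ∀ x, x ≤ w.length → (compile I P).BoundedRun w s
      (restConf I P .entry (.load i :: k) 1 σ o)
      (restConf I P .entry (.load i :: k) (x + 1) (Function.update σ i x) o) := by
    intro x hx
    induction x with
    | zero =>
      have : Function.update σ i 0 = σ := Function.update_eq_self_iff.2 hσ.symm
      rw [this]
    | succ x ih =>
      refine (ih (by omega)).trans ?_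
      have h2 := step_restConf (P := P) (w := w) (s := s) (ph := .entry) (ph' := .entry)
        (k' := .prim i .inc :: .load i :: k)
        (x := x + 1) (m := .right) (e := none) (o := o) (σ := Function.update σ i x) hp0 (by omega)
        (fun r => by
          have : w[x]? = some w[x] := List.getElem?_eq_getElem (by omega)
          simp [trans, readInput, this])
      have h4 : min (x + 1 + 1) (w.length + 1) = x + 1 + 1 := by omega
      simp only [Move.apply, Option.toList_none, List.append_nil, h4] at h2
      refine .head h2 ?_
      have h3 := run_of_exec (P := P) (w := w) (I := I) hB
        (Exec.inc (i := i) (O := O) (B := B) (σ := Function.update σ i x) (by simp; omega))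
        (.load i :: k) (x + 1 + 1) o (by simpa [conts] using hp1) hp0 (by omega)
      simpa using h3
  refine (by simpa using key w.length le_rfl : (compile I P).BoundedRun w s _ _).trans ?_
  have h2 := step_restConf (P := P) (w := w) (s := s) (ph := .entry) (ph' := .entry)
    (k' := k)
    (x := w.length + 1) (m := .stay) (e := none) (o := o)
    (σ := Function.update σ i w.length) hp0 (by omega)
    (fun r => by simp [trans, readInput])
  simp only [Move.apply, Option.toList_none, List.append_nil, min_self] at h2
  exact .single h2

/-- A number up to `c * (n + 1)` has `O(log n)` binary digits, so a linear bound on the counters is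
a logarithmic bound on the tapes. The program learns only the length of the input, which is all
there is to know about a unary word. -/
theorem logspaceComputable_of_exec (p : Cmd ι O) (i : ι) (f : List I → List O) {c : ℕ} (hc : 0 < c)
    (h : ∀ w, ∃ σ, Exec (c * (w.length + 1)) p (Function.update (fun _ => 0) i w.length) (f w) σ) :
    LogspaceComputable f := by
  -- `B` has at most `c.size + log n + 1` digits, and `(c.size + 5) * (log n + 1)` leaves room for
  -- the extra cells.
  refine ⟨compile I (.seq (.load i) p), c.size + 5, fun w => ?_⟩
  set P : Cmd ι O := .seq (.load i) p with hP
  set B := c * (w.length + 1) with hB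
  set s := (c.size + 5) * (Nat.log 2 w.length + 1) with hs
  have hsize : B.size + 2 < s := by
    have h1 : B < 2 ^ (c.size + (Nat.log 2 w.length + 1)) := by
      rw [pow_add]
      have h2 := Nat.lt_pow_succ_log_self (b := 2) (by norm_num) w.length
      have h3 := Nat.lt_size_self c
      calc B ≤ c * 2 ^ (Nat.log 2 w.length + 1) := Nat.mul_le_mul_left _ h2
        _ < _ := Nat.mul_lt_mul_of_pos_right h3 (by positivity)
    have h2 := Nat.size_le.2 h1
    have h3 : s = c.size * Nat.log 2 w.length + c.size + 5 * Nat.log 2 w.length + 5 := by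
      rw [hs]; ring
    omega
  obtain ⟨σ, hσ⟩ := h w
  have hsub : ∀ x, x ∈ conts P [] → x ∈ allConts P := fun x hx => Or.inr hx
  have hP' : P :: [] ∈ allConts P := hsub _ (mem_conts _ _)
  have hnil : [] ∈ allConts P := Or.inl rfl
  have hp1 : conts (.load i) [p] ⊆ allConts P := fun x hx => hsub x (by
    rw [hP, conts]; exact Or.inr (Or.inl hx))
  have hp2 : conts p [] ⊆ allConts P := fun x hx => hsub x (by
    rw [hP, conts]; exact Or.inr (Or.inr hx))
  have h0 : (compile I P).BoundedStep w s (compile I P).init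
      (restConf I P .entry [P] 0 (fun _ => 0) []) := by
    refine ⟨?_, fun _ => by simp [Transducer.init]; omega⟩
    simp only [Transducer.step, compile, restConf, Transducer.init, coe_toCont hP', trans]
    simp only [Option.map_some, Option.some.injEq, Move.apply]
    congr 1
    funext j
    funext a
    rcases a with _ | a <;> simp [digitTape, digitCell]
  have h1 := step_restConf (P := P) (w := w) (s := s) (ph := .entry) (ph' := .entry)
      (k' := [.load i, p])
      (x := 0) (m := .stay) (e := none) (o := []) (σ := fun _ => 0) hP' (by omega)
      (fun r => by simp [hP, trans])
  simp only [Move.apply, Option.toList_none, List.append_nil, Nat.zero_min] at h1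
  have hwB : w.length ≤ B := by
    have := Nat.mul_le_mul_right (w.length + 1) hc
    omega
  have h2 := run_load (P := P) (w := w) (s := s) (B := B) hsize (i := i) (k := [p]) (o := [])
    (σ := fun _ => 0) hwB hp1 (hp2 (mem_conts _ _)) rfl
  have h3 := run_of_exec (P := P) (w := w) hsize hσ [] (w.length + 1) [] hp2 hnil le_rfl
  have hrun : (compile I P).BoundedRun w s (compile I P).init _ := .head h0 (.head h1 (h2.trans h3))
  have := computesInSpace_of_boundedRun hrun (by
    simp only [Transducer.step, compile, restConf, coe_toCont hnil, trans]
    rfl) (fun j => by simp [restConf]; omega)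
  simpa [restConf] using this

end Compile

end BisimAC

namespace BisimAC

/-! ### Circuits from lists of levelled gates -/

theorem Gate.eval_congr {n : ℕ} (x : Fin n → Bool) (g : Gate n) {v v' : Name → Bool}
    (h : ∀ a ∈ g.inputs, v a = v' a) : g.eval x v = g.eval x v' := by
  cases g with
  | lit => rfl
  | and ins =>
    simp only [Gate.eval, Gate.inputs] at *
    rw [Bool.eq_iff_iff, List.all_eq_true, List.all_eq_true]
    exact forall₂_congr fun a ha => by rw [h a ha]
  | or ins =>
    simp only [Gate.eval, Gate.inputs] at *
    rw [Bool.eq_iff_iff, List.any_eq_true, List.any_eq_true]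
    exact exists_congr fun a => and_congr_right fun ha => by rw [h a ha]

theorem Gate.depth_congr {n : ℕ} (g : Gate n) {d d' : Name → ℕ}
    (h : ∀ a ∈ g.inputs, d a = d' a) : g.depth d = g.depth d' := by
  unfold Gate.depth
  congr 1
  exact List.map_congr_left fun a ha => by rw [h a ha]

theorem foldl_update_of_notMem {β γ : Type} (F : β → (Name → γ) → γ) (l : List (Name × β))
    (v : Name → γ) {a : Name} (ha : a ∉ l.map Prod.fst) :
    l.foldl (fun v e => Function.update v e.1 (F e.2 v)) v a = v a := by
  induction l generalizing v with
  | nil => rfl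
  | cons e l ih =>
    simp only [List.map_cons, List.mem_cons, not_or] at ha
    rw [List.foldl_cons, ih _ ha.2, Function.update_of_ne ha.1]

/-- Along the gates of a circuit, a local recursion computes a solution of its equations. -/
theorem Circuit.foldl_update_eq {n : ℕ} {γ : Type} (C : Circuit n)
    (F : Gate n → (Name → γ) → γ)
    (hF : ∀ g v v', (∀ a ∈ g.inputs, v a = v' a) → F g v = F g v') (v₀ : Name → γ)
    {e : Name × Gate n} (he : e ∈ C.gates) :
    C.gates.foldl (fun v e => Function.update v e.1 (F e.2 v)) v₀ e.1 =
      F e.2 (C.gates.foldl (fun v e => Function.update v e.1 (F e.2 v)) v₀) := by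
  obtain ⟨l₁, l₂, h⟩ := List.append_of_mem he
  have hnd := C.nodup
  have hac := C.acyclic l₁ e l₂ h
  rw [h] at hnd ⊢
  simp only [List.map_append, List.map_cons, List.nodup_append, List.nodup_cons] at hnd
  rw [List.foldl_append, List.foldl_cons, foldl_update_of_notMem _ _ _ hnd.2.1.1,
    Function.update_self]
  refine hF _ _ _ fun a ha => ?_
  have ha' := hac a ha
  have h1 : a ∉ l₂.map Prod.fst := fun h => hnd.2.2 a ha' a (List.mem_cons_of_mem _ h) rfl
  have h2 : a ≠ e.1 := fun h => hnd.2.2 a ha' a (by rw [h]; exact List.mem_cons_self) rfl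
  rw [foldl_update_of_notMem _ _ _ h1, Function.update_of_ne h2]

theorem Circuit.values_eq {n : ℕ} (C : Circuit n) (x : Fin n → Bool) {e : Name × Gate n}
    (he : e ∈ C.gates) : C.values x e.1 = e.2.eval x (C.values x) :=
  C.foldl_update_eq (fun g v => g.eval x v) (fun g _ _ h => g.eval_congr x h) _ he

theorem Circuit.depths_eq {n : ℕ} (C : Circuit n) {e : Name × Gate n}
    (he : e ∈ C.gates) : C.depths e.1 = e.2.depth C.depths :=
  C.foldl_update_eq (fun g d => g.depth d) (fun g _ _ h => g.depth_congr h) _ he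

theorem foldr_max_le {l : List ℕ} {b : ℕ} (h : ∀ a ∈ l, a ≤ b) : l.foldr max 0 ≤ b := by
  induction l with
  | nil => simp
  | cons a l ih =>
    rw [List.foldr_cons]
    exact max_le (h a List.mem_cons_self) (ih fun x hx => h x (List.mem_cons_of_mem _ hx))

/-! ### Recursive first-order formulas over input positions -/

/-- Formulas in negation normal form with variables named by numbers that range over `0, …, n`:
`lin pos is c k` says that `∑ i ∈ is, v_i + c ≤ v_k`, and `lit pos is c b` says that input bit
`∑ i ∈ is, v_i + c` is `b` (both negated if `pos` is `false`). `call r args` refers to the `r`-th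
definition of a system. -/
inductive Fml
  | lin (pos : Bool) (is : List ℕ) (c k : ℕ)
  | lit (pos : Bool) (is : List ℕ) (c : ℕ) (b : Bool)
  | bin (conj : Bool) (φ ψ : Fml)
  | quant (univ : Bool) (i : ℕ) (φ : Fml)
  | call (r : ℕ) (args : List ℕ)
  deriving DecidableEq

/-- The assignment of the values of the arguments to the first variables. -/
def argEnv (args : List ℕ) (e : ℕ → ℕ) : ℕ → ℕ := fun i => (args.map e).getD i 0

namespace Fml

/-- The subformulas of a formula. -/
def subs : Fml → List Fml
  | φ@(lin ..) => [φ]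
  | φ@(lit ..) => [φ]
  | φ@(bin _ ψ χ) => φ :: (ψ.subs ++ χ.subs)
  | φ@(quant _ _ ψ) => φ :: ψ.subs
  | φ@(call ..) => [φ]

theorem self_mem_subs (φ : Fml) : φ ∈ φ.subs := by cases φ <;> simp [subs]

/-- All quantified variables are below `m`, and calls are to the first `d` definitions with at
most `m` arguments. -/
def WF (m d : ℕ) : Fml → Prop
  | lin .. => True
  | lit .. => True
  | bin _ ψ χ => ψ.WF m d ∧ χ.WF m d
  | quant _ i ψ => i < m ∧ ψ.WF m d
  | call r args => r < d ∧ args.length ≤ m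

/-- Evaluation in `t` rounds. -/
def ev (w : List Bool) (defs : ℕ → Fml) : ℕ → Fml → (ℕ → ℕ) → Prop
  | 0, _, _ => False
  | _ + 1, lin pos is c k, e => (is.map e).sum + c ≤ e k ↔ pos = true
  | _ + 1, lit pos is c b, e => w[(is.map e).sum + c]? = some b ↔ pos = true
  | t + 1, bin true ψ χ, e => ev w defs t ψ e ∧ ev w defs t χ e
  | t + 1, bin false ψ χ, e => ev w defs t ψ e ∨ ev w defs t χ e
  | t + 1, quant true i ψ, e => ∀ a ≤ w.length, ev w defs t ψ (Function.update e i a)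
  | t + 1, quant false i ψ, e => ∃ a ≤ w.length, ev w defs t ψ (Function.update e i a)
  | t + 1, call r args, e => ev w defs t (defs r) (argEnv args e)

/-- A gate that is a conjunction or a disjunction. -/
def junct {n : ℕ} (conj : Bool) (ins : List Name) : Gate n := if conj then .and ins else .or ins

/-- The gate that evaluates a formula, given the names of the gates of the previous round. -/
def gate (n : ℕ) (defs : ℕ → Fml) (nm : Fml → (ℕ → ℕ) → Name) : Fml → (ℕ → ℕ) → Gate n
  | lin pos is c k, e => junct (decide ((is.map e).sum + c ≤ e k) == pos) []
  | lit pos is c b, e =>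
    if h : (is.map e).sum + c < n then .lit ⟨(is.map e).sum + c, h⟩ (b == pos)
    else junct (!pos) []
  | bin conj ψ χ, e => junct conj [nm ψ e, nm χ e]
  | quant univ i ψ, e => junct univ ((List.range (n + 1)).map fun a =>
      nm ψ (Function.update e i a))
  | call r args, e => .or [nm (defs r) (argEnv args e)]

/-- The formulas and assignments to which a formula refers. -/
def refs (n : ℕ) (defs : ℕ → Fml) : Fml → (ℕ → ℕ) → List (Fml × (ℕ → ℕ))
  | lin .., _ => []
  | lit .., _ => []
  | bin _ ψ χ, e => [(ψ, e), (χ, e)]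
  | quant _ i ψ, e => (List.range (n + 1)).map fun a => (ψ, Function.update e i a)
  | call r args, e => [(defs r, argEnv args e)]

end Fml

/-- Unary code of a number. -/
def unary (a : ℕ) : List Bool := List.replicate a true ++ [false]

/-- Unary codes are prefix-free, so names that are concatenations of them can be decoded. -/
theorem unary_append_inj {a b : ℕ} {l l' : List Bool} (h : unary a ++ l = unary b ++ l') :
    a = b ∧ l = l' := by
  induction a generalizing b with
  | zero => cases b <;> simp_all [unary, List.replicate_succ]
  | succ a ih =>
    cases b with
    | zero => simp [unary, List.replicate_succ] at h
    | succ b =>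
      have := ih (b := b) (by simpa [unary, List.replicate_succ] using h)
      exact ⟨by rw [this.1], this.2⟩

/-- All assignments that agree with `e` outside of the first `j` variables, and send these to
`0, …, n`. -/
def envs (n : ℕ) : ℕ → (ℕ → ℕ) → List (ℕ → ℕ)
  | 0, e => [e]
  | j + 1, e => (List.range (n + 1)).flatMap fun a => envs n j (Function.update e j a)

theorem mem_envs {n j : ℕ} {e e' : ℕ → ℕ} :
    e' ∈ envs n j e ↔ (∀ i < j, e' i ≤ n) ∧ ∀ i, j ≤ i → e' i = e i := by
  induction j generalizing e with
  | zero =>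
    simp only [envs, List.mem_singleton, not_lt_zero, false_imp_iff, implies_true, true_and,
      zero_le, forall_const]
    exact funext_iff
  | succ j ih =>
    simp only [envs, List.mem_flatMap, List.mem_range, ih]
    constructor
    · rintro ⟨a, ha, h1, h2⟩
      refine ⟨fun i hi => ?_, fun i hi => ?_⟩
      · rcases Nat.lt_succ_iff_lt_or_eq.1 hi with h | rfl
        · exact h1 i h
        · rw [h2 i le_rfl, Function.update_self]; omega
      · rw [h2 i (by omega), Function.update_of_ne (by omega)]
    · rintro ⟨h1, h2⟩
      refine ⟨e' j, by have := h1 j (by omega); omega, fun i hi => h1 i (by omega), fun i hi => ?_⟩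
      rcases eq_or_lt_of_le hi with rfl | h
      · simp
      · rw [h2 i h, Function.update_of_ne (by omega)]

theorem nodup_envs (n j : ℕ) (e : ℕ → ℕ) : (envs n j e).Nodup := by
  induction j generalizing e with
  | zero => simp [envs]
  | succ j ih =>
    rw [envs, List.nodup_flatMap]
    refine ⟨fun a _ => ih _, (List.nodup_range (n := n + 1)).imp fun {a b} hab => ?_⟩
    rw [Function.onFun, List.disjoint_left]
    intro x hx hx'
    have h1 := (mem_envs.1 hx).2 j le_rfl
    have h2 := (mem_envs.1 hx').2 j le_rfl
    simp only [Function.update_self] at h1 h2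
    exact hab (h1.symm.trans h2)

theorem length_envs (n j : ℕ) (e : ℕ → ℕ) : (envs n j e).length = (n + 1) ^ j := by
  induction j generalizing e with
  | zero => simp [envs]
  | succ j ih => simp [envs, List.length_flatMap, ih, pow_succ, mul_comm]

/-- A system of recursive definitions; the first one is the one to be evaluated. -/
structure FmlSystem where
  /-- the number of variables -/
  m : ℕ
  rels : List Fml
  wf : ∀ φ ∈ rels, φ.WF m rels.length
  ne_nil : rels ≠ []

/-! ### Gates, names and circuits of a system. -/

namespace FmlSystem

variable (S : FmlSystem)

/-- The `r`-th definition. -/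
def defs (r : ℕ) : Fml := S.rels.getD r (.lin true [] 0 0)

/-- All formulas that are evaluated. -/
def fmls : List Fml := (S.rels.flatMap Fml.subs).dedup

theorem mem_fmls {φ : Fml} : φ ∈ S.fmls ↔ ∃ ψ ∈ S.rels, φ ∈ ψ.subs := by
  simp [fmls]

theorem defs_mem_fmls {r : ℕ} (h : r < S.rels.length) : S.defs r ∈ S.fmls := by
  rw [mem_fmls, defs, List.getD_eq_getElem _ _ h]
  exact ⟨_, List.getElem_mem h, Fml.self_mem_subs _⟩

theorem _root_.BisimAC.Fml.WF.of_subs {m d : ℕ} {φ ψ : Fml} (h : φ.WF m d) (hψ : ψ ∈ φ.subs) :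
    ψ.WF m d := by
  induction φ with
  | bin _ _ _ ih₁ ih₂ =>
    simp only [Fml.subs, List.mem_cons, List.mem_append] at hψ
    rcases hψ with rfl | hψ | hψ
    exacts [h, ih₁ h.1 hψ, ih₂ h.2 hψ]
  | quant _ _ _ ih =>
    simp only [Fml.subs, List.mem_cons] at hψ
    rcases hψ with rfl | hψ
    exacts [h, ih h.2 hψ]
  | _ => simp only [Fml.subs, List.mem_singleton] at hψ; exact hψ ▸ h

theorem wf_of_mem {φ : Fml} (h : φ ∈ S.fmls) : φ.WF S.m S.rels.length := by
  obtain ⟨ψ, hψ, h⟩ := S.mem_fmls.1 h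
  exact (S.wf ψ hψ).of_subs h

theorem _root_.BisimAC.Fml.subs_trans {φ ψ χ : Fml} (h : χ ∈ ψ.subs) (h' : ψ ∈ φ.subs) :
    χ ∈ φ.subs := by
  induction φ with
  | bin _ _ _ ih₁ ih₂ =>
    simp only [Fml.subs, List.mem_cons, List.mem_append] at h' ⊢
    rcases h' with rfl | h' | h'
    · simpa [Fml.subs] using h
    · exact .inr (.inl (ih₁ h'))
    · exact .inr (.inr (ih₂ h'))
  | quant _ _ _ ih =>
    simp only [Fml.subs, List.mem_cons] at h' ⊢
    rcases h' with rfl | h'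
    · simpa [Fml.subs] using h
    · exact .inr (ih h')
  | _ => simp only [Fml.subs, List.mem_singleton] at h'; exact h' ▸ h

theorem subs_mem_fmls {φ ψ : Fml} (h : ψ ∈ S.fmls) (h' : φ ∈ ψ.subs) : φ ∈ S.fmls := by
  obtain ⟨χ, hχ, h⟩ := S.mem_fmls.1 h
  exact S.mem_fmls.2 ⟨χ, hχ, Fml.subs_trans h' h⟩

/-- Gates are indexed by a round, a formula and an assignment. -/
abbrev Key := ℕ × Fml × (ℕ → ℕ)

/-- The name of a gate. -/
def name (k : Key) : Name :=
  unary (S.fmls.idxOf k.2.1) ++ unary k.1 ++ (List.range S.m).flatMap fun i => unary (k.2.2 i)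

/-- A gate. -/
def gate (n : ℕ) : Key → Gate n
  | (0, _, _) => .or []
  | (t + 1, φ, e) => φ.gate n S.defs (fun ψ e => S.name (t, ψ, e)) e

/-- The indices of all gates. -/
def keys (n T : ℕ) : List Key :=
  (List.range (T + 1)).product (S.fmls.product (envs n S.m fun _ => 0))

theorem mem_keys {n T : ℕ} {k : Key} : k ∈ S.keys n T ↔
    k.1 ≤ T ∧ k.2.1 ∈ S.fmls ∧ (∀ i < S.m, k.2.2 i ≤ n) ∧ ∀ i, S.m ≤ i → k.2.2 i = 0 := by
  obtain ⟨t, φ, e⟩ := k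
  simp [keys, List.pair_mem_product, mem_envs]

theorem nodup_keys (n T : ℕ) : (S.keys n T).Nodup :=
  List.nodup_range.product ((List.nodup_dedup _).product (nodup_envs _ _ _))

theorem flatMap_unary_inj {l : List ℕ} {f g : ℕ → ℕ}
    (h : l.flatMap (fun i => unary (f i)) = l.flatMap fun i => unary (g i)) :
    ∀ i ∈ l, f i = g i := by
  induction l with
  | nil => simp
  | cons a l ih =>
    have := unary_append_inj h
    intro i hi
    rcases List.mem_cons.1 hi with rfl | hi
    exacts [this.1, ih this.2 i hi]

/-- A name codes the formula, the round and the values of the first `m` variables. This determines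
the key, since in all keys the other variables are `0`. -/
theorem name_inj {n T : ℕ} {k k' : Key} (hk : k ∈ S.keys n T) (hk' : k' ∈ S.keys n T)
    (h : S.name k = S.name k') : k = k' := by
  obtain ⟨t, φ, e⟩ := k
  obtain ⟨t', φ', e'⟩ := k'
  rw [mem_keys] at hk hk'
  simp only [name, List.append_assoc] at h
  obtain ⟨h1, h⟩ := unary_append_inj h
  obtain ⟨h2, h⟩ := unary_append_inj h
  have h3 := flatMap_unary_inj h
  have h4 : φ = φ' := (List.idxOf_inj hk.2.1).1 h1
  have h5 : e = e' := by
    funext i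
    by_cases hi : i < S.m
    · exact h3 i (List.mem_range.2 hi)
    · exact (hk.2.2.2 i (by omega)).trans (hk'.2.2.2 i (by omega)).symm
  rw [show t = t' from h2, h4, h5]

/-- The finite set of keys is closed under reference. This is where well-formedness enters:
quantifiers bind variables below `m`, and a call with at most `m` arguments leaves the variables
from `m` on at the default value `0`. -/
theorem refs_mem_keys {n T t : ℕ} {φ : Fml} {e : ℕ → ℕ} (hk : (t + 1, φ, e) ∈ S.keys n T)
    {ψ : Fml} {e' : ℕ → ℕ} (h : (ψ, e') ∈ φ.refs n S.defs e) : (t, ψ, e') ∈ S.keys n T := by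
  rw [mem_keys] at hk ⊢
  obtain ⟨ht, hφ, he, he0⟩ := hk
  have hwf := S.wf_of_mem hφ
  simp only at ht he he0
  have hsub : ∀ {χ}, χ ∈ φ.subs → χ ∈ S.fmls := fun h => S.subs_mem_fmls hφ h
  refine ⟨by simp only; omega, ?_⟩
  cases φ with
  | lin => simp [Fml.refs] at h
  | lit => simp [Fml.refs] at h
  | bin c χ χ' =>
    simp only [Fml.refs, List.mem_cons, Prod.mk.injEq, List.not_mem_nil, or_false] at h
    rcases h with ⟨rfl, rfl⟩ | ⟨rfl, rfl⟩ <;>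
      exact ⟨hsub (by simp [Fml.subs, Fml.self_mem_subs]), he, he0⟩
  | quant c i χ =>
    simp only [Fml.refs, List.mem_map, List.mem_range, Prod.mk.injEq] at h
    obtain ⟨a, ha, rfl, rfl⟩ := h
    refine ⟨hsub (by simp [Fml.subs, Fml.self_mem_subs]), fun j hj => ?_, fun j hj => ?_⟩
    · simp only [Function.update_apply]; split_ifs
      · omega
      · exact he j hj
    · have := hwf.1
      simp only
      rw [Function.update_of_ne (by omega)]
      exact he0 j hj
  | call r args =>
    simp only [Fml.refs, List.mem_singleton, Prod.mk.injEq] at h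
    obtain ⟨rfl, rfl⟩ := h
    refine ⟨S.defs_mem_fmls hwf.1, fun j _ => ?_, fun j hj => ?_⟩
    · simp only [argEnv, List.getD_eq_getElem?_getD, List.getElem?_map]
      cases args[j]? with
      | none => simp
      | some b =>
        simp only [Option.map_some, Option.getD_some]
        by_cases hb : b < S.m
        · exact he b hb
        · rw [he0 b (by omega)]; omega
    · have := hwf.2
      simp only [argEnv, List.getD_eq_getElem?_getD, List.getElem?_map]
      rw [List.getElem?_eq_none (by omega)]
      rfl

theorem _root_.BisimAC.Fml.inputs_gate {n : ℕ} {defs : ℕ → Fml} {nm : Fml → (ℕ → ℕ) → Name}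
    (φ : Fml) (e : ℕ → ℕ) :
    (φ.gate n defs nm e).inputs = (φ.refs n defs e).map fun p => nm p.1 p.2 := by
  have hj : ∀ (c : Bool) (l : List Name), (Fml.junct c l : Gate n).inputs = l := by
    intro c l; cases c <;> rfl
  cases φ with
  | lit =>
    simp only [Fml.gate]
    split_ifs
    · rfl
    · rw [hj]; rfl
  | call => rfl
  | _ => simp [Fml.gate, hj, Fml.refs]

theorem inputs_gate {n T : ℕ} {k : Key} (hk : k ∈ S.keys n T) {a : Name}
    (ha : a ∈ (S.gate n k).inputs) :
    ∃ k' ∈ S.keys n T, S.name k' = a ∧ k'.1 + 1 = k.1 := by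
  obtain ⟨t, φ, e⟩ := k
  rcases t with _ | t
  · simp [gate, Gate.inputs] at ha
  simp only [gate, Fml.inputs_gate, List.mem_map] at ha
  obtain ⟨⟨ψ, e'⟩, h, rfl⟩ := ha
  exact ⟨_, S.refs_mem_keys hk h, rfl, rfl⟩

/-- The keys are listed round by round. As the inputs of a gate belong to the preceding round, this
order is topological. -/
theorem fst_le_of_keys_eq {n T : ℕ} {l₁ l₂ : List Key} {k k' : Key}
    (h : S.keys n T = l₁ ++ k :: l₂) (hk : k' ∈ l₂) : k.1 ≤ k'.1 := by
  have hp : (S.keys n T).Pairwise fun k k' => k.1 ≤ k'.1 := by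
    rw [keys, List.product, List.pairwise_flatMap]
    refine ⟨fun a _ => ?_, ?_⟩
    · rw [List.pairwise_map]; simp [List.pairwise_iff_getElem]
    · refine (List.pairwise_lt_range (n := T + 1)).imp fun {a b} hab => ?_
      simp only [List.mem_map, forall_exists_index, and_imp]
      rintro _ x _ rfl _ y _ rfl
      exact hab.le
  rw [h, List.pairwise_append, List.pairwise_cons] at hp
  exact hp.2.1.1 _ hk

/-- The circuit that evaluates a system in `T` rounds. -/
def circuit (n T : ℕ) : Circuit n where
  gates := (S.keys n T).map fun k => (S.name k, S.gate n k)
  output := S.name (T, S.defs 0, fun _ => 0)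
  nodup := by
    rw [List.map_map]
    exact (S.nodup_keys n T).map_on fun k hk k' hk' h => S.name_inj hk hk' h
  acyclic := by
    intro l₁ e l₂ h a ha
    obtain ⟨k₁, k₂, hk, rfl, h2⟩ := List.map_eq_append_iff.1 h
    obtain ⟨k, k₂, rfl, rfl, rfl⟩ := List.map_eq_cons_iff.1 h2
    have hmem : k ∈ S.keys n T := by rw [hk]; simp
    obtain ⟨k', hk', rfl, hlt⟩ := S.inputs_gate hmem ha
    rw [List.map_map]
    refine List.mem_map.2 ⟨k', ?_, rfl⟩
    rw [hk, List.mem_append, List.mem_cons] at hk'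
    rcases hk' with h | rfl | h
    · exact h
    · omega
    · have := S.fst_le_of_keys_eq hk h
      omega
  output_mem := by
    rw [List.map_map]
    refine List.mem_map.2 ⟨(T, S.defs 0, fun _ => 0), ?_, rfl⟩
    exact S.mem_keys.2 ⟨le_rfl, S.defs_mem_fmls (List.length_pos_of_ne_nil S.ne_nil), by simp, by simp⟩

theorem size_circuit (n T : ℕ) :
    (S.circuit n T).size = (T + 1) * (S.fmls.length * (n + 1) ^ S.m) := by
  have h : ∀ {α β : Type} (l : List α) (l' : List β), (l.product l').length = l.length * l'.length :=
    fun l l' => List.length_product l l'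
  simp only [Circuit.size, circuit, List.length_map, keys, h, List.length_range, length_envs]

theorem depths_circuit {n T : ℕ} (t : ℕ) : ∀ φ e, (t, φ, e) ∈ S.keys n T →
    (S.circuit n T).depths (S.name (t, φ, e)) ≤ t := by
  induction t with
  | zero =>
    intro φ e h
    have := (S.circuit n T).depths_eq (e := (S.name (0, φ, e), S.gate n (0, φ, e)))
      (List.mem_map.2 ⟨_, h, rfl⟩)
    simp only at this
    rw [this]
    simp [gate, Gate.depth, Gate.inputs]
  | succ t ih =>
    intro φ e h
    have := (S.circuit n T).depths_eq (e := (S.name (t + 1, φ, e), S.gate n (t + 1, φ, e)))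
      (List.mem_map.2 ⟨_, h, rfl⟩)
    simp only at this
    rw [this, Gate.depth]
    refine foldr_max_le fun a ha => ?_
    obtain ⟨b, hb, rfl⟩ := List.mem_map.1 ha
    obtain ⟨⟨t', φ', e'⟩, hk', rfl, hlt⟩ := S.inputs_gate h hb
    simp only [Nat.add_right_cancel_iff] at hlt
    subst hlt
    have := ih _ _ hk'
    omega

theorem depth_circuit (n T : ℕ) : (S.circuit n T).depth ≤ T := by
  refine foldr_max_le fun a ha => ?_
  obtain ⟨b, hb, rfl⟩ := List.mem_map.1 ha
  obtain ⟨⟨t, φ, e⟩, hk, rfl⟩ := List.mem_map.1 hb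
  exact (S.depths_circuit t φ e hk).trans (S.mem_keys.1 hk).1

theorem eval_junct {n : ℕ} (x : Fin n → Bool) (v : Name → Bool) (c : Bool) (l : List Name) :
    (Fml.junct c l : Gate n).eval x v = if c then l.all v else l.any v := by
  cases c <;> rfl

/-- Wires go down exactly one round, so a gate of round `t` computes evaluation in `t` rounds; round
`0` is false on both sides. -/
theorem values_circuit {w : List Bool} {T : ℕ} (t : ℕ) : ∀ φ e, (t, φ, e) ∈ S.keys w.length T →
    ((S.circuit w.length T).values w.get (S.name (t, φ, e)) = true ↔ φ.ev w S.defs t e) := by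
  induction t with
  | zero =>
    intro φ e h
    rw [(S.circuit w.length T).values_eq w.get (e := (S.name (0, φ, e), S.gate _ (0, φ, e)))
      (List.mem_map.2 ⟨_, h, rfl⟩)]
    simp [gate, Gate.eval, Fml.ev]
  | succ t ih =>
    intro φ e h
    rw [(S.circuit w.length T).values_eq w.get
      (e := (S.name (t + 1, φ, e), S.gate _ (t + 1, φ, e))) (List.mem_map.2 ⟨_, h, rfl⟩)]
    have ih' : ∀ ψ e', (ψ, e') ∈ φ.refs w.length S.defs e →
        ((S.circuit w.length T).values w.get (S.name (t, ψ, e')) = true ↔ ψ.ev w S.defs t e') :=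
      fun ψ e' h' => ih _ _ (S.refs_mem_keys h h')
    simp only [gate]
    cases φ with
    | lin pos is c k =>
      by_cases hk : (is.map e).sum + c ≤ e k <;> cases pos <;>
        simp [Fml.gate, eval_junct, Fml.ev, hk]
    | lit pos is c b =>
      simp only [Fml.gate, Fml.ev]
      split_ifs with hlt
      · simp only [Gate.eval, List.getElem?_eq_getElem hlt, List.get_eq_getElem]
        cases b <;> cases pos <;> simp
      · rw [List.getElem?_eq_none (by omega)]
        cases pos <;> simp [eval_junct]
    | bin c ψ χ =>
      have h1 := ih' ψ e (by simp [Fml.refs])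
      have h2 := ih' χ e (by simp [Fml.refs])
      cases c <;> simp [Fml.gate, eval_junct, Fml.ev, h1, h2]
    | quant c i ψ =>
      have h1 : ∀ a ≤ w.length, _ := fun a ha => ih' ψ (Function.update e i a) (by
        simp only [Fml.refs, List.mem_map, List.mem_range]
        exact ⟨a, by omega, rfl⟩)
      cases c
      · simp only [Fml.gate, eval_junct, Fml.ev, Bool.false_eq_true, if_false, List.any_eq_true,
          List.mem_map, List.mem_range, exists_exists_and_eq_and, Nat.lt_succ_iff]
        exact exists_congr fun a => and_congr_right fun ha => h1 a ha
      · simp only [Fml.gate, eval_junct, Fml.ev, if_true, List.all_eq_true,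
          List.mem_map, List.mem_range, forall_exists_index, and_imp, forall_apply_eq_imp_iff₂,
          Nat.lt_succ_iff]
        exact forall₂_congr fun a ha => h1 a ha
    | call r args =>
      have h1 := ih' (S.defs r) (argEnv args e) (by simp [Fml.refs])
      simp [Fml.gate, Gate.eval, Fml.ev, h1]

theorem accepts_circuit (w : List Bool) (T : ℕ) :
    (S.circuit w.length T).Accepts w.get ↔ (S.defs 0).ev w S.defs T fun _ => 0 :=
  S.values_circuit T _ _ (S.mem_keys.2 ⟨le_rfl,
    S.defs_mem_fmls (List.length_pos_of_ne_nil S.ne_nil), by simp, by simp⟩)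

end FmlSystem

end BisimAC

namespace BisimAC

/-! ### Derived program constructs -/

section Macros

variable {ι O : Type} [DecidableEq ι] {B : ℕ}

/-- `p` writes `o` and leaves the counters as they were. -/
abbrev Emits (B : ℕ) (p : Cmd ι O) (σ : ι → ℕ) (o : List O) : Prop := Exec B p σ o σ

namespace Cmd

/-- Sequential composition of a list of programs. -/
def seqs : List (Cmd ι O) → Cmd ι O
  | [] => .skip
  | p :: l => .seq p (seqs l)

/-- Write a fixed word. -/
def outs (l : List O) : Cmd ι O := seqs (l.map .out)

/-- Add `c` to counter `i`. -/
def incs (i : ι) (c : ℕ) : Cmd ι O := seqs (List.replicate c (.prim i .inc))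

/-- Reset counter `i`. -/
def clear (i : ι) : Cmd ι O := .loop i (.prim i .dec)

/-- Move counter `i` to counter `d`. -/
def move (i d : ι) : Cmd ι O := .loop i (.seq (.prim i .dec) (.prim d .inc))

/-- Add counter `i` to counter `d`, with a scratch counter `s`. -/
def copy (s i d : ι) : Cmd ι O :=
  .seq (.loop i (seqs [.prim i .dec, .prim d .inc, .prim s .inc])) (move s i)

/-- Write counter `i` in unary, with a scratch counter `s`. -/
def tally (s i : ι) (o : O) : Cmd ι O :=
  .seq (.loop i (seqs [.prim i .dec, .prim s .inc, .out o])) (move s i)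

/-- Run `p` for all values of `v` from `0` to counter `n`, with a counter `r` for the number of
remaining rounds. -/
def forAll (s n v r : ι) (p : Cmd ι O) : Cmd ι O :=
  seqs [copy s n r, p, .loop r (seqs [.prim r .dec, .prim v .inc, p]), clear v]

/-- Halve counter `u`, with a scratch counter `g`. -/
def halve (u g : ι) : Cmd ι O :=
  .seq (.loop u (.seq (.prim u .dec) (.ite u .skip (.seq (.prim u .dec) (.prim g .inc)))))
    (move g u)

/-- Replace `u` by `u - f` and add `f - u` to `d`, while `f` is reset. -/
def compare (u f d : ι) : Cmd ι O :=
  .loop f (.seq (.prim f .dec) (.ite u (.prim d .inc) (.prim u .dec)))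

end Cmd

open Cmd

theorem Exec.cast {p : Cmd ι O} {σ σ' τ : ι → ℕ} {o o' : List O} (h : Exec B p σ o σ')
    (ho : o = o') (hσ : σ' = τ) : Exec B p σ o' τ := ho ▸ hσ ▸ h

theorem emits_seqs {α : Type} {l : List α} {f : α → Cmd ι O} {σ : ι → ℕ} {o : α → List O}
    (h : ∀ a ∈ l, Emits B (f a) σ (o a)) : Emits B (seqs (l.map f)) σ (l.flatMap o) := by
  induction l with
  | nil => exact .skip
  | cons a l ih =>
    exact .seq (h a List.mem_cons_self) (ih fun b hb => h b (List.mem_cons_of_mem _ hb))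

theorem emits_outs (l : List O) (σ : ι → ℕ) : Emits B (outs l) σ l :=
  (emits_seqs fun a _ => (Exec.out : Emits B (.out a) σ [a])).cast (by simp) rfl

theorem exec_incs (i : ι) (c : ℕ) {σ : ι → ℕ} (h : σ i + c ≤ B) :
    Exec B (incs i c : Cmd ι O) σ [] (Function.update σ i (σ i + c)) := by
  induction c generalizing σ with
  | zero => exact Exec.skip.cast rfl (by simp)
  | succ c ih =>
    refine (Exec.seq (.inc (by omega)) (ih (by simp; omega))).cast rfl ?_
    simp only [Function.update_idem, Function.update_self]
    congr 1; omega

/-- `τ j` is the explicit state before round `j`. The programs below are verified by exhibiting `τ`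
and checking one round. -/
theorem exec_loop {i : ι} {p : Cmd ι O} (k : ℕ) (τ : ℕ → ι → ℕ) (o : ℕ → List O)
    {σ σ' : ι → ℕ} {o' : List O}
    (h : ∀ j < k, τ j i ≠ 0 ∧ Exec B p (τ j) (o j) (τ (j + 1))) (hk : τ k i = 0)
    (h0 : τ 0 = σ) (ho : (List.range k).flatMap o = o') (h1 : τ k = σ') :
    Exec B (.loop i p) σ o' σ' := by
  subst h0 ho h1
  induction k generalizing τ o with
  | zero => exact .loop_zero hk
  | succ k ih =>
    have h1 := ih (fun j => τ (j + 1)) (fun j => o (j + 1)) (fun j hj => h (j + 1) (by omega)) hk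
    have h2 := h 0 (by omega)
    refine (Exec.loop_pos h2.1 h2.2 h1).cast ?_ rfl
    rw [List.range_succ_eq_map, List.flatMap_cons, List.flatMap_map]

theorem exec_clear (i : ι) {σ : ι → ℕ} (h : σ i ≤ B) :
    Exec B (clear i : Cmd ι O) σ [] (Function.update σ i 0) := by
  refine exec_loop (σ i) (fun j => Function.update σ i (σ i - j)) (fun _ => []) (fun j hj => ?_)
    (by simp) (by simp) (by simp) (by simp)
  exact ⟨by simp; omega, (Exec.dec (v := σ i - (j + 1)) (by simp; omega) (by simp; omega)).cast rfl
    (by simp)⟩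

theorem exec_move {i d : ι} (hd : i ≠ d) {σ : ι → ℕ} (h : σ i ≤ B)
    (h' : σ d + σ i ≤ B) :
    Exec B (move i d : Cmd ι O) σ []
      (Function.update (Function.update σ i 0) d (σ d + σ i)) := by
  refine exec_loop (σ i)
    (fun j => Function.update (Function.update σ i (σ i - j)) d (σ d + j)) (fun _ => [])
    (fun j hj => ⟨by simp [hd]; omega, ?_⟩) (by simp [hd]) (by simp) (by simp) (by simp)
  refine (Exec.seq (.dec (v := σ i - (j + 1)) (by simp [hd]; omega) (by simp [hd]; omega))
    (.inc (by simp [hd.symm]; omega))).cast rfl ?_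
  funext x
  simp only [Function.update_apply]
  grind

theorem exec_copy {s i d : ι} (h1 : i ≠ d) (h2 : i ≠ s) (h3 : d ≠ s) {σ : ι → ℕ}
    (hs : σ s = 0) (h : σ i ≤ B) (h' : σ d + σ i ≤ B) :
    Exec B (copy s i d : Cmd ι O) σ [] (Function.update σ d (σ d + σ i)) := by
  have := exec_loop (O := O) (B := B) (i := i)
    (p := seqs [.prim i .dec, .prim d .inc, .prim s .inc]) (σ := σ) (σ i)
    (fun j => Function.update (Function.update (Function.update σ i (σ i - j)) d (σ d + j)) s j)
    (fun _ => []) (fun j hj => ⟨by simp [h1, h2]; omega, ?_⟩) (by simp [h1, h2])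
    (by funext x; simp only [Function.update_apply]; grind) rfl rfl
  · refine (this.seq (exec_move (B := B) (i := s) (d := i) h2.symm
      (by simpa using h) (by simp [h1, h2]; exact h))).cast (by simp) ?_
    funext x
    simp only [Function.update_apply]
    grind
  · refine (Exec.seq (.dec (v := σ i - (j + 1)) (by simp [h1, h2]; omega) (by simp [h1, h2]; omega))
      (.seq (.inc (by simp [h1.symm, h3]; omega)) (.seq (.inc (by simp [h2.symm, h3.symm]; omega))
        .skip))).cast rfl ?_
    funext x
    simp only [Function.update_apply]
    grind

theorem flatMap_range_singleton (a : O) (n : ℕ) :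
    (List.range n).flatMap (fun _ => [a]) = List.replicate n a := by
  induction n with
  | zero => rfl
  | succ n ih => rw [List.range_succ, List.flatMap_append, ih, List.replicate_succ']; simp

theorem emits_tally {s i : ι} (hs : i ≠ s) (a : O) {σ : ι → ℕ} (h0 : σ s = 0) (h : σ i ≤ B) :
    Emits B (tally s i a) σ (List.replicate (σ i) a) := by
  have := exec_loop (O := O) (B := B) (i := i)
    (p := seqs [.prim i .dec, .prim s .inc, .out a]) (σ := σ) (σ i)
    (fun j => Function.update (Function.update σ i (σ i - j)) s j)
    (fun _ => [a]) (fun j hj => ⟨by simp [hs]; omega, ?_⟩) (by simp [hs])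
    (by funext x; simp only [Function.update_apply]; grind) rfl rfl
  · refine (this.seq (exec_move (B := B) (i := s) (d := i) hs.symm
      (by simpa using h) (by simp [hs]; exact h))).cast (by simp [flatMap_range_singleton]) ?_
    funext x
    simp only [Function.update_apply]
    grind
  · refine (Exec.seq (.dec (v := σ i - (j + 1)) (by simp [hs]; omega) (by simp [hs]; omega))
      (.seq (.inc (by simp [hs.symm]; omega)) (.seq .out .skip))).cast (by simp) ?_
    funext x
    simp only [Function.update_apply]
    grind

/-- `p` runs once before the loop and once per round, which gives the `n + 1` values `0, …, n`.
Before the run for `a` the counters are `v = a` and `r = n - a`. -/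
theorem emits_forAll {s n v r : ι} (hd : [s, n, v, r].Nodup) {p : Cmd ι O} {σ : ι → ℕ}
    {o : ℕ → List O} (hs : σ s = 0) (hv : σ v = 0) (hr : σ r = 0) (hn : σ n ≤ B)
    (hp : ∀ a ≤ σ n, Emits B p (Function.update (Function.update σ v a) r (σ n - a)) (o a)) :
    Emits B (forAll s n v r p) σ ((List.range (σ n + 1)).flatMap o) := by
  simp only [List.nodup_cons, List.mem_cons, List.not_mem_nil, or_false, not_or, List.nodup_nil,
    not_false_eq_true, and_true] at hd
  obtain ⟨⟨hsn, hsv, hsr⟩, ⟨hnv, hnr⟩, hvr⟩ := hd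
  have h1 := exec_copy (O := O) hnr (Ne.symm hsn) (Ne.symm hsr) (σ := σ) hs hn (by omega)
  have h2 := hp 0 (by omega)
  have h3 := exec_loop (O := O) (B := B) (i := r)
    (p := seqs [.prim r .dec, .prim v .inc, p]) (σ n)
    (fun j => Function.update (Function.update σ v j) r (σ n - j))
    (fun j => o (j + 1)) (fun j hj => ⟨by simp; omega, ?_⟩) (by simp)
    rfl rfl rfl
  · have h4 := exec_clear (O := O) (B := B) v
      (σ := Function.update (Function.update σ v (σ n)) r (σ n - σ n)) (by simp [hvr]; exact hn)
    refine (Exec.seq (h1.cast rfl ?_) (.seq h2 (.seq h3 (.seq h4 .skip)))).cast ?_ ?_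
    · funext x
      simp only [Function.update_apply]
      grind
    · rw [List.range_succ_eq_map, List.flatMap_cons, List.flatMap_map]
      simp
    · funext x
      simp only [Function.update_apply]
      grind
  · have h5 : Exec B (.prim r .dec : Cmd ι O) (Function.update (Function.update σ v j) r (σ n - j))
        [] (Function.update (Function.update σ v j) r (σ n - (j + 1))) :=
      (Exec.dec (v := σ n - (j + 1)) (by simp; omega) (by simp; omega)).cast rfl (by simp)
    have h6 : Exec B (.prim v .inc : Cmd ι O)
        (Function.update (Function.update σ v j) r (σ n - (j + 1)))
        [] (Function.update (Function.update σ v (j + 1)) r (σ n - (j + 1))) := by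
      refine (Exec.inc (by simp [hvr]; omega)).cast rfl ?_
      funext x
      simp only [Function.update_apply]
      grind
    exact (h5.seq (h6.seq ((hp (j + 1) (by omega)).seq .skip))).cast (by simp) rfl

theorem exec_halve {u g : ι} (hg : u ≠ g) {σ : ι → ℕ} (h0 : σ g = 0) (h : σ u ≤ B) :
    Exec B (halve u g : Cmd ι O) σ [] (Function.update σ u (σ u / 2)) := by
  -- `k` only bounds `v`, because a round lowers `v` by two.
  have key : ∀ (k v : ℕ) (σ : ι → ℕ), σ u = v → v ≤ B → σ g + v ≤ B → v ≤ k →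
      Exec B (.loop u (.seq (.prim u .dec) (.ite u .skip (.seq (.prim u .dec) (.prim g .inc)))) :
        Cmd ι O) σ [] (Function.update (Function.update σ u 0) g (σ g + v / 2)) := by
    intro k
    induction k with
    | zero =>
      intro v σ hv _ _ hk
      refine (Exec.loop_zero (by omega)).cast rfl ?_
      funext x
      simp only [Function.update_apply]
      grind
    | succ k ih =>
      intro v σ hv hB hgB hk
      rcases v with _ | _ | v
      · refine (Exec.loop_zero (by omega)).cast rfl ?_
        funext x
        simp only [Function.update_apply]
        grind
      · refine (Exec.loop_pos (by omega) (.seq (.dec (v := 0) hv (by omega))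
          (.ite_zero (by simp) .skip)) (.loop_zero (by simp))).cast rfl ?_
        funext x
        simp only [Function.update_apply]
        grind
      · have h2 := ih v (Function.update (Function.update σ u v) g (σ g + 1)) (by simp [hg])
          (by omega) (by simp; omega) (by omega)
        have h1 : Exec B (.seq (.prim u .dec) (.prim g .inc) : Cmd ι O)
            (Function.update σ u (v + 1)) []
            (Function.update (Function.update σ u v) g (σ g + 1)) := by
          refine (Exec.seq (.dec (v := v) (by simp) (by simp; omega))
            (.inc (by simp [hg.symm]; omega))).cast rfl ?_
          funext x
          simp only [Function.update_apply]
          grind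
        refine (Exec.loop_pos (by omega) (.seq (.dec (v := v + 1) hv (by omega))
          (.ite_pos (by simp) h1)) h2).cast rfl ?_
        funext x
        simp only [Function.update_apply]
        grind
  refine ((key _ _ σ rfl h (by omega) le_rfl).seq (exec_move (B := B) hg.symm (by simp; omega)
    (by simp [hg]; omega))).cast rfl ?_
  funext x
  simp only [Function.update_apply]
  grind

/-- Truncated subtraction in both directions at once: after `j` rounds `u` has lost `j` and `d` has
gained the overshoot `j - σ u`. -/
theorem exec_compare {u f d : ι} (hd : [u, f, d].Nodup) {σ : ι → ℕ} (h : σ u ≤ B) (hf : σ f ≤ B)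
    (hd' : σ d + σ f ≤ B) :
    Exec B (compare u f d : Cmd ι O) σ [] (Function.update (Function.update (Function.update σ
      u (σ u - σ f)) d (σ d + (σ f - σ u))) f 0) := by
  simp only [List.nodup_cons, List.mem_cons, List.not_mem_nil, or_false, not_or, List.nodup_nil,
    not_false_eq_true, and_true] at hd
  obtain ⟨⟨huf, hud⟩, hfd⟩ := hd
  refine exec_loop (σ f) (fun j => Function.update (Function.update (Function.update σ
      u (σ u - j)) d (σ d + (j - σ u))) f (σ f - j)) (fun _ => []) (fun j hj => ⟨by simp; omega, ?_⟩)
      (by simp) (by funext x; simp only [Function.update_apply]; grind) (by simp) (by simp)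
  have h1 : Exec B (.prim f .dec : Cmd ι O) (Function.update (Function.update (Function.update σ
      u (σ u - j)) d (σ d + (j - σ u))) f (σ f - j)) [] (Function.update (Function.update
      (Function.update σ u (σ u - j)) d (σ d + (j - σ u))) f (σ f - (j + 1))) :=
    (Exec.dec (v := σ f - (j + 1)) (by simp; omega) (by simp; omega)).cast rfl (by simp)
  by_cases hu : σ u ≤ j
  · refine (h1.seq (.ite_zero (by simp [huf, hud]; omega) (.inc ?_))).cast rfl ?_
    · simp [Ne.symm hfd]; omega
    · funext x
      simp only [Function.update_apply]
      grind
  · refine (h1.seq (.ite_pos (by simp [huf, hud]; omega) (.dec (v := σ u - (j + 1)) ?_ ?_))).cast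
      rfl ?_
    · simp [huf, hud]; omega
    · simp [huf, hud]; omega
    · funext x
      simp only [Function.update_apply]
      grind

end Macros
end BisimAC

namespace BisimAC

/-! ### A logspace transducer that writes the circuits of a system -/

/-- The counters of the program that writes circuits: the variables, the numbers of remaining
rounds of the loops over the variables, and auxiliary counters. -/
inductive Reg (m : ℕ)
  | var (i : Fin m)
  | rem (i : Fin m)
  | size
  | rounds
  | round
  | roundsLeft
  | aux
  | auxLeft
  | scratch
  | sum
  | deficit
  | excess
  | temp
  | zero
  deriving DecidableEq, Fintype

namespace Reg

variable {m : ℕ}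

/-- The counter of a variable. -/
def slot (i : ℕ) : Reg m := if h : i < m then .var ⟨i, h⟩ else .zero

theorem slot_cases (i : ℕ) : (∃ h : i < m, (slot i : Reg m) = .var ⟨i, h⟩) ∨
    m ≤ i ∧ (slot i : Reg m) = .zero := by
  unfold slot
  by_cases h : i < m
  · exact .inl ⟨h, dif_pos h⟩
  · exact .inr ⟨by omega, dif_neg h⟩

end Reg

open Reg Cmd

/-- The counters hold the assignment `e` and the number `n`, and the auxiliary counters in use
within a gate are `0`. -/
structure Holds {m : ℕ} (n : ℕ) (e : ℕ → ℕ) (σ : Reg m → ℕ) : Prop where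
  slot : ∀ i, σ (.slot i) = e i
  size : σ .size = n
  aux : σ .aux = 0
  auxLeft : σ .auxLeft = 0
  scratch : σ .scratch = 0
  sum : σ .sum = 0
  deficit : σ .deficit = 0
  excess : σ .excess = 0
  temp : σ .temp = 0
  zero : σ .zero = 0

/-! ### Programs for linear forms and for names. -/

section Print

variable {m n B : ℕ} {e : ℕ → ℕ} {σ : Reg m → ℕ}

/-- Add the values of variables and a constant to the counter `sum`. -/
def sumCmd (is : List ℕ) (c : ℕ) : Cmd (Reg m) CSym :=
  .seq (seqs (is.map fun i => copy .scratch (slot i) .sum)) (incs .sum c)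

theorem exec_sumCmd (is : List ℕ) (c : ℕ) (h : Holds n e σ) (hB : (is.map e).sum + c ≤ B) :
    Exec B (sumCmd is c) σ [] (Function.update σ .sum ((is.map e).sum + c)) := by
  have key : ∀ (is : List ℕ) (a : ℕ), a + (is.map e).sum ≤ B →
      Exec B (seqs (is.map fun i => copy .scratch (slot i) .sum) : Cmd (Reg m) CSym)
        (Function.update σ .sum a) [] (Function.update σ .sum (a + (is.map e).sum)) := by
    intro is
    induction is with
    | nil => intro a _; exact Exec.skip.cast rfl (by simp)
    | cons i is ih =>
      intro a ha
      simp only [List.map_cons, List.sum_cons] at ha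
      have hne : (slot i : Reg m) ≠ .sum ∧ (slot i : Reg m) ≠ .scratch := by
        rcases slot_cases (m := m) i with ⟨_, h⟩ | ⟨_, h⟩ <;> simp [h]
      have hi : Function.update σ .sum a (slot i) = e i := by
        rw [Function.update_of_ne hne.1, h.slot]
      have h1 := exec_copy (B := B) (O := CSym) (σ := Function.update σ .sum a) hne.1 hne.2
        (by simp) (by simp [h.scratch]) (by omega)
        (by simp only [hi, Function.update_self]; omega)
      rw [hi, Function.update_self, Function.update_idem] at h1
      refine (h1.seq (ih (a + e i) (by omega))).cast rfl ?_
      rw [List.map_cons, List.sum_cons, add_assoc]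
  have h1 := key is 0 (by omega)
  rw [Function.update_eq_self_iff.2 h.sum.symm, zero_add] at h1
  refine (h1.seq (exec_incs .sum c (by simpa using hB))).cast rfl ?_
  simp

/-- Run `p` with the sum of a linear form in `sum` and its differences with counter `k` in
`deficit` and `excess`. -/
def withSum (is : List ℕ) (c : ℕ) (k : Reg m) (p : Cmd (Reg m) CSym) : Cmd (Reg m) CSym :=
  seqs [sumCmd is c, copy .scratch k .deficit, copy .scratch .sum .temp,
    compare .deficit .temp .excess, p, clear .sum, clear .deficit, clear .excess]

/-- Both truncated differences are offered to `p`: a linear atom holds when `excess` is `0`, and a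
position lies within the input when `deficit` is not `0`. -/
theorem emits_withSum {is : List ℕ} {c : ℕ} {k : Reg m} {p : Cmd (Reg m) CSym} {o : List CSym}
    (h : Holds n e σ) (hB : (is.map e).sum + c ≤ B)
    (hk : (∃ i, k = slot i) ∨ k = .size) (hkB : σ k ≤ B)
    (hp : Emits B p (Function.update (Function.update (Function.update σ
      .sum ((is.map e).sum + c)) .deficit (σ k - ((is.map e).sum + c)))
      .excess ((is.map e).sum + c - σ k)) o) :
    Emits B (withSum is c k p) σ o := by
  obtain ⟨k1, k2, k3⟩ : k ≠ .sum ∧ k ≠ .scratch ∧ k ≠ .deficit := by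
    rcases hk with ⟨i, rfl⟩ | rfl
    · rcases slot_cases (m := m) i with ⟨_, h⟩ | ⟨_, h⟩ <;> simp [h]
    · simp
  set s := (is.map e).sum + c with hs
  have h1 := exec_sumCmd is c h hB
  rw [← hs] at h1
  set σ₁ := Function.update σ .sum s with hσ₁
  have h2 := exec_copy (O := CSym) (B := B) (s := .scratch) (i := k) (d := .deficit) (σ := σ₁) k3 k2
    (by simp) (by simp [hσ₁, h.scratch]) (by simpa [hσ₁, k1]) (by simpa [hσ₁, k1, h.deficit])
  set σ₂ := Function.update σ₁ .deficit (σ₁ .deficit + σ₁ k) with hσ₂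
  have h3 := exec_copy (O := CSym) (B := B) (s := .scratch) (i := .sum) (d := .temp) (σ := σ₂)
    (by simp) (by simp) (by simp) (by simp [hσ₂, hσ₁, h.scratch]) (by simpa [hσ₂, hσ₁])
    (by simpa [hσ₂, hσ₁, h.temp])
  set σ₃ := Function.update σ₂ .temp (σ₂ .temp + σ₂ .sum) with hσ₃
  have h4 := exec_compare (O := CSym) (B := B) (u := .deficit) (f := .temp) (d := .excess) (σ := σ₃)
    (by simp) (by simpa [hσ₃, hσ₂, hσ₁, h.deficit, k1]) (by simpa [hσ₃, hσ₂, hσ₁, h.temp])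
    (by simpa [hσ₃, hσ₂, hσ₁, h.temp, h.excess])
  have h5 : Function.update (Function.update (Function.update σ₃
      .deficit (σ₃ .deficit - σ₃ .temp)) .excess (σ₃ .excess + (σ₃ .temp - σ₃ .deficit))) .temp 0 =
      Function.update (Function.update (Function.update σ
      .sum s) .deficit (σ k - s)) .excess (s - σ k) := by
    funext x
    simp only [hσ₃, hσ₂, hσ₁, Function.update_apply]
    have := h.deficit
    have := h.temp
    have := h.excess
    grind
  rw [h5] at h4
  have h6 := exec_clear (O := CSym) (B := B) .sum (σ := Function.update (Function.update
    (Function.update σ .sum s) .deficit (σ k - s)) .excess (s - σ k)) (by simpa)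
  have h7 := exec_clear (O := CSym) (B := B) .deficit (σ := Function.update (Function.update
    (Function.update (Function.update σ .sum s) .deficit (σ k - s)) .excess (s - σ k)) .sum 0)
    (by simp; omega)
  have h8 := exec_clear (O := CSym) (B := B) .excess (σ := Function.update (Function.update
    (Function.update (Function.update (Function.update σ .sum s) .deficit (σ k - s))
    .excess (s - σ k)) .sum 0) .deficit 0) (by simp; omega)
  refine (h1.seq (h2.seq (h3.seq (h4.seq (hp.seq (h6.seq (h7.seq (h8.seq .skip)))))))).cast ?_ ?_
  · simp
  funext x
  simp only [Function.update_apply]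
  have := h.deficit
  have := h.sum
  have := h.excess
  grind

/-- A name as a word. -/
abbrev nameWord (a : Name) : List CSym := a.map CSym.bit

/-- Write counter `i` in unary, increased by `x`. -/
def unaryCmd (x : ℕ) (i : Reg m) : Cmd (Reg m) CSym :=
  .seq (tally .scratch i (.bit true)) (outs (nameWord (unary x)))

theorem emits_unaryCmd (x : ℕ) {i : Reg m} (hi : i ≠ .scratch) (h : σ .scratch = 0)
    (hB : σ i ≤ B) : Emits B (unaryCmd x i) σ (nameWord (unary (σ i + x))) := by
  refine ((emits_tally hi _ h hB).seq (emits_outs _ _)).cast ?_ rfl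
  simp only [unary, List.replicate_add, nameWord, List.map_append, List.map_replicate,
    List.append_assoc]

/-- Write the name of a gate whose round is in counter `t`, increased by `x`. -/
def nameCmd (idx x : ℕ) (t : Reg m) (f : ℕ → Reg m) : Cmd (Reg m) CSym :=
  seqs [outs (nameWord (unary idx)), unaryCmd x t,
    seqs ((List.range m).map fun i => unaryCmd 0 (f i))]

theorem emits_nameCmd (idx x : ℕ) {t : Reg m} {f : ℕ → Reg m} (ht : t ≠ .scratch)
    (hf : ∀ i, f i ≠ .scratch) (h : σ .scratch = 0) (htB : σ t ≤ B) (hfB : ∀ i, σ (f i) ≤ B) :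
    Emits B (nameCmd idx x t f) σ (nameWord (unary idx ++ unary (σ t + x) ++
      (List.range m).flatMap fun i => unary (σ (f i)))) := by
  refine ((emits_outs _ _).seq ((emits_unaryCmd x ht h htB).seq ((emits_seqs fun i _ =>
    emits_unaryCmd 0 (hf i) h (hfB i)).seq .skip))).cast ?_ rfl
  simp [nameWord, List.map_flatMap]

end Print

/-! ### Programs for gates, rounds and whole circuits. -/

namespace FmlSystem

variable (S : FmlSystem)

/-- Write the name of the gate for `φ` with variables in the counters `f`. -/
def fmlNameCmd (φ : Fml) (x : ℕ) (t : Reg S.m) (f : ℕ → Reg S.m) : Cmd (Reg S.m) CSym :=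
  nameCmd (S.fmls.idxOf φ) x t f

variable {S} {n B : ℕ} {e : ℕ → ℕ} {σ : Reg S.m → ℕ}

theorem emits_fmlNameCmd (φ : Fml) (x : ℕ) {t : Reg S.m} {f : ℕ → Reg S.m} (ht : t ≠ .scratch)
    (hf : ∀ i, f i ≠ .scratch) (h : σ .scratch = 0) (htB : σ t ≤ B) (hfB : ∀ i, σ (f i) ≤ B) :
    Emits B (S.fmlNameCmd φ x t f) σ (nameWord (S.name (σ t + x, φ, fun i => σ (f i)))) :=
  emits_nameCmd _ x ht hf h htB hfB

/-- The letter for a conjunction or a disjunction. -/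
def junctSym (c : Bool) : CSym := if c then .and else .or

theorem syms_junct (n : ℕ) (c : Bool) (l : List Name) :
    (Fml.junct c l : Gate n).syms = junctSym c :: l.flatMap fun h => nameWord h ++ [CSym.comma] := by
  cases c <;> rfl

variable (S) in
/-- Write the gate for a formula. -/
def gateCmd : Fml → Cmd (Reg S.m) CSym
  | .lin pos is c k => withSum is c (slot k)
      (.ite .excess (.out (junctSym pos)) (.out (junctSym !pos)))
  | .lit pos is c b => withSum is c .size
      (.ite .deficit (.out (junctSym !pos))
        (.seq (.out (if b == pos then .pos else .neg)) (.prim .sum (.bits .bit))))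
  | .bin c φ ψ => seqs [.out (junctSym c), S.fmlNameCmd φ 0 .round slot, .out .comma,
      S.fmlNameCmd ψ 0 .round slot, .out .comma]
  | .quant c i φ => seqs [.out (junctSym c), forAll .scratch .size .aux .auxLeft
      (seqs [S.fmlNameCmd φ 0 .round (Function.update slot i .aux), .out .comma])]
  | .call r args => seqs [.out .or, S.fmlNameCmd (S.defs r) 0 .round
      (fun i => (args.map slot).getD i .zero), .out .comma]

/-- A bound for the counters in the evaluation of the atoms of a formula. -/
def _root_.BisimAC.Fml.weight : Fml → ℕ
  | .lin _ is c _ => is.length + c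
  | .lit _ is c _ => is.length + c
  | _ => 0

theorem sum_le_weight {is : List ℕ} {c : ℕ} (he : ∀ i, e i ≤ n) :
    (is.map e).sum + c ≤ (is.length + c) * (n + 1) := by
  have : (is.map e).sum ≤ is.length * n := by
    induction is with
    | nil => simp
    | cons a l ih =>
      simp only [List.map_cons, List.sum_cons, List.length_cons]
      have := he a
      nlinarith
  nlinarith

theorem slot_ne_scratch (i : ℕ) : (slot i : Reg S.m) ≠ .scratch := by
  rcases slot_cases (m := S.m) i with ⟨_, h⟩ | ⟨_, h⟩ <;> simp [h]

/-- The counter `round` is one behind the gate being written, so it is the round of the inputs. For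
a quantifier, the names of the inputs differ only in the bound variable; its slot is redirected to
`aux`, and the counter that holds its value in `e` is not disturbed. -/
theorem emits_gateCmd {φ : Fml} (hφ : φ ∈ S.fmls) (h : Holds n e σ) (he : ∀ i, e i ≤ n)
    (hB : φ.weight * (n + 1) ≤ B) (hnB : n ≤ B) (ht : σ .round ≤ B) :
    Emits B (S.gateCmd φ) σ (S.gate n (σ .round + 1, φ, e)).syms := by
  have hslot : ∀ i, σ (slot i) ≤ B := fun i => by rw [h.slot]; exact (he i).trans hnB
  have heq : (fun i => σ (slot i)) = e := funext h.slot
  cases φ with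
  | lin pos is c k =>
    refine emits_withSum h ((sum_le_weight he).trans hB) (.inl ⟨k, rfl⟩) (hslot k) ?_
    simp only [gate, Fml.gate, syms_junct, List.flatMap_nil, h.slot]
    by_cases hle : (is.map e).sum + c ≤ e k
    · rw [decide_eq_true hle]
      exact (Exec.ite_zero (by simp; omega) .out).cast (by cases pos <;> rfl) rfl
    · rw [decide_eq_false hle]
      exact (Exec.ite_pos (by simp; omega) .out).cast (by cases pos <;> rfl) rfl
  | lit pos is c b =>
    have hsB := (sum_le_weight (is := is) (c := c) he).trans hB
    refine emits_withSum h hsB (.inr rfl) (by rw [h.size]; exact hnB) ?_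
    simp only [gate, Fml.gate, h.size]
    by_cases hlt : (is.map e).sum + c < n
    · rw [dif_pos hlt]
      refine (Exec.ite_pos (by simp; omega) (.seq .out (.bits (by simp; exact hsB)))).cast ?_ rfl
      simp [Gate.syms]
    · rw [dif_neg hlt, syms_junct]
      exact Exec.ite_zero (by simp; omega) .out
  | bin c φ ψ =>
    have h1 := fun φ => emits_fmlNameCmd (S := S) φ 0 (t := .round) (f := slot) (by simp)
      slot_ne_scratch h.scratch ht hslot
    simp only [heq, add_zero] at h1
    refine (Exec.seq .out ((h1 φ).seq (.seq .out ((h1 ψ).seq (.seq .out .skip))))).cast ?_ rfl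
    simp [gate, Fml.gate, syms_junct]
  | quant c i φ =>
    have hwf := (S.wf_of_mem hφ).1
    have hi : (slot i : Reg S.m) = .var ⟨i, hwf⟩ := dif_pos hwf
    have hf : ∀ a ≤ n, ∀ j, Function.update (Function.update σ .aux a) .auxLeft (n - a)
        (Function.update slot i .aux j) = Function.update e i a j := by
      intro a _ j
      by_cases hj : j = i
      · subst hj; simp
      · rw [Function.update_of_ne hj, Function.update_of_ne hj, ← h.slot]
        rcases slot_cases (m := S.m) j with ⟨_, h⟩ | ⟨_, h⟩ <;> simp [h]
    have h2 := emits_forAll (B := B) (O := CSym) (s := .scratch) (n := .size) (v := .aux)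
      (r := .auxLeft) (σ := σ)
      (p := seqs [S.fmlNameCmd φ 0 .round (Function.update slot i .aux), .out .comma])
      (o := fun a => nameWord (S.name (σ .round, φ, Function.update e i a)) ++ [CSym.comma])
      (by simp) h.scratch h.aux h.auxLeft (by rw [h.size]; exact hnB) (by
        intro a ha
        rw [h.size] at ha ⊢
        have h3 := emits_fmlNameCmd (S := S) (B := B) φ 0 (t := .round)
          (f := Function.update slot i .aux)
          (σ := Function.update (Function.update σ .aux a) .auxLeft (n - a)) (by simp)
          (by
            intro j
            rw [Function.update_apply]; split_ifs
            · simp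
            · exact slot_ne_scratch j)
          (by simp [h.scratch]) (by simpa) (by
            intro j
            rw [hf a ha, Function.update_apply]
            have := he j
            split_ifs <;> omega)
        simp only [hf a ha] at h3
        exact (h3.seq (.seq .out .skip)).cast (by simp) rfl)
    refine (Exec.seq .out (h2.seq .skip)).cast ?_ rfl
    simp [gate, Fml.gate, syms_junct, h.size, List.flatMap_map]
  | call r args =>
    have hf : ∀ j, σ ((args.map slot).getD j .zero) = argEnv args e j := by
      intro j
      simp only [argEnv, List.getD_eq_getElem?_getD, List.getElem?_map]
      cases args[j]? with
      | none => simp [h.zero]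
      | some a => simp [h.slot]
    have h1 := emits_fmlNameCmd (S := S) (B := B) (S.defs r) 0 (t := .round)
      (f := fun i => (args.map slot).getD i .zero) (σ := σ) (by simp)
      (by
        intro j
        simp only [List.getD_eq_getElem?_getD, List.getElem?_map]
        cases args[j]? with
        | none => simp
        | some a => simpa using slot_ne_scratch a) h.scratch ht (by
        intro j
        simp only [List.getD_eq_getElem?_getD, List.getElem?_map]
        cases args[j]? with
        | none => simp [h.zero]
        | some a => simpa using hslot a)
    simp only [hf, add_zero] at h1
    refine (Exec.seq .out (h1.seq (.seq .out .skip))).cast ?_ rfl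
    simp [gate, Fml.gate, Gate.syms]

variable (S) in
/-- The number of remaining rounds in the loop over a variable. -/
def remReg (j : ℕ) : Reg S.m := if h : j < S.m then .rem ⟨j, h⟩ else .temp

variable (S) in
/-- Run `p` for all values of the first `j` variables. -/
def forEnvs (p : Cmd (Reg S.m) CSym) : ℕ → Cmd (Reg S.m) CSym
  | 0 => p
  | j + 1 => forAll .scratch .size (slot j) (S.remReg j) (forEnvs p j)

/-- Each nested loop has a remainder counter of its own, and the outermost loop runs over variable
`j - 1`, which is the order of `envs`. -/
theorem emits_forEnvs {p : Cmd (Reg S.m) CSym} {o : (ℕ → ℕ) → List CSym} {t : ℕ} (hnB : n ≤ B)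
    (hp : ∀ e σ, Holds n e σ → σ .round = t → (∀ i, e i ≤ n) → Emits B p σ (o e)) {j : ℕ}
    (hj : j ≤ S.m) (h : Holds n e σ) (ht : σ .round = t) (he : ∀ i, e i ≤ n)
    (he0 : ∀ i < j, e i = 0) (hr : ∀ i < j, σ (S.remReg i) = 0) :
    Emits B (S.forEnvs p j) σ ((envs n j e).flatMap o) := by
  induction j generalizing e σ with
  | zero => exact (hp e σ h ht he).cast (by simp [envs]) rfl
  | succ j ih =>
    have hs : (slot j : Reg S.m) = .var ⟨j, hj⟩ := dif_pos hj
    have hr' : S.remReg j = .rem ⟨j, hj⟩ := dif_pos hj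
    have h1 := emits_forAll (B := B) (O := CSym) (s := .scratch) (n := .size) (v := slot j)
      (r := S.remReg j) (σ := σ) (p := S.forEnvs p j)
      (o := fun a => (envs n j (Function.update e j a)).flatMap o)
      (by simp [hs, hr']) h.scratch (by rw [h.slot]; exact he0 j (by omega)) (hr j (by omega))
      (by rw [h.size]; exact hnB) (by
        intro a ha
        rw [h.size] at ha ⊢
        rw [hs, hr']
        refine ih (by omega) ⟨fun i => ?_, ?_, ?_, ?_, ?_, ?_, ?_, ?_, ?_, ?_⟩ ?_ ?_ ?_ ?_
        · by_cases hi : i = j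
          · subst hi; simp [hs]
          · rw [Function.update_of_ne hi, ← h.slot]
            rcases slot_cases (m := S.m) i with ⟨_, h⟩ | ⟨_, h⟩ <;> simp [h, hi]
        · simpa using h.size
        · simpa using h.aux
        · simpa using h.auxLeft
        · simpa using h.scratch
        · simpa using h.sum
        · simpa using h.deficit
        · simpa using h.excess
        · simpa using h.temp
        · simpa using h.zero
        · simpa using ht
        · intro i
          rw [Function.update_apply]
          have := he i
          split_ifs <;> omega
        · intro i hi
          rw [Function.update_of_ne (by omega)]
          exact he0 i (by omega)
        · intro i hi
          have hi' : S.remReg i = .rem ⟨i, by omega⟩ := dif_pos (by omega)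
          have := hr i (by omega)
          rw [hi'] at this ⊢
          rw [Function.update_of_ne (by simp; omega), Function.update_of_ne (by simp)]
          exact this)
    refine h1.cast ?_ rfl
    rw [envs, List.flatMap_assoc, h.size]

/-- The line of a gate in the description of a circuit. -/
def gateLine (S : FmlSystem) (n : ℕ) (k : Key) : List CSym :=
  nameWord (S.name k) ++ (S.gate n k).syms ++ [CSym.semi]

/-- The lines of all gates of a round. -/
def roundLines (S : FmlSystem) (n t : ℕ) : List CSym :=
  S.fmls.flatMap fun φ => (envs n S.m fun _ => 0).flatMap fun e => S.gateLine n (t, φ, e)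

theorem syms_circuit (n T : ℕ) : (S.circuit n T).syms =
    nameWord (S.name (T, S.defs 0, fun _ => 0)) ++ [CSym.semi] ++
      (List.range (T + 1)).flatMap fun t => S.roundLines n t := by
  simp only [Circuit.syms, circuit, keys, List.flatMap_map, List.product, List.flatMap_assoc,
    roundLines, gateLine]

variable (S) in
/-- Write the lines of a round, where `x` is added to the round number in the names of the gates
and `p` writes the gates. -/
def roundCmd (x : ℕ) (p : Fml → Cmd (Reg S.m) CSym) : Cmd (Reg S.m) CSym :=
  seqs (S.fmls.map fun φ => S.forEnvs (seqs [S.fmlNameCmd φ x .round slot, p φ, .out .semi]) S.m)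

/-- Used with `x = 0` for round `0`, whose gates are all constants, and with `x = 1` for the later
rounds, in which the counter lags by one. -/
theorem emits_roundCmd {x : ℕ} {p : Fml → Cmd (Reg S.m) CSym} {t : ℕ} (hnB : n ≤ B) (htB : t ≤ B)
    (hp : ∀ φ ∈ S.fmls, ∀ e σ, Holds n e σ → σ .round = t → (∀ i, e i ≤ n) →
      Emits B (p φ) σ (S.gate n (t + x, φ, e)).syms)
    (h : Holds n (fun _ => 0) σ) (ht : σ .round = t) (hr : ∀ i, σ (S.remReg i) = 0) :
    Emits B (S.roundCmd x p) σ (S.roundLines n (t + x)) := by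
  refine emits_seqs fun φ hφ => emits_forEnvs hnB (t := t) ?_ le_rfl h ht (by simp) (by simp)
    (fun i _ => hr i)
  intro e σ h ht he
  have h1 := emits_fmlNameCmd (S := S) (B := B) φ x (t := .round) (f := slot) (σ := σ) (by simp)
    slot_ne_scratch h.scratch (by omega) (fun i => by rw [h.slot]; exact (he i).trans hnB)
  have heq : (fun i => σ (slot i)) = e := funext h.slot
  rw [heq, ht] at h1
  refine (h1.seq ((hp φ hφ e σ h ht he).seq (.seq .out .skip))).cast ?_ rfl
  simp [gateLine]

/-- The number of rounds for inputs of length `n`. -/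
def numRounds (K n : ℕ) : ℕ := K * Nat.size n + K

variable (S) in
/-- The program that writes the circuits of a system. -/
def circuitCmd (K : ℕ) : Cmd (Reg S.m) CSym :=
  seqs [copy .scratch .size .sum,
    .loop .sum (.seq (halve .sum .temp) (incs .rounds K)), incs .rounds K,
    S.fmlNameCmd (S.defs 0) 0 .rounds slot, .out .semi,
    S.roundCmd 0 (fun _ => .out .or),
    copy .scratch .rounds .roundsLeft,
    .loop .roundsLeft (seqs [.prim .roundsLeft .dec, S.roundCmd 1 S.gateCmd, .prim .round .inc])]

/-- Halving `v` down to `0` takes `v.size` rounds. This is how the program finds the logarithm of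
the input length. -/
theorem exec_size {ι O : Type} [DecidableEq ι] {u g r : ι} (hug : u ≠ g) (hur : u ≠ r) (hgr : g ≠ r)
    (K : ℕ) (v : ℕ) {σ : ι → ℕ} (h0 : σ g = 0) (hu : σ u = v) (hv : v ≤ B)
    (hB : σ r + K * v.size ≤ B) :
    Exec B (.loop u (.seq (halve u g) (incs r K)) : Cmd ι O) σ []
      (Function.update (Function.update σ u 0) r (σ r + K * v.size)) := by
  induction v using Nat.strong_induction_on generalizing σ with
  | _ v ih =>
    rcases Nat.eq_zero_or_pos v with rfl | hpos
    · refine (Exec.loop_zero hu).cast rfl ?_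
      funext x
      simp only [Function.update_apply, Nat.size_zero]
      grind
    · have hsz : v.size = (v / 2).size + 1 := by
        have h1 := Nat.size_bit (b := v.bodd) (n := v / 2) (by
          rw [← Nat.div2_val, Nat.bit_bodd_div2]; omega)
        rwa [← Nat.div2_val, Nat.bit_bodd_div2, Nat.div2_val] at h1
      rw [hsz, Nat.mul_add, Nat.mul_one] at hB
      have h1 := exec_halve (O := O) (B := B) hug h0 (by omega)
      have h2 := exec_incs (O := O) (B := B) r K (σ := Function.update σ u (σ u / 2))
        (by simp [hur.symm]; omega)
      have h3 := ih (v / 2) (by omega) (σ := Function.update (Function.update σ u (σ u / 2)) r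
        (Function.update σ u (σ u / 2) r + K)) (by simp [hgr, hug.symm, h0])
        (by simp [hur, hu]) (by omega) (by simp [hur.symm]; omega)
      refine (Exec.loop_pos (by omega) (h1.seq h2) h3).cast rfl ?_
      rw [hsz]
      funext x
      simp only [Function.update_apply]
      grind

theorem holds_of_forall {σ : Reg S.m → ℕ} (h : ∀ r, r ≠ .size → r ≠ .rounds → r ≠ .round →
    r ≠ .roundsLeft → σ r = 0) : Holds (σ .size) (fun _ => 0) σ := by
  constructor
  · intro i
    rcases slot_cases (m := S.m) i with ⟨_, h'⟩ | ⟨_, h'⟩ <;> rw [h'] <;> apply h <;> simp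
  all_goals first | rfl | (apply h <;> simp)

theorem exec_circuitCmd (K : ℕ) (hB : ∀ φ ∈ S.fmls, φ.weight * (n + 1) ≤ B) (hnB : n ≤ B)
    (hK : numRounds K n ≤ B) :
    ∃ σ, Exec B (S.circuitCmd K) (Function.update (fun _ => 0) .size n)
      (S.circuit n (numRounds K n)).syms σ := by
  -- From the writing of the output name on, the states between subprograms have no other nonzero
  -- counters than these four.
  set τ : ℕ → ℕ → ℕ → Reg S.m → ℕ := fun T t l =>
    Function.update (Function.update (Function.update (Function.update (fun _ => 0) .size n)
      .rounds T) .round t) .roundsLeft l with hτ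
  have hτh : ∀ T t l, Holds n (fun _ => 0) (τ T t l) := by
    intro T t l
    have := holds_of_forall (S := S) (σ := τ T t l) (by
      intro r h1 h2 h3 h4; simp [hτ, h1, h2, h3, h4])
    simpa [hτ] using this
  have hτr : ∀ T t l i, τ T t l (S.remReg i) = 0 := by
    intro T t l i
    unfold remReg
    split_ifs <;> simp [hτ]
  set T := numRounds K n with hT
  have hT' : K * Nat.size n + K = T := rfl
  have h1 := exec_copy (O := CSym) (B := B) (s := .scratch) (i := .size) (d := .sum)
    (σ := τ 0 0 0) (by simp) (by simp) (by simp) (by simp [hτ]) (by simpa [hτ]) (by simpa [hτ])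
  have h2 := exec_size (O := CSym) (B := B) (u := .sum) (g := .temp) (r := .rounds) (by simp)
    (by simp) (by simp) K n (σ := Function.update (τ 0 0 0) .sum (τ 0 0 0 .sum + τ 0 0 0 .size))
    (by simp [hτ]) (by simp [hτ]) hnB (by simp [hτ]; omega)
  replace h2 := h2.cast (τ := τ (K * Nat.size n) 0 0) rfl (by
    funext x
    simp only [Function.update_apply, hτ]
    grind)
  have h3 := exec_incs (O := CSym) (B := B) .rounds K (σ := τ (K * Nat.size n) 0 0)
    (by simp [hτ]; omega)
  replace h3 := h3.cast (τ := τ T 0 0) rfl (by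
    funext x
    simp only [Function.update_apply, hτ]
    grind)
  have h4 := emits_fmlNameCmd (S := S) (B := B) (S.defs 0) 0 (t := .rounds) (f := slot)
    (σ := τ T 0 0) (by simp) slot_ne_scratch (hτh _ _ _).scratch (by simp [hτ]; omega)
    (fun i => by rw [(hτh _ _ _).slot]; omega)
  have h5 := emits_roundCmd (S := S) (B := B) (n := n) (x := 0) (p := fun _ => .out .or) (t := 0)
    (σ := τ T 0 0) hnB (by omega) (fun φ _ e σ _ _ _ => Exec.out) (hτh _ _ _) (by simp [hτ])
    (hτr _ _ _)
  have h6 := exec_copy (O := CSym) (B := B) (s := .scratch) (i := .rounds) (d := .roundsLeft)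
    (σ := τ T 0 0) (by simp) (by simp) (by simp) (by simp [hτ]) (by simp [hτ]; omega)
    (by simp [hτ]; omega)
  replace h6 := h6.cast (τ := τ T 0 (T - 0)) rfl (by
    funext x
    simp only [Function.update_apply, hτ]
    grind)
  have h7 := exec_loop (O := CSym) (B := B) (i := .roundsLeft)
    (p := seqs [.prim .roundsLeft .dec, S.roundCmd 1 S.gateCmd, .prim .round .inc]) T
    (fun j => τ T j (T - j)) (fun j => S.roundLines n (j + 1))
    (fun j hj => ⟨by simp [hτ]; omega, ?_⟩) (by simp [hτ]) rfl rfl rfl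
  · have h8 : Exec B (.out .semi : Cmd (Reg S.m) CSym) (τ T 0 0) [.semi] (τ T 0 0) := .out
    have h9 := Exec.seq h1 (.seq h2 (.seq h3 (.seq h4 (.seq h8 (.seq h5 (.seq h6 (.seq h7 .skip)))))))
    have h0 : τ 0 0 0 = Function.update (fun _ => 0) .size n := by
      funext x
      simp only [Function.update_apply, hτ]
      grind
    rw [h0] at h9
    refine ⟨_, h9.cast ?_ rfl⟩
    have h10 : (fun i => τ T 0 0 (slot i)) = fun _ => 0 := funext (hτh _ _ _).slot
    have h11 : τ T 0 0 .rounds = T := by simp [hτ]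
    rw [syms_circuit, List.range_succ_eq_map, List.flatMap_cons, List.flatMap_map, h10, h11]
    simp
  · have h8 : Exec B (.prim .roundsLeft .dec : Cmd (Reg S.m) CSym) (τ T j (T - j)) []
        (τ T j (T - (j + 1))) := by
      refine (Exec.dec (v := T - (j + 1)) (by simp [hτ]; omega) (by simp [hτ]; omega)).cast rfl ?_
      simp [hτ]
    have h9 : Exec B (.prim .round .inc : Cmd (Reg S.m) CSym) (τ T j (T - (j + 1))) []
        (τ T (j + 1) (T - (j + 1))) := by
      refine (Exec.inc (by simp [hτ]; omega)).cast rfl ?_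
      funext x
      simp only [Function.update_apply, hτ]
      grind
    have hj' : τ T j (T - (j + 1)) .round = j := by simp [hτ]
    have h10 := emits_roundCmd (S := S) (B := B) (n := n) (x := 1) (p := S.gateCmd) (t := j)
      (σ := τ T j (T - (j + 1))) hnB (by omega)
      (fun φ hφ e σ h ht he => by
        have := emits_gateCmd (B := B) hφ h he (hB φ hφ) hnB (by omega)
        rwa [ht] at this)
      (hτh _ _ _) hj' (hτr _ _ _)
    exact (h8.seq (h10.seq (h9.seq .skip))).cast (by simp) rfl

theorem logspaceUniform_circuit (S : FmlSystem) (K : ℕ) :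
    LogspaceUniform fun n => S.circuit n (numRounds K n) := by
  set W := (S.fmls.map Fml.weight).sum with hW
  -- `W` pays for the sums in the atoms, `K` for the number of rounds, and `1` for the input length
  -- itself.
  refine logspaceComputable_of_exec (S.circuitCmd K) .size _ (c := W + K + 1) (by omega)
    fun w => exec_circuitCmd K ?_ ?_ ?_
  · intro φ hφ
    refine Nat.mul_le_mul_right _ ?_
    have := List.single_le_sum (l := S.fmls.map Fml.weight) (by simp) _ (List.mem_map.2 ⟨φ, hφ, rfl⟩)
    omega
  · nlinarith [Nat.zero_le (W + K)]
  · have : Nat.size w.length ≤ w.length := Nat.size_le.2 Nat.lt_two_pow_self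
    unfold numRounds
    nlinarith [Nat.zero_le (W * (w.length + 1))]

/-- A language that is defined by a system of recursive definitions in logarithmically many rounds
is in logspace-uniform `AC¹`. -/
theorem mem_AC (S : FmlSystem) (K : ℕ) (L : Language Bool)
    (h : ∀ w : List Bool, (S.defs 0).ev w S.defs (numRounds K w.length) (fun _ => 0) ↔ w ∈ L) :
    L ∈ AC 1 := by
  refine ⟨fun n => S.circuit n (numRounds K n), ?_, ?_, fun w => ?_, logspaceUniform_circuit S K⟩
  -- The same number serves as factor and as exponent. The degree `S.m + 1` comes from the
  -- assignments to `S.m` variables and from the rounds.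
  · refine ⟨(K + 1) * S.fmls.length + S.m + 1, fun n => ?_⟩
    rw [size_circuit]
    have h1 : Nat.size n ≤ n := Nat.size_le.2 Nat.lt_two_pow_self
    have h2 : numRounds K n + 1 ≤ (K + 1) * (n + 1) := by
      unfold numRounds
      nlinarith
    calc (numRounds K n + 1) * (S.fmls.length * (n + 1) ^ S.m)
        ≤ ((K + 1) * (n + 1)) * (S.fmls.length * (n + 1) ^ S.m) := Nat.mul_le_mul_right _ h2
      _ = ((K + 1) * S.fmls.length) * (n + 1) ^ (S.m + 1) := by ring
      _ ≤ _ := Nat.mul_le_mul (by omega) (Nat.pow_le_pow_right (by omega) (by omega))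
  -- `Nat.size n` is at most `Nat.log 2 n + 1`, and the additive `K` costs the second factor.
  · refine ⟨2 * K, fun n => (S.depth_circuit n _).trans ?_⟩
    have : Nat.size n ≤ Nat.log 2 n + 1 :=
      Nat.size_le.2 (Nat.lt_pow_succ_log_self (by norm_num) n)
    unfold numRounds
    rw [pow_one]
    nlinarith
  · rw [accepts_circuit, h]

end FmlSystem

end BisimAC

namespace BisimAC

/-! ### Bisimilarity -/

namespace LGraph

variable {V A : Type} {G : LGraph V A}

theorem Bisimilar.symm {x y : V} (h : G.Bisimilar x y) : G.Bisimilar y x := by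
  obtain ⟨R, hR, hxy⟩ := h
  exact ⟨fun a b => R b a, fun u v huv => ⟨(hR v u huv).2, (hR v u huv).1⟩, hxy⟩

theorem Bisimilar.trans {x y z : V} (h : G.Bisimilar x y) (h' : G.Bisimilar y z) :
    G.Bisimilar x z := by
  obtain ⟨R, hR, hxy⟩ := h
  obtain ⟨R', hR', hyz⟩ := h'
  refine ⟨fun a c => ∃ b, R a b ∧ R' b c, ?_, y, hxy, hyz⟩
  rintro u v ⟨b, h1, h2⟩
  refine ⟨fun a u' hu => ?_, fun a v' hv => ?_⟩
  · obtain ⟨b', hb, h3⟩ := (hR _ _ h1).1 a u' hu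
    obtain ⟨v', hv, h4⟩ := (hR' _ _ h2).1 a b' hb
    exact ⟨v', hv, b', h3, h4⟩
  · obtain ⟨b', hb, h3⟩ := (hR' _ _ h2).2 a v' hv
    obtain ⟨u', hu, h4⟩ := (hR _ _ h1).2 a b' hb
    exact ⟨u', hu, b', h4, h3⟩

theorem isBisimulation_bisimilar : G.IsBisimulation G.Bisimilar := by
  rintro u v ⟨R, hR, huv⟩
  refine ⟨fun a u' hu => ?_, fun a v' hv => ?_⟩
  · obtain ⟨v', hv, h⟩ := (hR _ _ huv).1 a u' hu
    exact ⟨v', hv, R, hR, h⟩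
  · obtain ⟨u', hu, h⟩ := (hR _ _ huv).2 a v' hv
    exact ⟨u', hu, R, hR, h⟩

/-- Bisimilarity is itself a bisimulation, hence a fixed point. Conversely, if the pair `x, y` meets
the conditions with respect to bisimilarity, then adding this pair gives a bisimulation. -/
theorem bisimilar_iff {x y : V} : G.Bisimilar x y ↔
    (∀ a x', G.E x a x' → ∃ y', G.E y a y' ∧ G.Bisimilar x' y') ∧
    (∀ a y', G.E y a y' → ∃ x', G.E x a x' ∧ G.Bisimilar x' y') := by
  refine ⟨fun h => isBisimulation_bisimilar _ _ h, fun h => ?_⟩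
  refine ⟨fun u v => G.Bisimilar u v ∨ u = x ∧ v = y, ?_, .inr ⟨rfl, rfl⟩⟩
  rintro u v (huv | ⟨rfl, rfl⟩)
  · obtain ⟨h1, h2⟩ := isBisimulation_bisimilar _ _ huv
    exact ⟨fun a u' hu => (h1 a u' hu).imp fun _ h => ⟨h.1, .inl h.2⟩,
      fun a u' hu => (h2 a u' hu).imp fun _ h => ⟨h.1, .inl h.2⟩⟩
  · exact ⟨fun a u' hu => (h.1 a u' hu).imp fun _ h => ⟨h.1, .inl h.2⟩,
      fun a u' hu => (h.2 a u' hu).imp fun _ h => ⟨h.1, .inl h.2⟩⟩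

end LGraph

/-! ### Deciding bisimilarity of tree nodes and graph nodes in logarithmically many rounds -/

open Relation

/-- A graph `G` that contains a copy of a graph with edges `E`, and a node `bot` whose only
successor is itself. -/
structure Arena (V M A : Type) where
  E : V → A → V → Prop
  G : LGraph M A
  emb : V → M
  bot : M
  emb_edge : ∀ v a y, G.E (emb v) a y ↔ ∃ v', y = emb v' ∧ E v a v'
  bot_edge : ∀ a y, G.E bot a y ↔ y = bot

/-- Partial information: `D t u` for `u` below `t`, `N t h` and `B t h` for `t` not bisimilar and
bisimilar to `h`, and `P t h u h'` and `Pn t h u h'` for the reduction of `t, h` to `u, h'` (see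
`Arena.truth`) being possible and impossible. -/
structure Facts (V M : Type) where
  D : V → V → Prop
  N : V → M → Prop
  B : V → M → Prop
  P : V → M → V → M → Prop
  Pn : V → M → V → M → Prop

namespace Arena

variable {V M A : Type} (T : Arena V M A)

/-- `c` is a child of `t`. -/
def Child (t c : V) : Prop := ∃ a, T.E t a c

/-- The reason for `t` not to be bisimilar to `h`, in terms of the children. -/
def Differ (N : V → M → Prop) (t : V) (h : M) : Prop :=
  (∃ a c, T.E t a c ∧ ∀ h', T.G.E h a h' → N c h') ∨
    ∃ a h', T.G.E h a h' ∧ ∀ c, T.E t a c → N c h'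

/-- The reduction step from `t, h` to `c, h'` for a child `c` of `t`: `t` is not bisimilar to `h`
if and only if there is a step from `t, h` to some `c, h'` such that `c` is not bisimilar to
`h'`. -/
def Step (N B : V → M → Prop) (t c : V) (h h' : M) : Prop :=
  (∃ a, T.E t a c ∧ T.G.E h a h' ∧ ∀ s, T.E t a s → s = c ∨ N s h') ∨
    h' = T.bot ∧
      ((∃ a h₁, T.G.E h a h₁ ∧ ¬ T.E t a c ∧ ∀ s, T.E t a s → N s h₁) ∨
        (∃ a s, ¬ s = c ∧ T.E t a s ∧ ∀ h₁, T.G.E h a h₁ → N s h₁) ∨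
        ∃ a, T.E t a c ∧ ∀ h₁, T.G.E h a h₁ → ∃ s, ¬ s = c ∧ T.E t a s ∧ B s h₁ ∧ N s (T.emb c))

/-- One round of inferences. -/
def infer (F : Facts V M) : Facts V M where
  D t u := T.Child t u ∨ ∃ w, F.D t w ∧ F.D w u
  N t h := T.Differ F.N t h ∨ ∃ u, F.D t u ∧ ∃ h', F.P t h u h' ∧ F.N u h'
  B t h := ¬ T.Differ (fun c h => ¬ F.B c h) t h ∨
    ∃ u, F.D t u ∧ ¬ ∃ h', ¬ F.Pn t h u h' ∧ ¬ F.B u h'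
  P t h u h' := T.Child t u ∧ T.Step F.N F.B t u h h' ∨
    ∃ w, F.D t w ∧ F.D w u ∧ ∃ h₁, F.P t h w h₁ ∧ F.P w h₁ u h'
  Pn t h u h' := T.Child t u ∧ ¬ T.Step (fun c h => ¬ F.B c h) (fun c h => ¬ F.N c h) t u h h' ∨
    ∃ w, F.D t w ∧ F.D w u ∧ ¬ ∃ h₁, ¬ F.Pn t h w h₁ ∧ ¬ F.Pn w h₁ u h'

/-- `t` is not bisimilar to `h`. -/
def Apart (t : V) (h : M) : Prop := ¬ T.G.Bisimilar (T.emb t) h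

/-- `t` is bisimilar to `h`. -/
def Alike (t : V) (h : M) : Prop := T.G.Bisimilar (T.emb t) h

/-- A reduction step. -/
def Reduce (x y : V × M) : Prop := T.Child x.1 y.1 ∧ T.Step T.Apart T.Alike x.1 y.1 x.2 y.2

/-- The intended facts. -/
def truth : Facts V M where
  D := TransGen T.Child
  N := T.Apart
  B := T.Alike
  P t h u h' := TransGen T.Reduce (t, h) (u, h')
  Pn t h u h' := ¬ TransGen T.Reduce (t, h) (u, h')

/-- The edges of `E` form a forest. -/
structure Forest : Prop where
  parent_unique : ∀ {t t' c}, T.Child t c → T.Child t' c → t = t'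
  acyclic : ∀ t, ¬ TransGen T.Child t t

variable {T}

theorem apart_iff_differ {t : V} {h : M} : T.Apart t h ↔ T.Differ T.Apart t h := by
  unfold Apart Differ
  rw [LGraph.bisimilar_iff]
  simp only [not_and_or, not_forall, not_exists, exists_prop, T.emb_edge]
  constructor
  · rintro (⟨a, _, ⟨c, rfl, hc⟩, h1⟩ | ⟨a, h', hh, h1⟩)
    · exact .inl ⟨a, c, hc, fun h' hh hb => (h1 h').elim (fun h => h hh) fun h => h hb⟩
    · exact .inr ⟨a, h', hh, fun c hc hb => (h1 (T.emb c)).elim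
        (fun h => (h c).elim (fun h => h rfl) fun h => h hc) fun h => h hb⟩
  · rintro (⟨a, c, hc, h1⟩ | ⟨a, h', hh, h1⟩)
    · exact .inl ⟨a, _, ⟨c, rfl, hc⟩, fun h' => or_iff_not_imp_left.2 fun hh => h1 h' (not_not.1 hh)⟩
    · refine .inr ⟨a, h', hh, fun x => or_iff_not_imp_left.2 fun hx => ?_⟩
      push Not at hx
      obtain ⟨c, rfl, hc⟩ := hx
      exact h1 c hc

theorem differ_congr {N N' : V → M → Prop} {t : V} (h : M)
    (hN : ∀ c, T.Child t c → ∀ h, N c h ↔ N' c h) : T.Differ N t h ↔ T.Differ N' t h := by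
  unfold Differ
  refine or_congr ?_ ?_
  · exact exists₂_congr fun a c => and_congr_right fun hc => forall₂_congr fun h' _ => hN c ⟨a, hc⟩ h'
  · exact exists₂_congr fun a h' => and_congr_right fun _ => forall₂_congr fun c hc => hN c ⟨a, hc⟩ h'

/-- A step into `c` consults `N` and `B` only at siblings of `c`, so it can be computed before
anything is known about the subtree of `c`. In the last clause `c` appears only as the node with
which a sibling is compared. -/
theorem step_congr {N N' B B' : V → M → Prop} {t c : V} (h h' : M)
    (hN : ∀ s, T.Child t s → s ≠ c → ∀ h, N s h ↔ N' s h)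
    (hB : ∀ s, T.Child t s → s ≠ c → ∀ h, B s h ↔ B' s h) :
    T.Step N B t c h h' ↔ T.Step N' B' t c h h' := by
  unfold Step
  refine or_congr ?_ (and_congr_right fun _ => or_congr ?_ (or_congr ?_ ?_))
  · refine exists_congr fun a => and_congr_right fun _ => and_congr_right fun _ =>
      forall₂_congr fun s hs => ?_
    by_cases hsc : s = c
    · simp [hsc]
    · simp [hsc, hN s ⟨a, hs⟩ hsc]
  · refine exists₂_congr fun a h₁ => and_congr_right fun _ => and_congr_right fun hc =>
      forall₂_congr fun s hs => hN s ⟨a, hs⟩ ?_ h₁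
    rintro rfl
    exact hc hs
  · exact exists₂_congr fun a s => and_congr_right fun hsc => and_congr_right fun hs =>
      forall₂_congr fun h₁ _ => hN s ⟨a, hs⟩ hsc h₁
  · exact exists_congr fun a => and_congr_right fun _ => forall₂_congr fun h₁ _ =>
      exists_congr fun s => and_congr_right fun hsc => and_congr_right fun hs =>
        and_congr (hB s ⟨a, hs⟩ hsc h₁) (hN s ⟨a, hs⟩ hsc _)

/-! ### Reductions along the branches of a forest. -/

section Truth

variable (hT : T.Forest)

theorem transGen_child_of_reduce {x y : V × M} (h : TransGen T.Reduce x y) :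
    TransGen T.Child x.1 y.1 := by
  induction h with
  | single h => exact .single h.1
  | tail _ h ih => exact ih.tail h.1

include hT

/-- Since parents are unique, every path down to `u` ends with the edge from `t`. -/
theorem Forest.eq_or_below {t u w : V} (h : T.Child t u) (hw : TransGen T.Child w u) :
    w = t ∨ TransGen T.Child w t := by
  rcases TransGen.tail'_iff.1 hw with ⟨x, hx, hxu⟩
  obtain rfl := hT.parent_unique h hxu
  exact reflTransGen_iff_eq_or_transGen.1 hx |>.imp Eq.symm id

/-- From a parent to its child there is no detour: a longer chain of reductions would descend from
`t` back to `t`. -/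
theorem Forest.reduce_iff {t u : V} {h h' : M} (htu : T.Child t u) :
    TransGen T.Reduce (t, h) (u, h') ↔ T.Step T.Apart T.Alike t u h h' := by
  refine ⟨fun hr => ?_, fun hs => .single ⟨htu, hs⟩⟩
  rcases TransGen.tail'_iff.1 hr with ⟨⟨x, y⟩, hx, hxu⟩
  have h1 := hT.parent_unique htu hxu.1
  simp only at h1
  subst h1
  rcases reflTransGen_iff_eq_or_transGen.1 hx with h2 | h2
  · simp only [Prod.mk.injEq, true_and] at h2
    subst h2
    exact hxu.2
  · exact absurd (transGen_child_of_reduce h2) (hT.acyclic _)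

/-- The first components of a chain of reductions descend along the only path from `t` to `u`, which
passes through `w`, so the chain can be cut there. -/
theorem Forest.reduce_comp {t w u : V} {h h' : M} (htw : TransGen T.Child t w)
    (hwu : TransGen T.Child w u) : TransGen T.Reduce (t, h) (u, h') ↔
      ∃ h₁, TransGen T.Reduce (t, h) (w, h₁) ∧ TransGen T.Reduce (w, h₁) (u, h') := by
  refine ⟨fun hr => ?_, fun ⟨_, h1, h2⟩ => h1.trans h2⟩
  have key : ∀ x y : V × M, TransGen T.Reduce x y → TransGen T.Child x.1 w →
      TransGen T.Child w y.1 → ∃ h₁, TransGen T.Reduce x (w, h₁) ∧ TransGen T.Reduce (w, h₁) y := by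
    intro x y hxy
    induction hxy with
    | single h =>
      intro h1 h2
      rcases hT.eq_or_below h.1 h2 with h3 | h3
      · exact absurd (h3 ▸ h1) (hT.acyclic _)
      · exact absurd (h1.trans h3) (hT.acyclic _)
    | tail hxy h ih =>
      intro h1 h2
      rcases hT.eq_or_below h.1 h2 with h3 | h3
      · subst h3
        exact ⟨_, hxy, .single h⟩
      · obtain ⟨h₁, h4, h5⟩ := ih h1 h3
        exact ⟨h₁, h4, h5.tail h⟩
  exact key _ _ hr htw hwu

variable [Finite V]

theorem Forest.wellFounded : WellFounded (flip T.Child) := by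
  have : Std.Irrefl (α := V) (TransGen (flip T.Child)) := ⟨fun t ht => hT.acyclic t (transGen_swap.1 ht)⟩
  have h := Finite.wellFounded_of_trans_of_irrefl (TransGen (flip T.Child))
  exact Subrelation.wf (fun h => TransGen.single h) h

variable [Nonempty A]

/-- From `bot` one can walk forever, from a node of a finite tree one cannot. `Nonempty A` provides
a label for the loop. -/
theorem Forest.apart_bot (t : V) : T.Apart t T.bot := by
  induction t using hT.wellFounded.induction with
  | _ t ih =>
    rw [apart_iff_differ]
    obtain ⟨a⟩ := ‹Nonempty A›
    exact .inr ⟨a, T.bot, (T.bot_edge _ _).2 rfl, fun c hc => ih c ⟨a, hc⟩⟩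

/-- The heart of the contraction: with the siblings settled, the recursion becomes purely
existential in `c`. Reasons for difference that do not depend on the subtree of `c` are steps to
`bot`, where the condition on `c` holds automatically. -/
theorem Forest.apart_iff_step {t c : V} {h : M} (htc : T.Child t c) :
    T.Apart t h ↔ ∃ h', T.Step T.Apart T.Alike t c h h' ∧ T.Apart c h' := by
  rw [apart_iff_differ]
  have hbot := hT.apart_bot c
  constructor
  · rintro (⟨a, s, hs, h1⟩ | ⟨a, h', hh, h1⟩)
    · by_cases hsc : s = c
      · subst hsc
        -- The reason is that `c` itself has no match. If some `h'` is shunned by all siblings, this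
        -- one successor suffices as a witness.
        by_cases h2 : ∃ h', T.G.E h a h' ∧ ∀ s', T.E t a s' → s' = s ∨ T.Apart s' h'
        · obtain ⟨h', h2, h3⟩ := h2
          exact ⟨h', .inl ⟨a, hs, h2, h3⟩, h1 h' h2⟩
        -- Otherwise each `h'` is bisimilar to a sibling `s'`, and "`c` differs from `h'`" becomes
        -- "`s'` differs from `c`" by transitivity.
        · push Not at h2
          refine ⟨T.bot, .inr ⟨rfl, .inr (.inr ⟨a, hs, fun h' hh => ?_⟩)⟩, hbot⟩
          obtain ⟨s', h3, h4, h5⟩ := h2 h' hh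
          have h5 := not_not.1 h5
          exact ⟨s', h4, h3, h5, fun h6 => h1 h' hh (h6.symm.trans h5)⟩
      · exact ⟨T.bot, .inr ⟨rfl, .inr (.inl ⟨a, s, hsc, hs, h1⟩)⟩, hbot⟩
    · by_cases hc : T.E t a c
      · exact ⟨h', .inl ⟨a, hc, hh, fun s hs => .inr (h1 s hs)⟩, h1 c hc⟩
      · exact ⟨T.bot, .inr ⟨rfl, .inl ⟨a, h', hh, hc, h1⟩⟩, hbot⟩
  · rintro ⟨h', ⟨a, hc, hh, h1⟩ | ⟨rfl, ⟨a, h₁, hh, _, h1⟩ | ⟨a, s, _, hs, h1⟩ | ⟨a, hc, h1⟩⟩, h2⟩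
    · refine .inr ⟨a, h', hh, fun s hs => ?_⟩
      rcases h1 s hs with rfl | h
      exacts [h2, h]
    · exact .inr ⟨a, h₁, hh, h1⟩
    · exact .inl ⟨a, s, hs, h1⟩
    · refine .inl ⟨a, c, hc, fun h₁ hh h3 => ?_⟩
      obtain ⟨s, _, _, h4, h5⟩ := h1 h₁ hh
      exact h5 (h4.trans h3.symm)

/-- Iterated steps: the subtree of `u` influences `t` only through one existential quantifier, at
any distance. -/
theorem Forest.apart_iff_reduce {t u : V} {h : M} (htu : TransGen T.Child t u) :
    T.Apart t h ↔ ∃ h', TransGen T.Reduce (t, h) (u, h') ∧ T.Apart u h' := by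
  induction htu using TransGen.head_induction_on generalizing h with
  | single htu => simp only [hT.reduce_iff htu, hT.apart_iff_step htu]
  | head htc hcu ih =>
    simp only [hT.apart_iff_step htc, ih, hT.reduce_comp (.single htc) hcu, hT.reduce_iff htc]
    grind

/-- Soundness: the rules for `N` and `P` are directions of the equivalences above, and those for `B`
and `Pn` come from their negations. The forest property is needed for composition and for reduction.
-/
theorem Forest.infer_truth :
    (∀ t u, (T.infer T.truth).D t u → T.truth.D t u) ∧
    (∀ t h, (T.infer T.truth).N t h → T.truth.N t h) ∧
    (∀ t h, (T.infer T.truth).B t h → T.truth.B t h) ∧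
    (∀ t h u h', (T.infer T.truth).P t h u h' → T.truth.P t h u h') ∧
    ∀ t h u h', (T.infer T.truth).Pn t h u h' → T.truth.Pn t h u h' := by
  simp only [infer, truth, not_not]
  have e1 : (fun c h => ¬ T.Alike c h) = T.Apart := rfl
  have e2 : (fun c h => ¬ T.Apart c h) = T.Alike := by
    funext c h; simp [Apart, Alike]
  have e3 : ∀ t h, T.Alike t h ↔ ¬ T.Apart t h := fun t h => by simp [Apart, Alike]
  rw [e1, e2]
  refine ⟨?_, ?_, ?_, ?_, ?_⟩
  · rintro t u (h | ⟨w, h1, h2⟩)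
    exacts [.single h, h1.trans h2]
  · rintro t h (h1 | ⟨u, htu, h1⟩)
    exacts [apart_iff_differ.2 h1, (hT.apart_iff_reduce htu).2 h1]
  · rintro t h (h1 | ⟨u, htu, h1⟩)
    · rw [e3, apart_iff_differ]; exact h1
    · rw [e3, hT.apart_iff_reduce htu]; exact h1
  · rintro t h u h' (⟨htu, h1⟩ | ⟨w, h1, h2, h3⟩)
    · exact (hT.reduce_iff htu).2 h1
    · exact (hT.reduce_comp h1 h2).2 h3
  · rintro t h u h' (⟨htu, h1⟩ | ⟨w, h1, h2, h3⟩)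
    · rwa [hT.reduce_iff htu]
    · rwa [hT.reduce_comp h1 h2]

end Truth

/-- The number of nodes below a node. -/
noncomputable def weight (T : Arena V M A) (t : V) : ℕ := {x | ReflTransGen T.Child t x}.ncard

/-! ### Weights, centroids and splitting edges. -/

section Weight

variable [Finite V] (hT : T.Forest)

theorem weight_pos (t : V) : 0 < T.weight t :=
  (Set.ncard_pos (Set.toFinite _)).2 ⟨t, .refl⟩

include hT

theorem Forest.weight_lt {t u : V} (h : TransGen T.Child t u) : T.weight u < T.weight t := by
  refine Set.ncard_lt_ncard ⟨fun x hx => h.to_reflTransGen.trans hx, fun hsub => ?_⟩ (Set.toFinite _)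
  have : ReflTransGen T.Child u t := hsub .refl
  exact hT.acyclic t (h.trans_left this)

omit [Finite V] in
-- The ancestors of `x` form a chain, since parents are unique.
theorem Forest.chain {t s x : V} (ht : ReflTransGen T.Child t x) (hs : ReflTransGen T.Child s x) :
    ReflTransGen T.Child t s ∨ ReflTransGen T.Child s t := by
  induction ht generalizing s with
  | refl => exact .inr hs
  | tail hty hyx ih =>
    rcases reflTransGen_iff_eq_or_transGen.1 hs with rfl | h
    · exact .inl (hty.tail hyx)
    · rcases hT.eq_or_below hyx h with rfl | h
      · exact .inl hty
      · exact ih h.to_reflTransGen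

/-- The subtrees of two siblings are disjoint, and neither contains `t`. -/
theorem Forest.weight_sibling {t s u : V} (hs : T.Child t s) (hu : T.Child t u) (hsu : s ≠ u) :
    T.weight s + T.weight u < T.weight t := by
  have main : ∀ {s u}, T.Child t s → T.Child t u → s ≠ u → ¬ ReflTransGen T.Child s u := by
    intro s u hs hu hsu h
    rcases reflTransGen_iff_eq_or_transGen.1 h with rfl | h
    · exact hsu rfl
    · rcases hT.eq_or_below hu h with rfl | h
      · exact hT.acyclic _ (.single hs)
      · exact hT.acyclic _ (.head hs h)
  have hdisj : Disjoint {x | ReflTransGen T.Child s x} {x | ReflTransGen T.Child u x} := by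
    rw [Set.disjoint_left]
    intro x h1 h2
    rcases hT.chain h1 h2 with h | h
    · exact main hs hu hsu h
    · exact main hu hs hsu.symm h
  unfold weight
  rw [← Set.ncard_union_eq hdisj (Set.toFinite _) (Set.toFinite _)]
  refine Set.ncard_lt_ncard ⟨?_, fun hsub => ?_⟩ (Set.toFinite _)
  · rintro x (hx | hx)
    exacts [.head hs hx, .head hu hx]
  · rcases hsub (show ReflTransGen T.Child t t from .refl) with h | h
    · exact hT.acyclic t (.head' hs h)
    · exact hT.acyclic t (.head' hu h)

/-- Descend into a child with more than `b` nodes as long as there is one. The final node has light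
children only, and it is heavy itself unless no descent took place. -/
theorem Forest.exists_centroid (b : ℕ) (t : V) : ∃ w, (t = w ∨ TransGen T.Child t w ∧ b < T.weight w) ∧
    ∀ c, T.Child w c → T.weight c ≤ b := by
  induction hn : T.weight t using Nat.strong_induction_on generalizing t with
  | _ n ih =>
    by_cases h : ∀ c, T.Child t c → T.weight c ≤ b
    · exact ⟨t, .inl rfl, h⟩
    · push Not at h
      obtain ⟨c, hc, hb⟩ := h
      obtain ⟨w, h1, h2⟩ := ih _ (hn ▸ hT.weight_lt (.single hc)) c rfl
      refine ⟨w, .inr ?_, h2⟩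
      rcases h1 with rfl | ⟨h1, h3⟩
      · exact ⟨.single hc, hb⟩
      · exact ⟨.head hc h1, h3⟩

omit [Finite V] hT in
-- The edge from `w` to `w'` is the first one on the way from `t` to `u` whose lower end has weight
-- at most `T.weight u + b`.
theorem exists_split (b : ℕ) {t u : V} (htu : TransGen T.Child t u) :
    ∃ w w', (t = w ∨ TransGen T.Child t w ∧ T.weight u + b < T.weight w) ∧ T.Child w w' ∧
      (w' = u ∨ TransGen T.Child w' u) ∧ T.weight w' ≤ T.weight u + b := by
  induction htu using TransGen.head_induction_on with
  | single h => exact ⟨_, _, .inl rfl, h, .inl rfl, by omega⟩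
  | @head t c htc hcu ih =>
    by_cases hb : T.weight c ≤ T.weight u + b
    · exact ⟨t, c, .inl rfl, htc, .inr hcu, hb⟩
    · obtain ⟨w, w', h1, h2, h3, h4⟩ := ih
      refine ⟨w, w', .inr ?_, h2, h3, h4⟩
      rcases h1 with rfl | ⟨h1, h5⟩
      · exact ⟨.single htc, by omega⟩
      · exact ⟨.head htc h1, h5⟩

end Weight

/-- The order of facts by implication. -/
structure _root_.BisimAC.Facts.Le (F F' : Facts V M) : Prop where
  D : ∀ {t u}, F.D t u → F'.D t u
  N : ∀ {t h}, F.N t h → F'.N t h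
  B : ∀ {t h}, F.B t h → F'.B t h
  P : ∀ {t h u h'}, F.P t h u h' → F'.P t h u h'
  Pn : ∀ {t h u h'}, F.Pn t h u h' → F'.Pn t h u h'

/-- All facts about the tree at `t` are known. -/
def KnownTree (T : Arena V M A) (F : Facts V M) (t : V) : Prop :=
  ∀ h, (F.N t h ↔ T.Apart t h) ∧ (F.B t h ↔ T.Alike t h)

/-- All facts about the reduction from `t` to `u` are known. -/
def KnownPath (T : Arena V M A) (F : Facts V M) (t u : V) : Prop :=
  F.D t u ∧ ∀ h h', (F.P t h u h' ↔ TransGen T.Reduce (t, h) (u, h')) ∧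
    (F.Pn t h u h' ↔ ¬ TransGen T.Reduce (t, h) (u, h'))

/-! ### What one round of inferences adds to complete knowledge. -/

section Known

variable {F F' : Facts V M} (hF' : F'.Le T.truth)

include hF'

/-- Complete knowledge persists as long as later facts remain sound. -/
theorem KnownTree.mono (h : T.KnownTree F t) (hle : F.Le F') : T.KnownTree F' t :=
  fun x => ⟨⟨hF'.N, fun h' => hle.N ((h x).1.2 h')⟩, ⟨hF'.B, fun h' => hle.B ((h x).2.2 h')⟩⟩

theorem KnownPath.mono {t u : V} (h : T.KnownPath F t u) (hle : F.Le F') : T.KnownPath F' t u :=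
  ⟨hle.D h.1, fun x y => ⟨⟨hF'.P, fun h' => hle.P ((h.2 x y).1.2 h')⟩,
    ⟨hF'.Pn, fun h' => hle.Pn ((h.2 x y).2.2 h')⟩⟩⟩

variable (hle : (T.infer F).Le F')

include hle

theorem knownTree_of_children {t : V} (h : ∀ c, T.Child t c → T.KnownTree F c) :
    T.KnownTree F' t := by
  refine fun x => ⟨⟨hF'.N, fun h' => hle.N (.inl ?_)⟩, ⟨hF'.B, fun h' => hle.B (.inl ?_)⟩⟩
  · rw [apart_iff_differ] at h'
    exact (differ_congr x fun c hc y => (h c hc y).1).2 h'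
  · rw [differ_congr (N' := T.Apart) x fun c hc y => not_congr (h c hc y).2, ← apart_iff_differ]
    exact not_not.2 h'

variable (hT : T.Forest)

include hT

/-- Only the subtrees that branch off at `t` matter; the subtree of `u` may still be unknown. -/
theorem Forest.knownPath_of_siblings {t u : V} (htu : T.Child t u)
    (h : ∀ s, T.Child t s → s ≠ u → T.KnownTree F s) : T.KnownPath F' t u := by
  have e2 : ∀ t h, ¬ T.Apart t h ↔ T.Alike t h := fun t h => by simp [Apart, Alike]
  refine ⟨hle.D (.inl htu), fun x y => ⟨⟨hF'.P, fun h' => hle.P (.inl ⟨htu, ?_⟩)⟩,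
    ⟨hF'.Pn, fun h' => hle.Pn (.inl ⟨htu, ?_⟩)⟩⟩⟩
  · rw [hT.reduce_iff htu] at h'
    exact (step_congr x y (fun s hs hsu z => (h s hs hsu z).1) (fun s hs hsu z => (h s hs hsu z).2)).2 h'
  · rw [hT.reduce_iff htu] at h'
    rwa [step_congr (N' := T.Apart) (B' := T.Alike) x y
      (fun s hs hsu z => not_congr (h s hs hsu z).2)
      (fun s hs hsu z => (not_congr (h s hs hsu z).1).trans (e2 _ _))]

/-- Every reduction from `t` to `u` passes through `w`, so impossibility can be concluded as well.
In the rule it is `D` that guarantees the position of `w`. -/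
theorem Forest.knownPath_comp {t w u : V} (h : T.KnownPath F t w) (h' : T.KnownPath F w u)
    (htw : TransGen T.Child t w) (hwu : TransGen T.Child w u) : T.KnownPath F' t u := by
  refine ⟨hle.D (.inr ⟨w, h.1, h'.1⟩), fun x y => ⟨⟨hF'.P, fun hr => hle.P (.inr ⟨w, h.1, h'.1, ?_⟩)⟩,
    ⟨hF'.Pn, fun hr => hle.Pn (.inr ⟨w, h.1, h'.1, ?_⟩)⟩⟩⟩
  · rw [hT.reduce_comp htw hwu] at hr
    simpa only [(h.2 _ _).1, (h'.2 _ _).1] using hr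
  · rw [hT.reduce_comp htw hwu] at hr
    simpa only [(h.2 _ _).2, (h'.2 _ _).2, not_not] using hr

variable [Finite V] [Nonempty A]

/-- The shortcut: knowledge jumps from `u` up to `t` in one round, whatever the length of the path.
-/
theorem Forest.knownTree_of_path {t u : V} (h : T.KnownPath F t u) (h' : T.KnownTree F u)
    (htu : TransGen T.Child t u) : T.KnownTree F' t := by
  refine fun x => ⟨⟨hF'.N, fun hr => hle.N (.inr ⟨u, h.1, ?_⟩)⟩,
    ⟨hF'.B, fun hr => hle.B (.inr ⟨u, h.1, ?_⟩)⟩⟩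
  · rw [hT.apart_iff_reduce htu] at hr
    simpa only [(h.2 _ _).1, (h' _).1] using hr
  · have hr : ¬ T.Apart t x := not_not.2 hr
    rw [hT.apart_iff_reduce htu] at hr
    simp only [(h.2 _ _).2, (h' _).2, not_not]
    exact hr

end Known

/-- After `5 j + 1` rounds everything is known about trees with at most `2 ^ j` nodes, and about
reductions that skip at most `2 ^ j` nodes. -/
theorem Forest.known (hT : T.Forest) [Finite V] [Nonempty A] {F : ℕ → Facts V M}
    (hle : ∀ k, (F k).Le (F (k + 1))) (hinf : ∀ k, (T.infer (F k)).Le (F (k + 1)))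
    (htr : ∀ k, (F k).Le T.truth) (j : ℕ) :
    (∀ t, T.weight t ≤ 2 ^ j → T.KnownTree (F (5 * j + 1)) t) ∧
    ∀ t u, TransGen T.Child t u → T.weight t ≤ T.weight u + 2 ^ j →
      T.KnownPath (F (5 * j + 1)) t u := by
  induction j with
  | zero =>
    refine ⟨fun t ht => ?_, fun t u htu ht => ?_⟩
    · refine knownTree_of_children (htr _) (hinf 0) fun c hc => ?_
      have := hT.weight_lt (.single hc)
      have := T.weight_pos c
      omega
    · have h1 : T.Child t u := by
        rcases TransGen.head'_iff.1 htu with ⟨w, hw, hwu⟩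
        rcases reflTransGen_iff_eq_or_transGen.1 hwu with rfl | h
        · exact hw
        · have := hT.weight_lt h
          have := hT.weight_lt (.single hw)
          omega
      -- `t` has at most one node more than `u`, which leaves no room for a sibling of `u`.
      refine hT.knownPath_of_siblings (htr _) (hinf 0) h1 fun s hs hsu => ?_
      have := hT.weight_sibling hs h1 hsu
      have := T.weight_pos s
      omega
  | succ j ih =>
    obtain ⟨ih1, ih2⟩ := ih
    set k := 5 * j + 1 with hk
    have hpow : 2 ^ (j + 1) = 2 ^ j + 2 ^ j := by ring
    have tree : ∀ t, T.weight t ≤ 2 ^ (j + 1) → T.KnownTree (F (k + 2)) t := by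
      intro t ht
      -- `w` has more than `2 ^ j` of the at most `2 ^ (j + 1)` nodes, so the path from `t` to `w`
      -- skips fewer than `2 ^ j`. One round settles `w` from its light children, the next one `t`.
      obtain ⟨w, h1, h2⟩ := hT.exists_centroid (2 ^ j) t
      have h3 : T.KnownTree (F (k + 1)) w :=
        knownTree_of_children (htr _) (hinf k) fun c hc => ih1 c (h2 c hc)
      rcases h1 with rfl | ⟨h1, h4⟩
      · exact h3.mono (htr _) (hle _)
      · exact hT.knownTree_of_path (htr _) (hinf (k + 1)) ((ih2 t w h1 (by omega)).mono (htr _) (hle _)) h3 h1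
    refine ⟨fun t ht => ?_, fun t u htu ht => ?_⟩
    · exact (((tree t ht).mono (htr _) (hle _)).mono (htr _) (hle _)).mono (htr _) (hle _)
    -- Both parts of the path skip at most `2 ^ j` nodes, and the siblings of `w'` have together
    -- with the skipped parts at most `2 ^ (j + 1)` nodes, so `tree` applies to them. The edge is
    -- known after three rounds, and two compositions make five.
    · obtain ⟨w, w', h1, h2, h3, h4⟩ := exists_split (T := T) (2 ^ j) htu
      have h5 : T.KnownPath (F (k + 3)) w w' := by
        refine hT.knownPath_of_siblings (htr _) (hinf (k + 2)) h2 fun s hs hsw => tree s ?_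
        have h6 := hT.weight_sibling hs h2 hsw
        have h7 : T.weight w ≤ T.weight t := by
          rcases h1 with rfl | h1
          · exact le_rfl
          · exact (hT.weight_lt h1.1).le
        have h8 : T.weight u ≤ T.weight w' := by
          rcases h3 with rfl | h3
          · exact le_rfl
          · exact (hT.weight_lt h3).le
        omega
      have h6 : ∀ {t u}, T.KnownPath (F k) t u → T.KnownPath (F (k + 3)) t u := fun h =>
        ((h.mono (htr _) (hle _)).mono (htr _) (hle _)).mono (htr _) (hle _)
      have h7 : T.KnownPath (F (k + 4)) t w' ∧ TransGen T.Child t w' := by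
        rcases h1 with rfl | ⟨h1, h8⟩
        · exact ⟨h5.mono (htr _) (hle _), .single h2⟩
        · exact ⟨hT.knownPath_comp (htr _) (hinf _) (h6 (ih2 t w h1 (by omega))) h5 h1 (.single h2),
            h1.tail h2⟩
      rcases h3 with rfl | h3
      · exact h7.1.mono (htr _) (hle _)
      · exact hT.knownPath_comp (htr _) (hinf _) h7.1
          ((h6 (ih2 w' u h3 h4)).mono (htr _) (hle _)) h7.2 h3

end Arena

end BisimAC

namespace BisimAC

/-! ### Reading the parts of an instance at positions of the input -/

/-- The name at the beginning of a word. -/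
def readName : List Sym → Name
  | .bit b :: l => b :: readName l
  | _ => []

/-- The name that begins at a position. -/
def nameAt (s : List Sym) (i : ℕ) : Name := readName (s.drop i)

theorem readName_nameSyms_append (u : Name) {l : List Sym} (h : readName l = []) :
    readName (nameSyms u ++ l) = u := by
  induction u with
  | nil => simpa [nameSyms] using h
  | cons b u ih => simpa [nameSyms, readName] using ih

/-- A word does not begin with a bit. -/
def NoBit (l : List Sym) : Prop := ∀ b l', l ≠ .bit b :: l'

theorem readName_eq_nil {l : List Sym} (h : NoBit l) : readName l = [] := by
  match l with
  | [] => rfl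
  | .bit b :: l => exact absurd rfl (h b l)
  | .comma :: l => rfl
  | .semi :: l => rfl
  | .bar :: l => rfl

theorem eq_readName_append (l : List Sym) :
    ∃ l', l = nameSyms (readName l) ++ l' ∧ NoBit l' := by
  induction l with
  | nil => exact ⟨[], rfl, by simp [NoBit]⟩
  | cons a l ih =>
    cases a with
    | bit b =>
      obtain ⟨l', h, h'⟩ := ih
      exact ⟨l', by simpa [nameSyms, readName] using h, h'⟩
    | _ => exact ⟨_, rfl, by simp [NoBit]⟩

/-- The test for the symbol `bar`. -/
def isBar : Sym → Bool
  | .bar => true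
  | _ => false

/-- The test for the ends of list entries and lists. -/
def isStop : Sym → Bool
  | .bar => true
  | .semi => true
  | _ => false

/-- The number of bars before a position. -/
def numBars (s : List Sym) (p : ℕ) : ℕ := (s.take p).countP isBar

/-- A list entry or the end of a list can be expected at position `p`, after `k` lists. -/
def Entry (s : List Sym) (k p : ℕ) : Prop :=
  numBars s p = k ∧ (p = 0 ∨ ∃ q a, q + 1 = p ∧ s[q]? = some a ∧ isStop a = true)

theorem entry_zero (s : List Sym) : Entry s 0 0 := ⟨by simp [numBars], .inl rfl⟩

theorem Entry.le_length {s : List Sym} {k p : ℕ} (h : Entry s k p) : p ≤ s.length := by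
  rcases h.2 with rfl | ⟨q, a, rfl, h, _⟩
  · omega
  · obtain ⟨h, _⟩ := List.getElem?_eq_some_iff.1 h
    omega

theorem numBars_add {s s' : List Sym} (p : ℕ) :
    numBars (s ++ s') (s.length + p) = s.countP isBar + numBars s' p := by
  simp [numBars, List.take_append, List.take_of_length_le]

theorem getElem?_append_add (s s' : List Sym) (p : ℕ) : (s ++ s')[s.length + p]? = s'[p]? := by
  rw [List.getElem?_append_right (by omega)]; simp

/-- Entries after a stop. -/
theorem entry_append {s s' : List Sym} {a : Sym} (ha : isStop a = true) {k p : ℕ} :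
    Entry (s ++ a :: s') ((s ++ [a]).countP isBar + k) (s.length + 1 + p) ↔ Entry s' k p := by
  have h1 : s ++ a :: s' = (s ++ [a]) ++ s' := by simp
  have h2 : s.length + 1 + p = (s ++ [a]).length + p := by simp
  unfold Entry
  rw [h1, h2, numBars_add]
  refine and_congr (by omega) ?_
  rcases p with _ | p
  · simp only [true_or, iff_true]
    refine .inr ⟨s.length, a, by simp, ?_, ha⟩
    simp
  · simp only [List.length_append, List.length_singleton, Nat.add_eq_zero_iff, one_ne_zero,
      and_false, false_or]
    constructor
    · rintro ⟨q, b, hq, hb, hs⟩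
      obtain rfl : q = (s ++ [a]).length + p := by simp; omega
      rw [getElem?_append_add] at hb
      exact ⟨p, b, rfl, hb, hs⟩
    · rintro ⟨q, b, hq, hb, hs⟩
      obtain rfl : q = p := by omega
      refine ⟨(s ++ [a]).length + q, b, by simp; omega, ?_, hs⟩
      rwa [getElem?_append_add]

/-- Cuts off the first list: a position with a bar before it lies behind the first bar. Statements
about list `k` are thus reduced to list `0` of a suffix. -/
theorem entry_succ_iff {s s' : List Sym} (hs : s.countP isBar = 0) {k p : ℕ} :
    Entry (s ++ .bar :: s') (k + 1) p ↔ ∃ p', p = s.length + 1 + p' ∧ Entry s' k p' := by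
  have h1 : (s ++ [Sym.bar]).countP isBar + k = k + 1 := by
    simp [hs, isBar, add_comm]
  constructor
  · intro h
    have h2 : s.length + 1 ≤ p := by
      by_contra hlt
      have : numBars (s ++ .bar :: s') p = 0 := by
        rw [numBars, List.take_append_of_le_length (by omega)]
        have := (List.take_sublist p s).countP_le (p := isBar)
        omega
      have := h.1
      omega
    obtain ⟨p', rfl⟩ := Nat.exists_eq_add_of_le h2
    rw [← h1, entry_append rfl] at h
    exact ⟨p', rfl, h⟩
  · rintro ⟨p', rfl, h⟩
    rw [← h1, entry_append rfl]
    exact h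

theorem drop_append_add (s s' : List Sym) (a : Sym) (p : ℕ) :
    (s ++ a :: s').drop (s.length + 1 + p) = s'.drop p := by
  have h1 : s ++ a :: s' = (s ++ [a]) ++ s' := by simp
  have h2 : s.length + 1 + p = (s ++ [a]).length + p := by simp
  rw [h1, h2, ← List.drop_drop, List.drop_left]

/-! ### Lists of items in a word. -/

section Items

variable {α : Type} (body : α → List Sym) (hb : ∀ x, ∀ a ∈ body x, isStop a = false)

theorem isBar_eq_false {a : Sym} (h : isStop a = false) : isBar a = false := by
  cases a <;> simp_all [isStop, isBar]

include hb

theorem countP_items (xs : List α) :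
    (xs.flatMap fun x => body x ++ [Sym.semi]).countP isBar = 0 := by
  rw [List.countP_eq_zero]
  intro a ha
  simp only [List.mem_flatMap, List.mem_append, List.mem_singleton] at ha
  obtain ⟨x, _, ha | rfl⟩ := ha
  · simp [isBar_eq_false (hb x a ha)]
  · simp [isBar]

theorem countP_body_semi (x : α) : (body x ++ [Sym.semi]).countP isBar = 0 := by
  simpa using countP_items body hb [x]

/-- Item bodies contain no stop, so up to the first bar entries occur exactly at the boundaries of
items. -/
theorem entry_items_iff (xs : List α) (s : List Sym) (p : ℕ) :
    Entry ((xs.flatMap fun x => body x ++ [Sym.semi]) ++ .bar :: s) 0 p ↔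
      ∃ xs₁ xs₂, xs = xs₁ ++ xs₂ ∧ p = (xs₁.flatMap fun x => body x ++ [Sym.semi]).length := by
  induction xs generalizing p with
  | nil =>
    simp only [List.flatMap_nil, List.nil_append, List.nil_eq, List.append_eq_nil_iff]
    constructor
    · intro h
      rcases p with _ | p
      · exact ⟨[], [], by simp⟩
      · have := h.1
        simp [numBars, isBar] at this
    · rintro ⟨_, _, ⟨rfl, rfl⟩, rfl⟩
      exact entry_zero _
  | cons x xs ih =>
    have key : ∀ p', Entry (((x :: xs).flatMap fun x => body x ++ [Sym.semi]) ++ .bar :: s) 0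
        ((body x).length + 1 + p') ↔
        Entry ((xs.flatMap fun x => body x ++ [Sym.semi]) ++ .bar :: s) 0 p' := by
      intro p'
      have h := entry_append (s := body x) (a := .semi) (k := 0) (p := p')
        (s' := (xs.flatMap fun x => body x ++ [Sym.semi]) ++ .bar :: s) rfl
      rw [countP_body_semi body hb] at h
      simpa using h
    constructor
    · intro h
      by_cases hp : (body x).length + 1 ≤ p
      · obtain ⟨p', rfl⟩ := Nat.exists_eq_add_of_le hp
        rw [key, ih] at h
        obtain ⟨xs₁, xs₂, rfl, rfl⟩ := h
        exact ⟨x :: xs₁, xs₂, rfl, by simp; omega⟩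
      · rcases h.2 with rfl | ⟨q, a, rfl, hq, ha⟩
        · exact ⟨[], _, rfl, rfl⟩
        · have h1 : q < (body x).length := by omega
          simp only [List.flatMap_cons, List.append_assoc] at hq
          rw [List.getElem?_append_left h1, List.getElem?_eq_getElem h1, Option.some_inj] at hq
          have := hb x a (hq ▸ List.getElem_mem h1)
          simp [ha] at this
    · rintro ⟨xs₁, xs₂, h, rfl⟩
      rcases xs₁ with _ | ⟨y, xs₁⟩
      · exact entry_zero _
      · simp only [List.cons_append, List.cons.injEq] at h
        obtain ⟨rfl, rfl⟩ := h
        have := (key (xs₁.flatMap fun x => body x ++ [Sym.semi]).length).2 ((ih _).2 ⟨_, _, rfl, rfl⟩)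
        convert this using 1
        simp
        omega

/-- The items of a list are what can be read at its entries. -/
theorem exists_entry_item_iff (xs : List α) (s : List Sym) (x : α)
    (hinj : ∀ y l l', body y ++ Sym.semi :: l = body x ++ Sym.semi :: l' → y = x)
    (hbar : ∀ l l', Sym.bar :: l ≠ body x ++ Sym.semi :: l') (p : ℕ) :
    (∃ l, Entry ((xs.flatMap fun x => body x ++ [Sym.semi]) ++ .bar :: s) 0 p ∧
      ((xs.flatMap fun x => body x ++ [Sym.semi]) ++ .bar :: s).drop p = body x ++ Sym.semi :: l) ↔
    ∃ xs₁ xs₂, xs = xs₁ ++ x :: xs₂ ∧ p = (xs₁.flatMap fun x => body x ++ [Sym.semi]).length := by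
  have hdrop : ∀ xs₁ xs₂ : List α, (((xs₁ ++ xs₂).flatMap fun x => body x ++ [Sym.semi]) ++
      .bar :: s).drop (xs₁.flatMap fun x => body x ++ [Sym.semi]).length =
      (xs₂.flatMap fun x => body x ++ [Sym.semi]) ++ .bar :: s := by
    intro xs₁ xs₂
    rw [List.flatMap_append, List.append_assoc, List.drop_left]
  simp only [entry_items_iff body hb]
  constructor
  · rintro ⟨l, ⟨xs₁, xs₂, rfl, rfl⟩, h⟩
    rw [hdrop] at h
    rcases xs₂ with _ | ⟨y, xs₂⟩
    · exact absurd h (hbar _ _)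
    · obtain rfl := hinj y _ _ (by simpa using h)
      exact ⟨xs₁, xs₂, rfl, rfl⟩
  · rintro ⟨xs₁, xs₂, rfl, rfl⟩
    exact ⟨_, ⟨xs₁, x :: xs₂, rfl, rfl⟩, by rw [hdrop]; simp; rfl⟩

/-- A word in which an item or a bar follows after each item begins with a list of items. -/
theorem exists_items (n : ℕ) : ∀ s : List Sym, s.length ≤ n →
    (∀ p, Entry s 0 p → (∃ l, s.drop p = .bar :: l) ∨ ∃ x l, s.drop p = body x ++ Sym.semi :: l) →
    ∃ (xs : List α) (s' : List Sym), s = (xs.flatMap fun x => body x ++ [Sym.semi]) ++ .bar :: s' := by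
  induction n with
  | zero =>
    intro s hs h
    rcases h 0 (entry_zero s) with ⟨l, h⟩ | ⟨x, l, h⟩ <;>
    · have := congrArg List.length h
      simp at this
      omega
  | succ n ih =>
    intro s hs h
    rcases h 0 (entry_zero s) with ⟨l, h1⟩ | ⟨x, l, h1⟩
    · exact ⟨[], l, h1⟩
    · rw [List.drop_zero] at h1
      subst h1
      obtain ⟨xs, s', rfl⟩ := ih l (by simp at hs; omega) fun p hp => by
        have h2 := (entry_append (s := body x) (a := .semi) rfl).2 hp
        rw [countP_body_semi body hb] at h2
        have := h _ h2
        rwa [drop_append_add] at this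
      exact ⟨x :: xs, s', by simp⟩

end Items

theorem nameSyms_noStop (u : Name) : ∀ a ∈ nameSyms u, isStop a = false := by
  intro a ha
  obtain ⟨b, _, rfl⟩ := List.mem_map.1 ha
  rfl

/-- An edge without its end marker. -/
def edgeSyms (e : Name × Name × Name) : List Sym :=
  nameSyms e.1 ++ Sym.comma :: (nameSyms e.2.1 ++ Sym.comma :: nameSyms e.2.2)

theorem edgeSyms_noStop (e : Name × Name × Name) : ∀ a ∈ edgeSyms e, isStop a = false := by
  intro a ha
  simp only [edgeSyms, List.mem_append, List.mem_cons] at ha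
  rcases ha with h | rfl | h | rfl | h
  exacts [nameSyms_noStop _ a h, rfl, nameSyms_noStop _ a h, rfl, nameSyms_noStop _ a h]

theorem nameSyms_append_inj {u v : Name} {l l' : List Sym} (hl : NoBit l) (hl' : NoBit l')
    (h : nameSyms u ++ l = nameSyms v ++ l') : u = v ∧ l = l' := by
  have h1 := congrArg readName h
  rw [readName_nameSyms_append u (readName_eq_nil hl),
    readName_nameSyms_append v (readName_eq_nil hl')] at h1
  subst h1
  exact ⟨rfl, List.append_cancel_left h⟩

theorem noBit_comma (l : List Sym) : NoBit (.comma :: l) := by simp [NoBit]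

theorem noBit_semi (l : List Sym) : NoBit (.semi :: l) := by simp [NoBit]

theorem edgeSyms_append (e : Name × Name × Name) (l : List Sym) : edgeSyms e ++ Sym.semi :: l =
    nameSyms e.1 ++ Sym.comma :: (nameSyms e.2.1 ++ Sym.comma :: (nameSyms e.2.2 ++ Sym.semi :: l)) := by
  simp [edgeSyms]

theorem edgeSyms_append_inj {e e' : Name × Name × Name} {l l' : List Sym}
    (h : edgeSyms e ++ Sym.semi :: l = edgeSyms e' ++ Sym.semi :: l') : e = e' := by
  obtain ⟨u, a, v⟩ := e
  obtain ⟨u', a', v'⟩ := e'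
  rw [edgeSyms_append, edgeSyms_append] at h
  obtain ⟨rfl, h⟩ := nameSyms_append_inj (noBit_comma _) (noBit_comma _) h
  obtain ⟨rfl, h⟩ := nameSyms_append_inj (noBit_comma _) (noBit_comma _) (List.cons.inj h).2
  obtain ⟨rfl, h⟩ := nameSyms_append_inj (noBit_semi _) (noBit_semi _) (List.cons.inj h).2
  rfl

theorem bar_ne_nameSyms (u : Name) (l l' : List Sym) : Sym.bar :: l ≠ nameSyms u ++ Sym.semi :: l' := by
  cases u <;> simp [nameSyms]

theorem bar_ne_edgeSyms (e : Name × Name × Name) (l l' : List Sym) :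
    Sym.bar :: l ≠ edgeSyms e ++ Sym.semi :: l' := by
  rw [edgeSyms_append]
  obtain ⟨u, a, v⟩ := e
  cases u <;> simp [nameSyms]

/-- The word for the lists of nodes and of edges of two graphs and for two nodes. -/
def layout (N₁ : List Name) (E₁ : List (Name × Name × Name)) (N₂ : List Name)
    (E₂ : List (Name × Name × Name)) (v₁ v₂ : Name) : List Sym :=
  (N₁.flatMap fun u => nameSyms u ++ [Sym.semi]) ++ .bar ::
  ((E₁.flatMap fun u => edgeSyms u ++ [Sym.semi]) ++ .bar ::
  ((N₂.flatMap fun u => nameSyms u ++ [Sym.semi]) ++ .bar ::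
  ((E₂.flatMap fun u => edgeSyms u ++ [Sym.semi]) ++ .bar ::
  (nameSyms v₁ ++ Sym.semi :: (nameSyms v₂ ++ [Sym.semi])))))

theorem encodeInstance_eq (G₁ G₂ : PointerGraph) (v₁ v₂ : Name) :
    encodeInstance G₁ G₂ v₁ v₂ =
      (layout G₁.nodes G₁.edges G₂.nodes G₂.edges v₁ v₂).flatMap Sym.toBits := by
  have h : ∀ e : Name × Name × Name, nameSyms e.1 ++ [Sym.comma] ++ nameSyms e.2.1 ++ [Sym.comma] ++
      nameSyms e.2.2 ++ [Sym.semi] = edgeSyms e ++ [Sym.semi] := fun e => by simp [edgeSyms]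
  rw [encodeInstance, layout]
  have h' : ∀ l : List (Name × Name × Name), (l.flatMap fun e => nameSyms e.1 ++ [Sym.comma] ++
      nameSyms e.2.1 ++ [Sym.comma] ++ nameSyms e.2.2 ++ [Sym.semi]) =
      l.flatMap fun e => edgeSyms e ++ [Sym.semi] := fun l => by simp only [h]
  rw [PointerGraph.syms, PointerGraph.syms, h', h']
  congr 1
  simp only [List.append_assoc, List.cons_append, List.nil_append]

/-- The item `x` can be read at an entry of list `k`. -/
def HasItem {α : Type} (body : α → List Sym) (s : List Sym) (k : ℕ) (x : α) : Prop :=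
  ∃ p l, Entry s k p ∧ s.drop p = body x ++ Sym.semi :: l

/-- The end of list `k` or an item can be read at every entry of list `k`. -/
def OnlyItems {α : Type} (body : α → List Sym) (s : List Sym) (k : ℕ) : Prop :=
  ∀ p, Entry s k p → (∃ l, s.drop p = .bar :: l) ∨ ∃ x l, s.drop p = body x ++ Sym.semi :: l

/-- After `k` lists, there are the nodes `v₁` and `v₂` and nothing else. -/
def HasEnd (s : List Sym) (k : ℕ) (v₁ v₂ : Name) : Prop :=
  ∃ p, Entry s k p ∧ (∀ r, r + 1 = p → s[r]? = some Sym.bar) ∧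
    s.drop p = nameSyms v₁ ++ Sym.semi :: (nameSyms v₂ ++ [Sym.semi])

section

variable {s s' : List Sym} (hs : s.countP isBar = 0) {k : ℕ} {α : Type} {body : α → List Sym}
include hs

theorem hasItem_succ_iff {x : α} :
    HasItem body (s ++ .bar :: s') (k + 1) x ↔ HasItem body s' k x := by
  simp only [HasItem, entry_succ_iff hs]
  constructor
  · rintro ⟨_, l, ⟨p, rfl, h⟩, h'⟩
    exact ⟨p, l, h, by rwa [drop_append_add] at h'⟩
  · rintro ⟨p, l, h, h'⟩
    exact ⟨_, l, ⟨p, rfl, h⟩, by rwa [drop_append_add]⟩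

theorem onlyItems_succ_iff :
    OnlyItems body (s ++ .bar :: s') (k + 1) ↔ OnlyItems body s' k := by
  simp only [OnlyItems, entry_succ_iff hs]
  constructor
  · intro h p hp
    have := h _ ⟨p, rfl, hp⟩
    rwa [drop_append_add] at this
  · rintro h _ ⟨p, rfl, hp⟩
    rw [drop_append_add]
    exact h p hp

theorem hasEnd_succ_iff {v₁ v₂ : Name} :
    HasEnd (s ++ .bar :: s') (k + 1) v₁ v₂ ↔ HasEnd s' k v₁ v₂ := by
  simp only [HasEnd, entry_succ_iff hs]
  have h1 : s ++ .bar :: s' = (s ++ [Sym.bar]) ++ s' := by simp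
  constructor
  · rintro ⟨_, ⟨p, rfl, h⟩, hr, h'⟩
    refine ⟨p, h, fun r hp => ?_, by rwa [drop_append_add] at h'⟩
    have := hr (s.length + 1 + r) (by omega)
    rwa [h1, show s.length + 1 + r = (s ++ [Sym.bar]).length + r by simp,
      getElem?_append_add] at this
  · rintro ⟨p, h, hr, h'⟩
    refine ⟨_, ⟨p, rfl, h⟩, fun r hp => ?_, by rwa [drop_append_add]⟩
    rcases p with _ | p
    · obtain rfl : r = s.length := by omega
      simp
    · obtain rfl : r = s.length + 1 + p := by omega
      rw [h1, show s.length + 1 + p = (s ++ [Sym.bar]).length + p by simp, getElem?_append_add]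
      exact hr p rfl

end

/-- A positive `p` would have a bar just before it, although no bars precede it. The clause about
this bar in `HasEnd` is what pins the position to the end of the last list. -/
theorem hasEnd_zero_iff {s : List Sym} {v₁ v₂ : Name} :
    HasEnd s 0 v₁ v₂ ↔ s = nameSyms v₁ ++ Sym.semi :: (nameSyms v₂ ++ [Sym.semi]) := by
  constructor
  · rintro ⟨p, h, hr, h'⟩
    rcases p with _ | p
    · exact h'
    · have h1 := hr p rfl
      have h2 := h.1
      rw [numBars, List.take_add_one, h1] at h2
      simp [isBar] at h2
  · intro h
    exact ⟨0, entry_zero s, by simp, h⟩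

theorem onlyItems_zero_iff {α : Type} {body : α → List Sym}
    (hb : ∀ x, ∀ a ∈ body x, isStop a = false) {s : List Sym} : OnlyItems body s 0 ↔
      ∃ (xs : List α) (s' : List Sym),
        s = (xs.flatMap fun x => body x ++ [Sym.semi]) ++ .bar :: s' := by
  refine ⟨fun h => exists_items body hb _ s le_rfl h, ?_⟩
  rintro ⟨xs, s', rfl⟩ p hp
  obtain ⟨xs₁, xs₂, rfl, rfl⟩ := (entry_items_iff body hb _ _ _).1 hp
  rw [List.flatMap_append, List.append_assoc, List.drop_left]
  rcases xs₂ with _ | ⟨x, xs₂⟩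
  · exact .inl ⟨s', rfl⟩
  · exact .inr ⟨x, _, by simp; rfl⟩

theorem hasItem_zero_iff {α : Type} {body : α → List Sym}
    (hb : ∀ x, ∀ a ∈ body x, isStop a = false)
    (hinj : ∀ x y l l', body y ++ Sym.semi :: l = body x ++ Sym.semi :: l' → y = x)
    (hbar : ∀ x l l', Sym.bar :: l ≠ body x ++ Sym.semi :: l') {xs : List α} {s : List Sym}
    {x : α} : HasItem body ((xs.flatMap fun x => body x ++ [Sym.semi]) ++ .bar :: s) 0 x ↔
      x ∈ xs := by
  constructor
  · rintro ⟨p, l, h, h'⟩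
    obtain ⟨xs₁, xs₂, rfl, -⟩ :=
      (exists_entry_item_iff body hb xs s x (hinj x) (hbar x) p).1 ⟨l, h, h'⟩
    simp
  · intro h
    obtain ⟨xs₁, xs₂, rfl⟩ := List.append_of_mem h
    obtain ⟨l, h, h'⟩ := (exists_entry_item_iff body hb _ s x (hinj x) (hbar x) _).2
      ⟨xs₁, xs₂, rfl, rfl⟩
    exact ⟨_, l, h, h'⟩

theorem nameSyms_semi_inj (u v : Name) (l l' : List Sym)
    (h : nameSyms v ++ Sym.semi :: l = nameSyms u ++ Sym.semi :: l') : v = u :=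
  (nameSyms_append_inj (noBit_semi _) (noBit_semi _) h).1

/-- What can be read from the word for two graphs and two nodes. -/
theorem layout_spec (N₁ : List Name) (E₁ : List (Name × Name × Name)) (N₂ : List Name)
    (E₂ : List (Name × Name × Name)) (v₁ v₂ : Name) :
    let s := layout N₁ E₁ N₂ E₂ v₁ v₂
    (∀ u, HasItem nameSyms s 0 u ↔ u ∈ N₁) ∧ (∀ e, HasItem edgeSyms s 1 e ↔ e ∈ E₁) ∧
    (∀ u, HasItem nameSyms s 2 u ↔ u ∈ N₂) ∧ (∀ e, HasItem edgeSyms s 3 e ↔ e ∈ E₂) ∧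
    ∀ u v, HasEnd s 4 u v ↔ u = v₁ ∧ v = v₂ := by
  have c1 := countP_items nameSyms nameSyms_noStop
  have c2 := countP_items edgeSyms edgeSyms_noStop
  have m1 := @hasItem_zero_iff _ _ nameSyms_noStop nameSyms_semi_inj bar_ne_nameSyms
  have m2 := @hasItem_zero_iff _ _ edgeSyms_noStop (fun _ _ _ _ => edgeSyms_append_inj)
    bar_ne_edgeSyms
  refine ⟨fun u => ?_, fun u => ?_, fun u => ?_, fun u => ?_, fun u v => ?_⟩ <;> unfold layout
  · rw [m1]
  · rw [hasItem_succ_iff (c1 _), m2]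
  · rw [hasItem_succ_iff (c1 _), hasItem_succ_iff (c2 _), m1]
  · rw [hasItem_succ_iff (c1 _), hasItem_succ_iff (c2 _), hasItem_succ_iff (c1 _), m2]
  · rw [hasEnd_succ_iff (c1 _), hasEnd_succ_iff (c2 _), hasEnd_succ_iff (c1 _),
      hasEnd_succ_iff (c2 _), hasEnd_zero_iff]
    constructor
    · intro h
      obtain ⟨rfl, h'⟩ := nameSyms_append_inj (noBit_semi _) (noBit_semi _) h
      exact ⟨rfl, (nameSyms_semi_inj _ _ _ _ (List.cons.inj h').2).symm⟩
    · rintro ⟨rfl, rfl⟩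
      rfl

/-- The words that describe two lists of nodes and edges and two nodes. -/
theorem exists_layout_iff {s : List Sym} : (∃ N₁ E₁ N₂ E₂ v₁ v₂, s = layout N₁ E₁ N₂ E₂ v₁ v₂) ↔
    OnlyItems nameSyms s 0 ∧ OnlyItems edgeSyms s 1 ∧ OnlyItems nameSyms s 2 ∧
      OnlyItems edgeSyms s 3 ∧ ∃ v₁ v₂, HasEnd s 4 v₁ v₂ := by
  have c1 := countP_items nameSyms nameSyms_noStop
  have c2 := countP_items edgeSyms edgeSyms_noStop
  have i1 := @onlyItems_zero_iff _ _ nameSyms_noStop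
  have i2 := @onlyItems_zero_iff _ _ edgeSyms_noStop
  constructor
  · rintro ⟨N₁, E₁, N₂, E₂, v₁, v₂, rfl⟩
    refine ⟨?_, ?_, ?_, ?_, v₁, v₂, ((layout_spec N₁ E₁ N₂ E₂ v₁ v₂).2.2.2.2 _ _).2 ⟨rfl, rfl⟩⟩ <;>
      unfold layout
    · exact i1.2 ⟨_, _, rfl⟩
    · rw [onlyItems_succ_iff (c1 _)]
      exact i2.2 ⟨_, _, rfl⟩
    · rw [onlyItems_succ_iff (c1 _), onlyItems_succ_iff (c2 _)]
      exact i1.2 ⟨_, _, rfl⟩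
    · rw [onlyItems_succ_iff (c1 _), onlyItems_succ_iff (c2 _), onlyItems_succ_iff (c1 _)]
      exact i2.2 ⟨_, _, rfl⟩
  · rintro ⟨h0, h1, h2, h3, v₁, v₂, h4⟩
    obtain ⟨N₁, s, rfl⟩ := i1.1 h0
    rw [onlyItems_succ_iff (c1 _)] at h1 h2 h3
    rw [hasEnd_succ_iff (c1 _)] at h4
    obtain ⟨E₁, s, rfl⟩ := i2.1 h1
    rw [onlyItems_succ_iff (c2 _)] at h2 h3
    rw [hasEnd_succ_iff (c2 _)] at h4
    obtain ⟨N₂, s, rfl⟩ := i1.1 h2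
    rw [onlyItems_succ_iff (c1 _)] at h3
    rw [hasEnd_succ_iff (c1 _)] at h4
    obtain ⟨E₂, s, rfl⟩ := i2.1 h3
    rw [hasEnd_succ_iff (c2 _), hasEnd_zero_iff] at h4
    subst h4
    exact ⟨N₁, E₁, N₂, E₂, v₁, v₂, rfl⟩

/-! ### Reading symbols from positions -/

theorem getElem?_drop_cons {s l : List Sym} {p : ℕ} {u : Name} {a : Sym}
    (h : s.drop p = nameSyms u ++ a :: l) :
    s[p + u.length]? = some a ∧ s.drop (p + u.length + 1) = l := by
  have h1 : (nameSyms u).length = u.length := by simp [nameSyms]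
  constructor
  · rw [← List.getElem?_drop, h, ← h1]
    simp
  · rw [add_assoc, ← List.drop_drop, h, List.append_cons,
      show u.length + 1 = (nameSyms u ++ [a]).length by simp [h1], List.drop_left]

theorem drop_nameAt (s : List Sym) (p : ℕ) :
    s.drop p = nameSyms (nameAt s p) ++ s.drop (p + (nameAt s p).length) := by
  obtain ⟨l', h, -⟩ := eq_readName_append (s.drop p)
  have h3 : (nameSyms (nameAt s p)).length = (nameAt s p).length := by simp [nameSyms]
  rw [← List.drop_drop, ← h3]
  change s.drop p = nameSyms (nameAt s p) ++ l' at h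
  rw [h, List.drop_left, ← h]

/-- The name at `p` ends before `q`, where the symbol is `a`. -/
def Ends (s : List Sym) (p q : ℕ) (a : Sym) : Prop :=
  q = p + (nameAt s p).length ∧ s[q]? = some a

theorem drop_eq_cons_iff {s l : List Sym} {p : ℕ} {u : Name} {a : Sym} (ha : NoBit (a :: l)) :
    s.drop p = nameSyms u ++ a :: l ↔
      nameAt s p = u ∧ ∃ q, Ends s p q a ∧ s.drop (q + 1) = l := by
  constructor
  · intro h
    have h1 : nameAt s p = u := by
      rw [nameAt, h, readName_nameSyms_append u (readName_eq_nil ha)]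
    obtain ⟨h2, h3⟩ := getElem?_drop_cons h
    exact ⟨h1, _, ⟨by rw [h1], h2⟩, h3⟩
  · rintro ⟨rfl, _, ⟨rfl, h1⟩, h2⟩
    rw [drop_nameAt s p]
    obtain ⟨h3, h4⟩ := List.getElem?_eq_some_iff.1 h1
    rw [List.drop_eq_getElem_cons h3, h4, h2]

theorem exists_drop_eq_nameSyms_iff {s : List Sym} {p : ℕ} {u : Name} :
    (∃ l, s.drop p = nameSyms u ++ Sym.semi :: l) ↔ nameAt s p = u ∧ ∃ q, Ends s p q .semi := by
  simp only [drop_eq_cons_iff (noBit_semi _)]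
  exact ⟨fun ⟨_, h, q, h', _⟩ => ⟨h, q, h'⟩, fun ⟨h, q, h'⟩ => ⟨_, h, q, h', rfl⟩⟩

theorem exists_drop_eq_edgeSyms_iff {s : List Sym} {p : ℕ} {e : Name × Name × Name} :
    (∃ l, s.drop p = edgeSyms e ++ Sym.semi :: l) ↔
      nameAt s p = e.1 ∧ ∃ q, Ends s p q .comma ∧ nameAt s (q + 1) = e.2.1 ∧
        ∃ q', Ends s (q + 1) q' .comma ∧ nameAt s (q' + 1) = e.2.2 ∧
          ∃ r, Ends s (q' + 1) r .semi := by
  simp only [edgeSyms_append, drop_eq_cons_iff (noBit_comma _), drop_eq_cons_iff (noBit_semi _)]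
  constructor
  · rintro ⟨_, h, q, h1, h2, q', h3, h4, r, h5, _⟩
    exact ⟨h, q, h1, h2, q', h3, h4, r, h5⟩
  · rintro ⟨h, q, h1, h2, q', h3, h4, r, h5⟩
    exact ⟨_, h, q, h1, h2, q', h3, h4, r, h5, rfl⟩

theorem drop_eq_end_iff {s : List Sym} {p : ℕ} {u v : Name} :
    s.drop p = nameSyms u ++ Sym.semi :: (nameSyms v ++ [Sym.semi]) ↔
      nameAt s p = u ∧ ∃ q, Ends s p q .semi ∧ nameAt s (q + 1) = v ∧
        ∃ r, Ends s (q + 1) r .semi ∧ ∀ a, s[r + 1]? ≠ some a := by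
  simp only [drop_eq_cons_iff (noBit_semi _), List.drop_eq_nil_iff]
  refine and_congr_right fun _ => exists_congr fun q => and_congr_right fun _ =>
    and_congr_right fun _ => exists_congr fun r => and_congr_right fun _ => ?_
  rw [← List.getElem?_eq_none_iff, Option.eq_none_iff_forall_ne_some]

theorem noBit_iff {l : List Sym} : NoBit l ↔ ∀ b, l[0]? ≠ some (.bit b) := by
  cases l <;> simp [NoBit]

/-- The end of a name in terms of single symbols. -/
theorem eq_add_length_iff {s : List Sym} {p q : ℕ} : q = p + (nameAt s p).length ↔
    p ≤ q ∧ (∀ x, p ≤ x → x < q → ∃ b, s[x]? = some (.bit b)) ∧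
      ∀ b, s[q]? ≠ some (.bit b) := by
  obtain ⟨l', h, h'⟩ := eq_readName_append (s.drop p)
  change s.drop p = nameSyms (nameAt s p) ++ l' at h
  have h3 : (nameSyms (nameAt s p)).length = (nameAt s p).length := by simp [nameSyms]
  have hx : ∀ x, (hx : x < (nameAt s p).length) →
      s[p + x]? = some (.bit (nameAt s p)[x]) := by
    intro x hx
    rw [← List.getElem?_drop, h, List.getElem?_append_left (by omega)]
    simp [nameSyms, hx]
  have he : ∀ b, s[p + (nameAt s p).length]? ≠ some (.bit b) := by
    rw [noBit_iff] at h'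
    intro b
    rw [← List.getElem?_drop, h, ← h3, List.getElem?_append_right le_rfl, Nat.sub_self]
    exact h' b
  constructor
  · rintro rfl
    refine ⟨by omega, fun x h1 h2 => ?_, he⟩
    obtain ⟨x, rfl⟩ := Nat.exists_eq_add_of_le h1
    exact ⟨_, hx x (by omega)⟩
  · rintro ⟨h1, h2, h4⟩
    obtain ⟨x, rfl⟩ := Nat.exists_eq_add_of_le h1
    rcases lt_trichotomy x (nameAt s p).length with h5 | h5 | h5
    · exact absurd (hx x h5) (h4 _)
    · omega
    · obtain ⟨b, hb⟩ := h2 (p + (nameAt s p).length) (by omega) (by omega)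
      exact absurd hb (he b)

theorem nameAt_getElem?_iff {s : List Sym} {p k : ℕ} {b : Bool} :
    (nameAt s p)[k]? = some b ↔ (∀ x, x < k → ∃ b, s[p + x]? = some (.bit b)) ∧
      s[p + k]? = some (.bit b) := by
  have key : ∀ l : List Sym, ∀ k : ℕ, (readName l)[k]? = some b ↔
      (∀ x, x < k → ∃ b, l[x]? = some (Sym.bit b)) ∧ l[k]? = some (Sym.bit b) := by
    intro l
    induction l with
    | nil => simp [readName]
    | cons a l ih =>
      intro k
      by_cases ha : ∃ c, a = .bit c
      · obtain ⟨c, rfl⟩ := ha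
        rcases k with _ | k
        · simp [readName]
        · simp only [readName, List.getElem?_cons_succ, ih]
          refine and_congr_left fun _ => ⟨fun h x hx => ?_, fun h x hx => ?_⟩
          · rcases x with _ | x
            · exact ⟨c, rfl⟩
            · simpa using h x (by omega)
          · simpa using h (x + 1) (by omega)
      · have h1 : readName (a :: l) = [] :=
          readName_eq_nil fun b l' h => ha ⟨b, (List.cons.inj h).1⟩
        rw [h1]
        simp only [List.getElem?_nil, reduceCtorEq, false_iff, not_and]
        intro h2 h3
        rcases k with _ | k
        · exact ha ⟨b, by simpa using h3⟩
        · obtain ⟨c, hc⟩ := h2 0 (by omega)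
          exact ha ⟨c, by simpa using hc⟩
  rw [nameAt, key]
  simp only [List.getElem?_drop]

/-! ### Symbols and bits -/

theorem toBits_length (a : Sym) : a.toBits.length = 3 := by cases a <;> rfl

theorem length_flatMap_toBits (s : List Sym) : (s.flatMap Sym.toBits).length = 3 * s.length := by
  induction s with
  | nil => rfl
  | cons a s ih =>
    rw [List.flatMap_cons, List.length_append, ih, toBits_length, List.length_cons]
    omega

theorem toBits_injective : Function.Injective Sym.toBits := by
  intro a b h
  cases a <;> cases b <;> simp_all [Sym.toBits]

/-- Bit `c` of the code of the symbol at a position. -/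
theorem getElem?_flatMap_toBits (s : List Sym) (v : ℕ) {c : ℕ} (hc : c < 3) :
    (s.flatMap Sym.toBits)[3 * v + c]? = s[v]?.bind fun a => a.toBits[c]? := by
  induction s generalizing v with
  | nil => simp
  | cons a s ih =>
    rw [List.flatMap_cons]
    rcases v with _ | v
    · rw [List.getElem?_append_left (by rw [toBits_length]; omega)]
      simp
    · rw [List.getElem?_append_right (by rw [toBits_length]; omega), toBits_length,
        List.getElem?_cons_succ, ← ih]
      congr 1
      omega

/-- The symbol `a` is at position `v` if and only if its code is. -/
theorem getElem?_eq_some_iff_bits {s : List Sym} {v : ℕ} {a : Sym} : s[v]? = some a ↔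
    ∀ c < 3, (s.flatMap Sym.toBits)[3 * v + c]? = a.toBits[c]? := by
  constructor
  · intro h c hc
    rw [getElem?_flatMap_toBits s v hc, h]
    rfl
  · intro h
    rcases hv : s[v]? with _ | b
    · have := h 0 (by omega)
      rw [getElem?_flatMap_toBits s v (by omega), hv] at this
      cases a <;> simp [Sym.toBits] at this
    · congr 1
      refine toBits_injective (List.ext_getElem? fun c => ?_)
      by_cases hc : c < 3
      · rw [← h c hc, getElem?_flatMap_toBits s v hc, hv]
        rfl
      · rw [List.getElem?_eq_none (by rw [toBits_length]; omega),
          List.getElem?_eq_none (by rw [toBits_length]; omega)]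

/-- The words that consist of codes of symbols. -/
theorem exists_flatMap_toBits_iff {w : List Bool} : (∃ s : List Sym, w = s.flatMap Sym.toBits) ↔
    ∀ v ≤ w.length, (∀ b, w[3 * v]? ≠ some b) ∨ ∃ a : Sym, ∀ c < 3, w[3 * v + c]? = a.toBits[c]? := by
  constructor
  · rintro ⟨s, rfl⟩ v _
    by_cases hv : v < s.length
    · exact .inr ⟨s[v], getElem?_eq_some_iff_bits.1 (List.getElem?_eq_getElem hv)⟩
    · refine .inl fun b => ?_
      rw [List.getElem?_eq_none (by rw [length_flatMap_toBits]; omega)]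
      simp
  · intro h
    have key : ∀ n, ∀ w : List Bool, w.length ≤ n → (∀ v ≤ w.length, (∀ b, w[3 * v]? ≠ some b) ∨
        ∃ a : Sym, ∀ c < 3, w[3 * v + c]? = a.toBits[c]?) →
        ∃ s : List Sym, w = s.flatMap Sym.toBits := by
      intro n
      induction n with
      | zero =>
        intro w hw _
        exact ⟨[], List.eq_nil_of_length_eq_zero (by omega)⟩
      | succ n ih =>
        intro w hw h
        rcases w with _ | ⟨b, w⟩
        · exact ⟨[], rfl⟩
        · rcases h 0 (by omega) with h0 | ⟨a, h0⟩
          · exact absurd rfl (h0 b)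
          · obtain ⟨w', hw'⟩ : ∃ w', b :: w = a.toBits ++ w' := by
              refine ⟨(b :: w).drop 3, ?_⟩
              conv_lhs => rw [← List.take_append_drop 3 (b :: w)]
              congr 1
              refine List.ext_getElem? fun c => ?_
              by_cases hc : c < 3
              · rw [List.getElem?_take_of_lt hc, ← h0 c hc]
                simp
              · rw [List.getElem?_eq_none (by simp; omega),
                  List.getElem?_eq_none (by rw [toBits_length]; omega)]
            rw [hw'] at hw h ⊢
            rw [List.length_append, toBits_length] at hw
            obtain ⟨s, rfl⟩ := ih w' (by omega) fun v hv => by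
              have h1 := h (v + 1) (by rw [List.length_append, toBits_length]; omega)
              have h2 : ∀ c, (a.toBits ++ w')[3 * (v + 1) + c]? = w'[3 * v + c]? := fun c => by
                rw [List.getElem?_append_right (by rw [toBits_length]; omega), toBits_length]
                congr 1
                omega
              have h3 : (a.toBits ++ w')[3 * (v + 1)]? = w'[3 * v]? := h2 0
              simpa only [h2, h3] using h1
            exact ⟨a :: s, by simp⟩
    exact key _ w le_rfl h

end BisimAC

namespace BisimAC

/-! ### Recursive formulas as inductive definitions -/

namespace Fml

/-- Satisfaction of a formula, given the meaning of the calls. -/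
def Sat (w : List Bool) (X : ℕ → (ℕ → ℕ) → Prop) : Fml → (ℕ → ℕ) → Prop
  | lin pos is c k, e => (is.map e).sum + c ≤ e k ↔ pos = true
  | lit pos is c b, e => w[(is.map e).sum + c]? = some b ↔ pos = true
  | bin true φ ψ, e => φ.Sat w X e ∧ ψ.Sat w X e
  | bin false φ ψ, e => φ.Sat w X e ∨ ψ.Sat w X e
  | quant true i φ, e => ∀ a ≤ w.length, φ.Sat w X (Function.update e i a)
  | quant false i φ, e => ∃ a ≤ w.length, φ.Sat w X (Function.update e i a)
  | call r args, e => X r (argEnv args e)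

/-- The number of rounds that a formula takes up to its calls. -/
def depth : Fml → ℕ
  | lin .. => 1
  | lit .. => 1
  | bin _ φ ψ => max φ.depth ψ.depth + 1
  | quant _ _ φ => φ.depth + 1
  | call .. => 1

/-- A bound for the variables of a formula and the numbers of arguments of its calls. -/
def varBound : Fml → ℕ
  | lin .. => 0
  | lit .. => 0
  | bin _ φ ψ => max φ.varBound ψ.varBound
  | quant _ i φ => max (i + 1) φ.varBound
  | call _ args => args.length

/-- A bound for the calls of a formula. -/
def callBound : Fml → ℕ
  | lin .. => 0
  | lit .. => 0
  | bin _ φ ψ => max φ.callBound ψ.callBound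
  | quant _ _ φ => φ.callBound
  | call r _ => r + 1

theorem wf_of_bound {m d : ℕ} {φ : Fml} (h : φ.varBound ≤ m) (h' : φ.callBound ≤ d) :
    φ.WF m d := by
  induction φ with
  | lin => trivial
  | lit => trivial
  | bin _ φ ψ ih ih' =>
    simp only [varBound, callBound, max_le_iff] at h h'
    exact ⟨ih h.1 h'.1, ih' h.2 h'.2⟩
  | quant _ i φ ih =>
    simp only [varBound, callBound, max_le_iff] at h h'
    exact ⟨h.1, ih h.2 h'⟩
  | call r args => exact ⟨h', h⟩

variable {w : List Bool} {defs : ℕ → Fml}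

/-- Calls occur only positively and round `0` is false, so further rounds never withdraw a fact. -/
theorem ev_succ {t : ℕ} {φ : Fml} {e : ℕ → ℕ} (h : ev w defs t φ e) : ev w defs (t + 1) φ e := by
  induction t generalizing φ e with
  | zero => exact h.elim
  | succ t ih =>
    match φ with
    | lin .. => exact h
    | lit .. => exact h
    | bin true _ _ => exact ⟨ih h.1, ih h.2⟩
    | bin false _ _ => exact Or.imp ih ih h
    | quant true _ _ => exact fun a ha => ih (h a ha)
    | quant false _ _ => exact Exists.imp (fun a ha => ⟨ha.1, ih ha.2⟩) h
    | call _ _ => exact @ih (defs _) _ h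

theorem ev_mono {t t' : ℕ} (ht : t ≤ t') {φ : Fml} {e : ℕ → ℕ} (h : ev w defs t φ e) :
    ev w defs t' φ e := by
  induction ht with
  | refl => exact h
  | step _ ih => exact ev_succ ih

theorem Sat.mono {X Y : ℕ → (ℕ → ℕ) → Prop} (hXY : ∀ r e, X r e → Y r e) {φ : Fml} {e : ℕ → ℕ}
    (h : φ.Sat w X e) : φ.Sat w Y e := by
  induction φ generalizing e with
  | lin => exact h
  | lit => exact h
  | bin c φ ψ ih ih' =>
    cases c with
    | true => exact ⟨ih h.1, ih' h.2⟩
    | false => exact Or.imp ih ih' h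
  | quant c i φ ih =>
    cases c with
    | true => exact fun a ha => ih (h a ha)
    | false => exact Exists.imp (fun a ha => ⟨ha.1, ih ha.2⟩) h
  | call r args => exact hXY _ _ h

/-- Calls hold only in models of the definitions. -/
theorem sat_of_ev {X : ℕ → (ℕ → ℕ) → Prop} (hX : ∀ r e, (defs r).Sat w X e → X r e) {t : ℕ}
    {φ : Fml} {e : ℕ → ℕ} (h : ev w defs t φ e) : φ.Sat w X e := by
  induction t generalizing φ e with
  | zero => exact h.elim
  | succ t ih =>
    match φ with
    | lin .. => exact h
    | lit .. => exact h
    | bin true _ _ => exact ⟨ih h.1, ih h.2⟩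
    | bin false _ _ => exact Or.imp ih ih h
    | quant true _ _ => exact fun a ha => ih (h a ha)
    | quant false _ _ => exact Exists.imp (fun a ha => ⟨ha.1, ih ha.2⟩) h
    | call _ _ => exact hX _ _ (@ih (defs _) _ h)

/-- If the calls are settled after `t` rounds, the connectives above them cost the depth of the
formula. A call has depth `1` because it takes a round to refer to its definition. -/
theorem ev_of_sat {t : ℕ} {φ : Fml} {e : ℕ → ℕ}
    (h : φ.Sat w (fun r e => ev w defs t (defs r) e) e) : ev w defs (t + φ.depth) φ e := by
  induction φ generalizing e with
  | lin => exact h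
  | lit => exact h
  | bin c φ ψ ih ih' =>
    have h1 : t + φ.depth ≤ t + max φ.depth ψ.depth := by omega
    have h2 : t + ψ.depth ≤ t + max φ.depth ψ.depth := by omega
    cases c with
    | true => exact ⟨ev_mono h1 (ih h.1), ev_mono h2 (ih' h.2)⟩
    | false => exact Or.imp (fun h => ev_mono h1 (ih h)) (fun h => ev_mono h2 (ih' h)) h
  | quant c i φ ih =>
    cases c with
    | true => exact fun a ha => ih (h a ha)
    | false => exact Exists.imp (fun a ha => ⟨ha.1, ih ha.2⟩) h
  | call r args => exact h

/-- The stages of an inductive definition are evaluated in a number of rounds that is linear in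
their number. -/
theorem ev_of_stage {X : ℕ → ℕ → (ℕ → ℕ) → Prop} (h0 : ∀ r e, ¬ X 0 r e)
    (hX : ∀ k r e, X (k + 1) r e → (defs r).Sat w (X k) e) {d : ℕ} (hd : ∀ r, (defs r).depth ≤ d)
    (k r : ℕ) (e : ℕ → ℕ) (h : X k r e) : ev w defs (k * d) (defs r) e := by
  induction k generalizing r e with
  | zero => exact (h0 r e h).elim
  | succ k ih =>
    refine ev_mono ?_ (ev_of_sat ((hX k r e h).mono ih))
    have := hd r
    rw [Nat.succ_mul]
    omega

/-- Exchange of the relations `2` and `3`, and of `4` and `5`. -/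
def dual : ℕ → ℕ
  | 2 => 3
  | 3 => 2
  | 4 => 5
  | 5 => 4
  | r => r

/-- The formula for the negation, where each called relation is expressed by its dual. -/
def neg : Fml → Fml
  | lin pos is c k => lin (!pos) is c k
  | lit pos is c b => lit (!pos) is c b
  | bin c φ ψ => bin (!c) φ.neg ψ.neg
  | quant c i φ => quant (!c) i φ.neg
  | call r args => call (dual r) args

/-- Negation must be pushed to the atoms to keep the system positive. At a call it is replaced by
the dual relation, which is meant to hold the complement. On formulas without calls this is true
negation, for every `X`. -/
theorem sat_neg {X : ℕ → (ℕ → ℕ) → Prop} {φ : Fml} {e : ℕ → ℕ} :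
    φ.neg.Sat w X e ↔ ¬ φ.Sat w (fun r e => ¬ X (dual r) e) e := by
  induction φ generalizing e with
  | lin pos => cases pos <;> simp [neg, Sat]
  | lit pos => cases pos <;> simp [neg, Sat]
  | bin c φ ψ ih ih' => cases c <;> simp [neg, Sat, ih, ih', -not_and, not_and_or]
  | quant c i φ ih => cases c <;> simp [neg, Sat, ih]
  | call r args => simp [neg, Sat]

end Fml

/-- The system of a list of definitions. -/
def FmlSystem.ofList (l : List Fml) (hl : l ≠ []) : FmlSystem where
  m := (l.map Fml.varBound).sum
  -- Padding with true formulas makes every called number a valid index. The padding equals the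
  -- default value of `defs`, so it does not show there.
  rels := l ++ List.replicate (l.map Fml.callBound).sum (.lin true [] 0 0)
  wf := by
    intro φ hφ
    rcases List.mem_append.1 hφ with h | h
    · refine Fml.wf_of_bound (List.single_le_sum (by simp) _ (List.mem_map_of_mem h)) ?_
      have := List.single_le_sum (by simp) _ (List.mem_map_of_mem (f := Fml.callBound) h)
      simp only [List.length_append, List.length_replicate]
      omega
    · rw [List.eq_of_mem_replicate h]
      trivial
  ne_nil := by simp [hl]

theorem FmlSystem.defs_ofList (l : List Fml) (hl : l ≠ []) :
    (FmlSystem.ofList l hl).defs = fun r => l.getD r (.lin true [] 0 0) := by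
  funext r
  simp only [FmlSystem.defs, FmlSystem.ofList, List.getD_eq_getElem?_getD]
  by_cases h : r < l.length
  · rw [List.getElem?_append_left h]
  · rw [List.getElem?_append_right (by omega), List.getElem?_eq_none (l := l) (by omega)]
    by_cases h' : r - l.length < (l.map Fml.callBound).sum
    · rw [List.getElem?_replicate_of_lt h']
      rfl
    · rw [List.getElem?_eq_none (by simpa using h')]

end BisimAC

namespace BisimAC

/-! ### Formulas that read an instance -/

theorem numBars_succ_of_bar {s : List Sym} {p : ℕ} (h : s[p]? = some .bar) :
    numBars s (p + 1) = numBars s p + 1 := by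
  rw [numBars, List.take_add_one, h]
  simp [numBars, isBar]

theorem numBars_succ_of_ne {s : List Sym} {p : ℕ} (h : s[p]? ≠ some .bar) :
    numBars s (p + 1) = numBars s p := by
  rw [numBars, List.take_add_one, List.countP_append, numBars]
  rcases hp : s[p]? with _ | a
  · simp
  · cases a <;> simp_all [isBar]

theorem numBars_eq_zero_iff {s : List Sym} {p : ℕ} :
    numBars s p = 0 ↔ ∀ x < p, s[x]? ≠ some .bar := by
  induction p with
  | zero => simp [numBars]
  | succ p ih =>
    by_cases h : s[p]? = some .bar
    · rw [numBars_succ_of_bar h]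
      exact ⟨fun h => by omega, fun h' => absurd h (h' p (by omega))⟩
    · rw [numBars_succ_of_ne h, ih]
      refine ⟨fun h' x hx => ?_, fun h' x hx => h' x (by omega)⟩
      rcases Nat.lt_succ_iff_lt_or_eq.1 hx with hx | rfl
      exacts [h' x hx, h]

/-- `x` is the last bar before `p`. Thus counting up to a fixed number is first-order. -/
theorem numBars_eq_succ_iff {s : List Sym} {p k : ℕ} : numBars s p = k + 1 ↔
    ∃ x, x < p ∧ s[x]? = some .bar ∧ numBars s x = k ∧
      ∀ y, y ≤ x ∨ p ≤ y ∨ s[y]? ≠ some .bar := by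
  induction p with
  | zero => simp [numBars]
  | succ p ih =>
    by_cases h : s[p]? = some .bar
    · rw [numBars_succ_of_bar h]
      constructor
      · intro hk
        exact ⟨p, by omega, h, by omega, fun y => by omega⟩
      · rintro ⟨x, hx, hb, hk, hy⟩
        rcases hy p with h1 | h1 | h1
        · obtain rfl : x = p := by omega
          rw [hk]
        · omega
        · exact absurd h h1
    · rw [numBars_succ_of_ne h, ih]
      constructor
      · rintro ⟨x, hx, hb, hk, hy⟩
        refine ⟨x, by omega, hb, hk, fun y => ?_⟩
        rcases hy y with h1 | h1 | h1
        · exact .inl h1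
        · rcases Nat.eq_or_lt_of_le h1 with rfl | h1
          · exact .inr (.inr h)
          · exact .inr (.inl h1)
        · exact .inr (.inr h1)
      · rintro ⟨x, hx, hb, hk, hy⟩
        have hxp : x ≠ p := by
          rintro rfl
          exact h hb
        refine ⟨x, by omega, hb, hk, fun y => ?_⟩
        rcases hy y with h1 | h1 | h1
        · exact .inl h1
        · exact .inr (.inl (by omega))
        · exact .inr (.inr h1)

/-- The code of a word. -/
def bits (s : List Sym) : List Bool := s.flatMap Sym.toBits

theorem length_bits (s : List Sym) : (bits s).length = 3 * s.length := length_flatMap_toBits s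

theorem le_length_bits {s : List Sym} {x : ℕ} {a : Sym} (h : s[x]? = some a) :
    x + 3 ≤ (bits s).length := by
  obtain ⟨h, -⟩ := List.getElem?_eq_some_iff.1 h
  rw [length_bits]
  omega

namespace Fml

/-- Conjunction. -/
def conj (φ ψ : Fml) : Fml := bin true φ ψ
/-- Disjunction. -/
def disj (φ ψ : Fml) : Fml := bin false φ ψ
/-- Universal quantification. -/
def all (i : ℕ) (φ : Fml) : Fml := quant true i φ
/-- Existential quantification. -/
def ex (i : ℕ) (φ : Fml) : Fml := quant false i φ

section

variable {w : List Bool} {X : ℕ → (ℕ → ℕ) → Prop} {φ ψ : Fml} {e : ℕ → ℕ} {p q : Prop} {i : ℕ}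

theorem sat_conj (h : φ.Sat w X e ↔ p) (h' : ψ.Sat w X e ↔ q) :
    (conj φ ψ).Sat w X e ↔ p ∧ q := and_congr h h'

theorem sat_conj_of (h : φ.Sat w X e ↔ p) (h' : p → (ψ.Sat w X e ↔ q)) :
    (conj φ ψ).Sat w X e ↔ p ∧ q :=
  (and_congr_left' h).trans (and_congr_right h')

theorem sat_disj (h : φ.Sat w X e ↔ p) (h' : ψ.Sat w X e ↔ q) :
    (disj φ ψ).Sat w X e ↔ p ∨ q := or_congr h h'

theorem sat_ex : (ex i φ).Sat w X e ↔ ∃ a ≤ w.length, φ.Sat w X (Function.update e i a) := Iff.rfl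

theorem sat_all : (all i φ).Sat w X e ↔ ∀ a ≤ w.length, φ.Sat w X (Function.update e i a) :=
  Iff.rfl

/-- Quantifiers of formulas stop at the input length. The side conditions here and in `sat_all_of`
say that nothing is lost by this. -/
theorem sat_ex_of {P : ℕ → Prop} (h : ∀ a ≤ w.length, (φ.Sat w X (Function.update e i a) ↔ P a))
    (hb : ∀ a, P a → a ≤ w.length) : (ex i φ).Sat w X e ↔ ∃ a, P a :=
  ⟨fun ⟨a, ha, h'⟩ => ⟨a, (h a ha).1 h'⟩, fun ⟨a, h'⟩ => ⟨a, hb a h', (h a (hb a h')).2 h'⟩⟩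

theorem sat_all_of {P : ℕ → Prop} (h : ∀ a ≤ w.length, (φ.Sat w X (Function.update e i a) ↔ P a))
    (hb : ∀ a, w.length < a → P a) : (all i φ).Sat w X e ↔ ∀ a, P a :=
  ⟨fun h' a => (le_or_gt a w.length).elim (fun ha => (h a ha).1 (h' a ha)) (hb a),
    fun h' a ha => (h a ha).2 (h' a)⟩

theorem sat_lin {is : List ℕ} {c k : ℕ} :
    (lin true is c k).Sat w X e ↔ (is.map e).sum + c ≤ e k := by simp [Sat]

theorem sat_not_lin {is : List ℕ} {c k : ℕ} :
    (lin false is c k).Sat w X e ↔ e k < (is.map e).sum + c := by simp [Sat]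

/-- Variable `j` is the successor of variable `i`. -/
def isSucc (i j : ℕ) : Fml := conj (lin true [i] 1 j) (lin false [i] 2 j)

theorem sat_isSucc {j : ℕ} : (isSucc i j).Sat w X e ↔ e i + 1 = e j :=
  (sat_conj sat_lin sat_not_lin).trans (by simp; omega)

/-- Variable `i` is `0`. -/
def isZero (i : ℕ) : Fml := lin false [] 1 i

theorem sat_isZero : (isZero i).Sat w X e ↔ e i = 0 := sat_not_lin.trans (by simp)

/-- Variable `i` is `1`. -/
def isOne (i : ℕ) : Fml := conj (lin true [] 1 i) (lin false [] 2 i)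

theorem sat_isOne : (isOne i).Sat w X e ↔ e i = 1 :=
  (sat_conj sat_lin sat_not_lin).trans (by simp; omega)

/-- The symbol `a` is at the sum of some variables. -/
def symAt (is : List ℕ) (a : Sym) : Fml :=
  conj (lit true (is ++ is ++ is) 0 (a.toBits.getD 0 false))
    (conj (lit true (is ++ is ++ is) 1 (a.toBits.getD 1 false))
      (lit true (is ++ is ++ is) 2 (a.toBits.getD 2 false)))

theorem sat_symAt_bits {is : List ℕ} {a : Sym} : (symAt is a).Sat w X e ↔
    ∀ c < 3, w[3 * (is.map e).sum + c]? = a.toBits[c]? := by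
  have h0 : ∀ c < 3, a.toBits[c]? = some (a.toBits.getD c false) := fun c hc => by
    have : c < a.toBits.length := by rwa [toBits_length]
    rw [List.getD_eq_getElem?_getD, List.getElem?_eq_getElem this]
    rfl
  -- Sums of variables are the only terms; listing the variables three times yields the factor `3`
  -- from symbols to bits.
  have h3 : ((is ++ is ++ is).map e).sum = 3 * (is.map e).sum := by
    simp only [List.map_append, List.sum_append]
    omega
  refine (sat_conj Iff.rfl (sat_conj Iff.rfl Iff.rfl)).trans ?_
  simp only [Sat, h3, iff_true]
  constructor
  · rintro ⟨h1, h2, h4⟩ c hc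
    rw [h0 c hc]
    interval_cases c
    exacts [h1, h2, h4]
  · intro h
    exact ⟨(h 0 (by omega)).trans (h0 0 (by omega)), (h 1 (by omega)).trans (h0 1 (by omega)),
      (h 2 (by omega)).trans (h0 2 (by omega))⟩

end

/-! ### Formulas about symbols, names and lists, where `f` is always a number from which on
variables are unused. -/

variable {s : List Sym} {X : ℕ → (ℕ → ℕ) → Prop} {e : ℕ → ℕ} {f i j k p : ℕ}

theorem sat_symAt {is : List ℕ} {a : Sym} :
    (symAt is a).Sat (bits s) X e ↔ s[(is.map e).sum]? = some a :=
  sat_symAt_bits.trans getElem?_eq_some_iff_bits.symm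

theorem sat_symAt_singleton {a : Sym} : (symAt [i] a).Sat (bits s) X e ↔ s[e i]? = some a := by
  rw [sat_symAt]
  simp

/-- A bit is at the sum of some variables. -/
def isBit (is : List ℕ) : Fml := disj (symAt is (.bit false)) (symAt is (.bit true))

theorem sat_isBit {is : List ℕ} :
    (isBit is).Sat (bits s) X e ↔ ∃ b, s[(is.map e).sum]? = some (.bit b) :=
  (sat_disj sat_symAt sat_symAt).trans (by simp)

/-- Bit `k` of the name at `i` is `b`. -/
def nameBit (f i k : ℕ) (b : Bool) : Fml :=
  conj (all f (disj (lin true [k] 0 f) (isBit [i, f]))) (symAt [i, k] (.bit b))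

theorem sat_nameBit {b : Bool} (hi : i < f) (hk : k < f) (hn : e k ≤ (bits s).length) :
    (nameBit f i k b).Sat (bits s) X e ↔ (nameAt s (e i))[e k]? = some b := by
  rw [nameAt_getElem?_iff]
  refine sat_conj ?_ (sat_symAt.trans (by simp))
  refine (sat_all_of (P := fun x => e k ≤ x ∨ ∃ b, s[e i + x]? = some (Sym.bit b))
    (fun a _ => sat_disj (sat_lin.trans ?_) (sat_isBit.trans ?_)) fun a ha => .inl (by omega)).trans
      (forall_congr' fun a => ?_)
  · simp (disch := omega)
  · simp (disch := omega)
  · rw [← not_lt, ← imp_iff_not_or]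

/-- The names at `i` and `j` are equal. -/
def same (f i j : ℕ) : Fml := all f (conj
  (disj (conj (nameBit (f + 1) i f true) (nameBit (f + 1) j f true))
    (conj (nameBit (f + 1) i f true).neg (nameBit (f + 1) j f true).neg))
  (disj (conj (nameBit (f + 1) i f false) (nameBit (f + 1) j f false))
    (conj (nameBit (f + 1) i f false).neg (nameBit (f + 1) j f false).neg)))

theorem length_nameAt_le (s : List Sym) (i : ℕ) : (nameAt s i).length ≤ s.length := by
  have := congrArg List.length (drop_nameAt s i)
  simp only [List.length_append, List.length_drop, nameSyms, List.length_map] at this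
  omega

theorem sat_same (hi : i < f) (hj : j < f) :
    (same f i j).Sat (bits s) X e ↔ nameAt s (e i) = nameAt s (e j) := by
  -- Stated for all `X`, since under `neg` the formula is evaluated with the dual meaning of calls.
  have hb : ∀ a ≤ (bits s).length, ∀ (X : ℕ → (ℕ → ℕ) → Prop), ∀ k < f, ∀ b,
      (nameBit (f + 1) k f b).Sat (bits s) X (Function.update e f a) ↔
        (nameAt s (e k))[a]? = some b := by
    intro a ha X k hk b
    rw [sat_nameBit (by omega) (by omega) (by simpa using ha)]
    simp (disch := omega)
  refine (sat_all_of (P := fun a => (nameAt s (e i))[a]? = (nameAt s (e j))[a]?)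
    (fun a ha => ?_) fun a ha => ?_).trans List.ext_getElem?_iff.symm
  · refine (sat_conj
      (sat_disj (sat_conj (hb a ha _ i hi _) (hb a ha _ j hj _))
        (sat_conj (sat_neg.trans (not_congr (hb a ha _ i hi _)))
          (sat_neg.trans (not_congr (hb a ha _ j hj _)))))
      (sat_disj (sat_conj (hb a ha _ i hi _) (hb a ha _ j hj _))
        (sat_conj (sat_neg.trans (not_congr (hb a ha _ i hi _)))
          (sat_neg.trans (not_congr (hb a ha _ j hj _)))))).trans ?_
    rcases (nameAt s (e i))[a]? with _ | (_ | _) <;> rcases (nameAt s (e j))[a]? with _ | (_ | _) <;>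
      simp
  · rw [length_bits] at ha
    have h1 := length_nameAt_le s (e i)
    have h2 := length_nameAt_le s (e j)
    rw [List.getElem?_eq_none (by omega), List.getElem?_eq_none (by omega)]

/-- The name at `i` ends before `j`, where the symbol is `a`. -/
def ends (f i j : ℕ) (a : Sym) : Fml :=
  conj (lin true [i] 0 j) (conj
    (all f (disj (lin true [f] 1 i) (disj (lin true [j] 0 f) (isBit [f])))) (symAt [j] a))

theorem sat_ends {a : Sym} (ha : ∀ b, a ≠ .bit b) (hi : i < f) (hj : j < f) :
    (ends f i j a).Sat (bits s) X e ↔ Ends s (e i) (e j) a := by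
  -- The symbol at `e j` shows that `e j` is within the input, so the bounded quantifier reaches all
  -- positions of the name.
  have h1 : ∀ P : Prop, P ∧ s[e j]? = some a →
      ((∀ x ≤ (bits s).length, x + 1 ≤ e i ∨ e j ≤ x ∨ ∃ b, s[x]? = some (.bit b)) ↔
        ∀ x, e i ≤ x → x < e j → ∃ b, s[x]? = some (.bit b)) := by
    rintro P ⟨_, h⟩
    have := le_length_bits h
    constructor
    · intro h x hx hx'
      rcases h x (by omega) with h | h | h
      exacts [by omega, by omega, h]
    · intro h x _
      by_cases h1 : e i ≤ x
      · by_cases h2 : x < e j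
        · exact .inr (.inr (h x h1 h2))
        · exact .inr (.inl (by omega))
      · exact .inl (by omega)
  rw [Ends, eq_add_length_iff]
  refine (sat_conj sat_lin (sat_conj (sat_all.trans (forall₂_congr fun a _ =>
    sat_disj sat_lin (sat_disj sat_lin sat_isBit))) sat_symAt_singleton)).trans ?_
  simp (disch := omega) only [List.map_cons, List.map_nil, List.sum_cons, List.sum_nil, add_zero,
    Function.update_self, Function.update_of_ne]
  constructor
  · rintro ⟨h2, h3, h4⟩
    exact ⟨⟨h2, (h1 True ⟨trivial, h4⟩).1 h3, fun b => by simpa [h4] using ha b⟩, h4⟩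
  · rintro ⟨⟨h2, h3, h5⟩, h4⟩
    exact ⟨h2, (h1 True ⟨trivial, h4⟩).2 h3, h4⟩

/-- There are `k` bars before `p`. -/
def bars : ℕ → ℕ → ℕ → Fml
  | f, 0, p => all f (disj (lin true [p] 0 f) (symAt [f] .bar).neg)
  | f, k + 1, p => ex f (conj (lin true [f] 1 p) (conj (symAt [f] .bar) (conj (bars (f + 2) k f)
      (all (f + 1) (disj (lin true [f + 1] 0 f) (disj (lin true [p] 0 (f + 1))
        (symAt [f + 1] .bar).neg))))))

theorem sat_bars (hp : p < f) : (bars f k p).Sat (bits s) X e ↔ numBars s (e p) = k := by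
  have hle : ∀ x, (bits s).length < x → s[x]? ≠ some .bar := fun x hx h => by
    have := le_length_bits h
    omega
  induction k generalizing f p e with
  | zero =>
    rw [numBars_eq_zero_iff]
    refine (sat_all_of (P := fun x => e p ≤ x ∨ s[x]? ≠ some .bar) (fun a _ => ?_)
      fun a ha => .inr (hle a ha)).trans (forall_congr' fun a => ?_)
    · refine (sat_disj sat_lin (sat_neg.trans (not_congr sat_symAt_singleton))).trans ?_
      simp (disch := omega)
    · rw [← not_lt, ← imp_iff_not_or]
  | succ k ih =>
    rw [numBars_eq_succ_iff]
    refine sat_ex_of (fun a _ => ?_) fun a h => by have := le_length_bits h.2.1; omega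
    refine sat_conj (sat_lin.trans ?_) (sat_conj (sat_symAt_singleton.trans ?_)
      (sat_conj ((ih (by omega)).trans ?_) (sat_all_of (fun y _ => ?_)
        fun y hy => .inr (.inr (hle y hy)))))
    · simp (disch := omega)
    · simp
    · simp
    · refine sat_disj (sat_lin.trans ?_) (sat_disj (sat_lin.trans ?_)
        (sat_neg.trans (not_congr (sat_symAt_singleton.trans ?_)))) <;> simp (disch := omega)

/-- An entry of list `k` can be expected at `p`. -/
def entry (f k p : ℕ) : Fml :=
  conj (bars f k p) (disj (isZero p)
    (ex f (conj (isSucc f p) (disj (symAt [f] .bar) (symAt [f] .semi)))))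

theorem sat_entry (hp : p < f) : (entry f k p).Sat (bits s) X e ↔ Entry s k (e p) := by
  refine sat_conj (sat_bars hp) (sat_disj sat_isZero (sat_ex_of (fun a _ => (sat_conj sat_isSucc
    (sat_disj sat_symAt_singleton sat_symAt_singleton)).trans ?_) ?_))
  · simp (disch := omega) only [Function.update_self, Function.update_of_ne]
    constructor
    · rintro ⟨h1, h2 | h2⟩
      exacts [⟨_, h1, h2, rfl⟩, ⟨_, h1, h2, rfl⟩]
    · rintro ⟨b, h1, h2, h3⟩
      cases b <;> simp_all [isStop]
  · rintro a ⟨b, h1, h2, h3⟩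
    have := le_length_bits h2
    omega

/-- The item at `p` is the name at `i`. -/
def nameItem (f p i : ℕ) : Fml := conj (same f p i) (ex f (ends (f + 1) p f .semi))

theorem Ends_le {s : List Sym} {p q : ℕ} {a : Sym} (h : Ends s p q a) :
    q + 3 ≤ (bits s).length := le_length_bits h.2

theorem sat_nameItem (hp : p < f) (hi : i < f) : (nameItem f p i).Sat (bits s) X e ↔
    ∃ l, s.drop (e p) = nameSyms (nameAt s (e i)) ++ Sym.semi :: l := by
  rw [exists_drop_eq_nameSyms_iff]
  refine sat_conj (sat_same hp hi) (sat_ex_of (fun a _ => (sat_ends (by simp) (by omega)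
    (by omega)).trans ?_) fun a h => by have := Ends_le h; omega)
  simp (disch := omega)

/-- The item at `p` is an edge from the name at `i` to the name at `j` with the name at `a` as
its label. -/
def edgeItem (f p i a j : ℕ) : Fml :=
  conj (same f p i) (ex f (conj (ends (f + 1) p f .comma) (ex (f + 1) (conj (isSucc f (f + 1)) (conj
    (same (f + 2) (f + 1) a) (ex (f + 2) (conj (ends (f + 3) (f + 1) (f + 2) .comma)
      (ex (f + 3) (conj (isSucc (f + 2) (f + 3)) (conj (same (f + 4) (f + 3) j)
        (ex (f + 4) (ends (f + 5) (f + 3) (f + 4) .semi))))))))))))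

/-- Most of the formulas take variables rather than terms, so a successor position needs a variable
of its own. -/
theorem sat_ex_succ {w : List Bool} {φ : Fml} {P : ℕ → Prop} (hij : i ≠ j)
    (hi : e i + 1 ≤ w.length)
    (h : ∀ a, φ.Sat w X (Function.update e j a) ↔ P a) :
    (ex j (conj (isSucc i j) φ)).Sat w X e ↔ P (e i + 1) := by
  refine (sat_ex_of (P := fun a => e i + 1 = a ∧ P a) (fun a _ => sat_conj (sat_isSucc.trans ?_) (h a))
    fun a h => by omega).trans (by simp)
  simp [hij]

/-- Each end of a name bounds the next position: by `Ends_le` it lies at least three below the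
number of bits, so its successor is in the range of the quantifiers. -/
theorem sat_edgeItem {a : ℕ} (hp : p < f) (hi : i < f) (ha : a < f) (hj : j < f) :
    (edgeItem f p i a j).Sat (bits s) X e ↔
      ∃ l, s.drop (e p) = edgeSyms (nameAt s (e i), nameAt s (e a), nameAt s (e j)) ++
        Sym.semi :: l := by
  rw [exists_drop_eq_edgeSyms_iff]
  refine sat_conj (sat_same hp hi) (sat_ex_of (fun q _ => sat_conj_of ((sat_ends (by simp) (by omega)
    (by omega)).trans (by simp (disch := omega))) fun hq => ?_)
    fun a h => by have := Ends_le h.1; omega)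
  have := Ends_le hq
  refine (sat_ex_succ (P := fun x => nameAt s x = nameAt s (e a) ∧ ∃ q', Ends s x q' .comma ∧
    nameAt s (q' + 1) = nameAt s (e j) ∧ ∃ r, Ends s (q' + 1) r .semi) (by omega)
    (by simp; omega) fun x => ?_).trans (by simp)
  refine sat_conj ((sat_same (by omega) (by omega)).trans (by simp (disch := omega)))
    (sat_ex_of (fun q' _ => sat_conj_of ((sat_ends (by simp) (by omega)
    (by omega)).trans (by simp (disch := omega))) fun hq' => ?_)
    fun a h => by have := Ends_le h.1; omega)
  have := Ends_le hq'
  refine (sat_ex_succ (P := fun x => nameAt s x = nameAt s (e j) ∧ ∃ r, Ends s x r .semi) (by omega)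
    (by simp; omega) fun y => ?_).trans (by simp)
  refine sat_conj ((sat_same (by omega) (by omega)).trans (by simp (disch := omega)))
    (sat_ex_of (fun r _ => (sat_ends (by simp) (by omega)
    (by omega)).trans (by simp (disch := omega))) fun a h => by have := Ends_le h; omega)

/-- The name at `i` is in list `k`. -/
def node (f k i : ℕ) : Fml := ex f (conj (entry (f + 1) k f) (nameItem (f + 1) f i))

theorem sat_node (hi : i < f) :
    (node f k i).Sat (bits s) X e ↔ HasItem nameSyms s k (nameAt s (e i)) := by
  refine (sat_ex_of (fun p _ => sat_conj ((sat_entry (by omega)).trans ?_)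
    ((sat_nameItem (by omega) (by omega)).trans ?_)) fun p h => ?_).trans
      (exists_congr fun p => exists_and_left.symm)
  · simp
  · simp (disch := omega)
  · have := h.1.le_length
    rw [length_bits]
    omega

/-- List `k` contains an edge from the name at `i` to the name at `j` with the name at `a` as its
label. -/
def edge (f k i a j : ℕ) : Fml := ex f (conj (entry (f + 1) k f) (edgeItem (f + 1) f i a j))

theorem sat_edge {a : ℕ} (hi : i < f) (ha : a < f) (hj : j < f) : (edge f k i a j).Sat (bits s) X e ↔
    HasItem edgeSyms s k (nameAt s (e i), nameAt s (e a), nameAt s (e j)) := by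
  refine (sat_ex_of (fun p _ => sat_conj ((sat_entry (by omega)).trans ?_)
    ((sat_edgeItem (by omega) (by omega) (by omega) (by omega)).trans ?_)) fun p h => ?_).trans
      (exists_congr fun p => exists_and_left.symm)
  · simp
  · simp (disch := omega)
  · have := h.1.le_length
    rw [length_bits]
    omega

theorem exists_drop_eq_cons_iff {s : List Sym} {p : ℕ} {a : Sym} :
    (∃ l, s.drop p = a :: l) ↔ s[p]? = some a := by
  constructor
  · rintro ⟨l, h⟩
    have : (s.drop p)[0]? = some a := by rw [h]; rfl
    simpa using this
  · intro h
    obtain ⟨h, h'⟩ := List.getElem?_eq_some_iff.1 h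
    exact ⟨s.drop (p + 1), by rw [List.drop_eq_getElem_cons h, h']⟩

/-- List `k` is a list of names. -/
def onlyNames (f k : ℕ) : Fml :=
  all f (disj (entry (f + 1) k f).neg (disj (symAt [f] .bar) (nameItem (f + 1) f f)))

theorem not_entry_of_lt {s : List Sym} {k p : ℕ} (h : (bits s).length < p) : ¬ Entry s k p := by
  intro h'
  have := h'.le_length
  rw [length_bits] at h
  omega

theorem sat_onlyNames : (onlyNames f k).Sat (bits s) X e ↔ OnlyItems nameSyms s k := by
  refine (sat_all_of (P := fun p => ¬ Entry s k p ∨ s[p]? = some .bar ∨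
    ∃ x l, s.drop p = nameSyms x ++ .semi :: l) (fun p _ => sat_disj (sat_neg.trans (not_congr ((sat_entry (by omega)).trans ?_)))
    (sat_disj (sat_symAt_singleton.trans ?_) ((sat_nameItem (by omega) (by omega)).trans ?_)))
    fun p hp => .inl (not_entry_of_lt hp)).trans (forall_congr' fun p => ?_)
  · simp
  · simp
  · simp only [Function.update_self]
    refine ⟨fun h => ⟨_, h⟩, fun ⟨x, h⟩ => ?_⟩
    obtain ⟨rfl, -⟩ := exists_drop_eq_nameSyms_iff.1 h
    exact h
  · rw [← imp_iff_not_or, exists_drop_eq_cons_iff]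

/-- List `k` is a list of edges. -/
def onlyEdges (f k : ℕ) : Fml :=
  all f (disj (entry (f + 1) k f).neg (disj (symAt [f] .bar)
    (ex (f + 1) (ex (f + 2) (edgeItem (f + 3) f f (f + 1) (f + 2))))))

theorem sat_onlyEdges : (onlyEdges f k).Sat (bits s) X e ↔ OnlyItems edgeSyms s k := by
  refine (sat_all_of (P := fun p => ¬ Entry s k p ∨ s[p]? = some .bar ∨
    ∃ x l, s.drop p = edgeSyms x ++ .semi :: l) (fun p _ => sat_disj (sat_neg.trans (not_congr ((sat_entry (by omega)).trans ?_)))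
    (sat_disj (sat_symAt_singleton.trans ?_) ?_))
    fun p hp => .inl (not_entry_of_lt hp)).trans (forall_congr' fun p => ?_)
  · simp
  · simp
  · refine (sat_ex.trans (exists_congr fun a => and_congr_right fun _ => sat_ex.trans (exists_congr
      fun b => and_congr_right fun _ => sat_edgeItem (by omega) (by omega) (by omega) (by omega)))).trans ?_
    simp (disch := omega) only [Function.update_self, Function.update_of_ne]
    constructor
    · rintro ⟨a, -, b, -, h⟩
      exact ⟨_, h⟩
    · rintro ⟨⟨u, a, v⟩, h⟩
      obtain ⟨h1, q, h2, h3, q', h4, h5, -⟩ := exists_drop_eq_edgeSyms_iff.1 h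
      have := Ends_le h2
      have := Ends_le h4
      refine ⟨q + 1, by omega, q' + 1, by omega, ?_⟩
      rw [h1, h3, h5]
      exact h
  · rw [← imp_iff_not_or, exists_drop_eq_cons_iff]

/-- The nodes to be compared are the names at `i` and `j`. -/
def pair (f i j : ℕ) : Fml :=
  ex f (conj (entry (f + 1) 4 f) (conj (ex (f + 1) (conj (isSucc (f + 1) f) (symAt [f + 1] .bar)))
    (conj (same (f + 1) f i) (ex (f + 1) (conj (ends (f + 2) f (f + 1) .semi)
      (ex (f + 2) (conj (isSucc (f + 1) (f + 2)) (conj (same (f + 3) (f + 2) j)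
        (ex (f + 3) (conj (ends (f + 4) (f + 2) (f + 3) .semi)
          (conj (lit false [f + 3, f + 3, f + 3] 3 false)
            (lit false [f + 3, f + 3, f + 3] 3 true))))))))))))

/-- A symbol is absent if and only if the first bit of its block is; the index is `3 * (r + 1)`. -/
theorem getElem?_succ_ne_iff {s : List Sym} {r : ℕ} : (∀ a, s[r + 1]? ≠ some a) ↔
    (bits s)[r + (r + r) + 3]? ≠ some false ∧ (bits s)[r + (r + r) + 3]? ≠ some true := by
  have h := getElem?_flatMap_toBits s (r + 1) (c := 0) (by omega)
  rw [show 3 * (r + 1) + 0 = r + (r + r) + 3 by ring] at h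
  rw [bits, h]
  rcases s[r + 1]? with _ | a
  · simp
  · cases a <;> simp [Sym.toBits]

theorem sat_pair (hi : i < f) (hj : j < f) :
    (pair f i j).Sat (bits s) X e ↔ HasEnd s 4 (nameAt s (e i)) (nameAt s (e j)) := by
  unfold HasEnd
  simp only [drop_eq_end_iff]
  refine sat_ex_of (fun p _ => sat_conj_of ((sat_entry (by omega)).trans (by simp)) fun hp =>
    sat_conj ?_ (sat_conj ((sat_same (by omega) (by omega)).trans (by simp (disch := omega)))
      (sat_ex_of (fun q _ => sat_conj_of ((sat_ends (by simp) (by omega)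
        (by omega)).trans (by simp (disch := omega))) fun hq => ?_)
        fun a h => by have := Ends_le h.1; omega))) fun p h => ?_
  · refine (sat_ex_of (P := fun r => r + 1 = p ∧ s[r]? = some .bar) (fun r _ =>
      sat_conj (sat_isSucc.trans (by simp)) (sat_symAt_singleton.trans (by simp)))
      fun r h => by omega).trans ?_
    -- The condition in `HasEnd` is universal and void at `0`, the one in the formula is
    -- existential. They agree because four bars precede `p`.
    have : p ≠ 0 := by
      rintro rfl
      have := hp.1
      simp [numBars] at this
    constructor
    · rintro ⟨r, h1, h2⟩ r' h3
      obtain rfl : r = r' := by omega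
      exact h2
    · intro h
      exact ⟨p - 1, by omega, h _ (by omega)⟩
  · have := Ends_le hq
    refine (sat_ex_succ (P := fun x => nameAt s x = nameAt s (e j) ∧ ∃ r, Ends s x r .semi ∧
      ∀ a, s[r + 1]? ≠ some a) (by omega) (by simp; omega) fun x => ?_).trans (by simp)
    refine sat_conj ((sat_same (by omega) (by omega)).trans (by simp (disch := omega)))
      (sat_ex_of (fun r _ => sat_conj ((sat_ends (by simp) (by omega)
      (by omega)).trans (by simp (disch := omega))) ?_) fun a h => by have := Ends_le h.1; omega)
    rw [getElem?_succ_ne_iff]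
    refine sat_conj ?_ ?_ <;> simp [Sat]
  · have := h.1.le_length
    rw [length_bits]
    omega

/-- The input consists of codes of symbols. -/
def blocks : Fml := all 0 (disj (conj (lit false [0, 0, 0] 0 false) (lit false [0, 0, 0] 0 true))
  (disj (symAt [0] (.bit false)) (disj (symAt [0] (.bit true)) (disj (symAt [0] .comma)
    (disj (symAt [0] .semi) (symAt [0] .bar))))))

theorem sat_blocks {w : List Bool} : blocks.Sat w X e ↔ ∃ s, w = bits s := by
  refine (sat_all.trans (forall₂_congr fun v _ => ?_)).trans exists_flatMap_toBits_iff.symm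
  have h3 : v + (v + v) = 3 * v := by ring
  refine (sat_disj (sat_conj Iff.rfl Iff.rfl) (sat_disj sat_symAt_bits (sat_disj sat_symAt_bits
    (sat_disj sat_symAt_bits (sat_disj sat_symAt_bits sat_symAt_bits))))).trans (or_congr ?_ ?_)
  · simp [Sat, h3]
  · simp only [List.map_cons, List.map_nil, List.sum_cons, List.sum_nil, add_zero,
      Function.update_self]
    constructor
    · rintro (h | h | h | h | h)
      exacts [⟨_, h⟩, ⟨_, h⟩, ⟨_, h⟩, ⟨_, h⟩, ⟨_, h⟩]
    · rintro ⟨(_ | _) | _ | _ | _, h⟩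
      exacts [.inl h, .inr (.inl h), .inr (.inr (.inl h)), .inr (.inr (.inr (.inl h))),
        .inr (.inr (.inr (.inr h)))]

end Fml

end BisimAC

namespace BisimAC

/-! ### The rules of inference as formulas -/

/-- The names that occur in a word. -/
def Occ (s : List Sym) : Type := {u : Name // ∃ i, nameAt s i = u}

/-- The name at a position. -/
def occ (s : List Sym) (i : ℕ) : Occ s := ⟨nameAt s i, i, rfl⟩

theorem occ_eq_iff {s : List Sym} {i j : ℕ} : occ s i = occ s j ↔ nameAt s i = nameAt s j :=
  Subtype.ext_iff

theorem exists_occ_eq {s : List Sym} (x : Occ s) : ∃ i ≤ s.length, occ s i = x := by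
  obtain ⟨_, i, rfl⟩ := x
  rcases le_total i s.length with h | h
  · exact ⟨i, h, rfl⟩
  -- All positions from the end on carry the empty name.
  · refine ⟨s.length, le_rfl, occ_eq_iff.2 ?_⟩
    rw [nameAt, nameAt, List.drop_length, List.drop_eq_nil_of_le h]

theorem occ_surjective (s : List Sym) :
    Function.Surjective fun i : Fin (s.length + 1) => occ s i := fun x => by
  obtain ⟨i, hi, h⟩ := exists_occ_eq x
  exact ⟨⟨i, by omega⟩, h⟩

instance (s : List Sym) : Finite (Occ s) := Finite.of_surjective _ (occ_surjective s)

instance (s : List Sym) : Nonempty (Occ s) := ⟨occ s 0⟩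

theorem card_occ_le (s : List Sym) : Nat.card (Occ s) ≤ s.length + 1 := by
  simpa using Nat.card_le_card_of_surjective _ (occ_surjective s)

/-- The nodes of two graphs and an additional node. -/
abbrev Spot (s : List Sym) : Type := Occ s ⊕ Occ s ⊕ Unit

/-- The node that is given by the number of its graph and its name. -/
def spot (s : List Sym) : ℕ → Occ s → Spot s
  | 0, x => .inl x
  | 1, x => .inr (.inl x)
  | _ + 2, _ => .inr (.inr ())

theorem exists_spot_eq {s : List Sym} (h : Spot s) :
    ∃ a ≤ 2, ∃ i ≤ s.length, spot s a (occ s i) = h := by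
  rcases h with x | x | _
  · obtain ⟨i, hi, rfl⟩ := exists_occ_eq x
    exact ⟨0, by omega, i, hi, rfl⟩
  · obtain ⟨i, hi, rfl⟩ := exists_occ_eq x
    exact ⟨1, by omega, i, hi, rfl⟩
  · exact ⟨2, le_rfl, 0, by omega, rfl⟩

/-- The edges of the two graphs and of an additional node with all loops. -/
def spotEdge (s : List Sym) : Spot s → Occ s → Spot s → Prop
  | .inl u, a, .inl v => HasItem edgeSyms s 1 (u.1, a.1, v.1)
  | .inr (.inl u), a, .inr (.inl v) => HasItem edgeSyms s 3 (u.1, a.1, v.1)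
  | .inr (.inr _), _, .inr (.inr _) => True
  | _, _, _ => False

/-- The two graphs in a word. -/
def arena (s : List Sym) : Arena (Occ s) (Spot s) (Occ s) where
  E u a v := HasItem edgeSyms s 1 (u.1, a.1, v.1)
  G := ⟨spotEdge s⟩
  emb := .inl
  bot := .inr (.inr ())
  emb_edge v a y := by rcases y with y | y | _ <;> simp [spotEdge]
  bot_edge a y := by rcases y with y | y | _ <;> simp [spotEdge]

/-- The meaning of the relations `1` to `5`. -/
def meaning (s : List Sym) (c : Prop) (F : Facts (Occ s) (Spot s)) : ℕ → (ℕ → ℕ) → Prop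
  | 1, e => F.D (occ s (e 0)) (occ s (e 1))
  | 2, e => F.N (occ s (e 0)) (spot s (e 1) (occ s (e 2)))
  | 3, e => F.B (occ s (e 0)) (spot s (e 1) (occ s (e 2)))
  | 4, e => F.P (occ s (e 0)) (spot s (e 1) (occ s (e 2))) (occ s (e 3)) (spot s (e 4) (occ s (e 5)))
  | 5, e => F.Pn (occ s (e 0)) (spot s (e 1) (occ s (e 2))) (occ s (e 3)) (spot s (e 4) (occ s (e 5)))
  | _, _ => c

theorem argEnv_zero (a : ℕ) (l : List ℕ) (e : ℕ → ℕ) : argEnv (a :: l) e 0 = e a := rfl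

theorem argEnv_succ (a : ℕ) (l : List ℕ) (e : ℕ → ℕ) (n : ℕ) :
    argEnv (a :: l) e (n + 1) = argEnv l e n := by simp [argEnv]

namespace Fml

variable {s : List Sym} {X : ℕ → (ℕ → ℕ) → Prop} {e : ℕ → ℕ} {f i j : ℕ} {φ : Fml}

/-- Quantifying over positions amounts to quantifying over the names found there, as the truth of
`φ` depends on the name only. -/
theorem sat_ex_occ {P : Occ s → Prop}
    (h : ∀ a, φ.Sat (bits s) X (Function.update e i a) ↔ P (occ s a)) :
    (ex i φ).Sat (bits s) X e ↔ ∃ x, P x := by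
  constructor
  · rintro ⟨a, -, h'⟩
    exact ⟨_, (h a).1 h'⟩
  · rintro ⟨x, hx⟩
    obtain ⟨a, ha, rfl⟩ := exists_occ_eq x
    exact ⟨a, by rw [length_bits]; omega, (h a).2 hx⟩

theorem sat_all_occ {P : Occ s → Prop}
    (h : ∀ a, φ.Sat (bits s) X (Function.update e i a) ↔ P (occ s a)) :
    (all i φ).Sat (bits s) X e ↔ ∀ x, P x := by
  constructor
  · intro h' x
    obtain ⟨a, ha, rfl⟩ := exists_occ_eq x
    exact (h a).1 (h' a (by rw [length_bits]; omega))
  · exact fun h' a _ => (h a).2 (h' _)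

/-- A spot is coded by a graph number and a position. The numbers up to `2` must be in the range of
the quantifiers, which a nonempty word ensures with its three bits per symbol. -/
theorem sat_ex_spot (hs : 0 < s.length) {P : Spot s → Prop}
    (h : ∀ a b, φ.Sat (bits s) X (Function.update (Function.update e i a) j b) ↔
      P (spot s a (occ s b))) :
    (ex i (ex j φ)).Sat (bits s) X e ↔ ∃ x, P x := by
  constructor
  · rintro ⟨a, -, b, -, h'⟩
    exact ⟨_, (h a b).1 h'⟩
  · rintro ⟨x, hx⟩
    obtain ⟨a, ha, b, hb, rfl⟩ := exists_spot_eq x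
    exact ⟨a, by rw [length_bits]; omega, b, by rw [length_bits]; omega, (h a b).2 hx⟩

theorem sat_all_spot (hs : 0 < s.length) {P : Spot s → Prop}
    (h : ∀ a b, φ.Sat (bits s) X (Function.update (Function.update e i a) j b) ↔
      P (spot s a (occ s b))) :
    (all i (all j φ)).Sat (bits s) X e ↔ ∀ x, P x := by
  constructor
  · intro h' x
    obtain ⟨a, ha, b, hb, rfl⟩ := exists_spot_eq x
    exact (h a b).1 (h' a (by rw [length_bits]; omega) b (by rw [length_bits]; omega))
  · exact fun h' a _ b _ => (h a b).2 (h' _)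

/-- The hypothesis on `φ` is required for all `X` because `neg` changes the meaning of calls; in the
applications `φ` only reads the input. -/
theorem sat_imp {w : List Bool} {ψ : Fml} {p q : Prop} (h : ∀ X, φ.Sat w X e ↔ p)
    (h' : ψ.Sat w X e ↔ q) : (disj φ.neg ψ).Sat w X e ↔ (p → q) :=
  (sat_disj (sat_neg.trans (not_congr (h _))) h').trans imp_iff_not_or.symm

theorem sat_not {w : List Bool} {p : Prop} (h : ∀ X, φ.Sat w X e ↔ p) :
    φ.neg.Sat w X e ↔ ¬ p := sat_neg.trans (not_congr (h _))

theorem sat_same_occ (hi : i < f) (hj : j < f) :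
    (same f i j).Sat (bits s) X e ↔ occ s (e i) = occ s (e j) :=
  (sat_same hi hj).trans occ_eq_iff.symm

theorem sat_treeEdge {a : ℕ} (hi : i < f) (ha : a < f) (hj : j < f) :
    (edge f 1 i a j).Sat (bits s) X e ↔ (arena s).E (occ s (e i)) (occ s (e a)) (occ s (e j)) :=
  sat_edge hi ha hj

/-- There is an edge labelled `l` from the node with number `a` and name `i` to the one with number
`b` and name `j`. -/
def arrow (f a i l b j : ℕ) : Fml :=
  disj (conj (isZero a) (conj (isZero b) (edge f 1 i l j)))
    (disj (conj (isOne a) (conj (isOne b) (edge f 3 i l j)))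
      (conj (lin true [] 2 a) (lin true [] 2 b)))

theorem sat_arrow {a l b : ℕ} (hi : i < f) (hl : l < f) (hj : j < f) :
    (arrow f a i l b j).Sat (bits s) X e ↔
      (arena s).G.E (spot s (e a) (occ s (e i))) (occ s (e l)) (spot s (e b) (occ s (e j))) := by
  refine (sat_disj (sat_conj sat_isZero (sat_conj sat_isZero (sat_edge hi hl hj)))
    (sat_disj (sat_conj sat_isOne (sat_conj sat_isOne (sat_edge hi hl hj)))
      (sat_conj sat_lin sat_lin))).trans ?_
  generalize e a = x
  generalize e b = y
  rcases x with _ | _ | x <;> rcases y with _ | _ | y <;> simp [spot, arena, spotEdge, occ]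

/-- `Arena.Differ` as a formula, for `t` and the node with number `a` and name `i`. -/
def differ (f t a i : ℕ) : Fml :=
  disj (ex f (ex (f + 1) (conj (edge (f + 2) 1 t f (f + 1)) (all (f + 2) (all (f + 3)
      (disj (arrow (f + 4) a i f (f + 2) (f + 3)).neg (call 2 [f + 1, f + 2, f + 3])))))))
    (ex f (ex (f + 1) (ex (f + 2) (conj (arrow (f + 3) a i f (f + 1) (f + 2)) (all (f + 3)
      (disj (edge (f + 4) 1 t f (f + 3)).neg (call 2 [f + 3, f + 1, f + 2])))))))

variable {N B : Occ s → Spot s → Prop} (hs : 0 < s.length)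
  (hN : ∀ e, X 2 e ↔ N (occ s (e 0)) (spot s (e 1) (occ s (e 2))))
  (hB : ∀ e, X 3 e ↔ B (occ s (e 0)) (spot s (e 1) (occ s (e 2))))

include hs hN

theorem sat_differ {t a : ℕ} (ht : t < f) (ha : a < f) (hi : i < f) :
    (differ f t a i).Sat (bits s) X e ↔
      (arena s).Differ N (occ s (e t)) (spot s (e a) (occ s (e i))) := by
  refine sat_disj
    (sat_ex_occ fun l => sat_ex_occ fun c => sat_conj
      ((sat_treeEdge (by omega) (by omega) (by omega)).trans ?_)
      (sat_all_spot hs fun b j => sat_imp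
        (fun X => (sat_arrow (by omega) (by omega) (by omega)).trans ?_) ((hN _).trans ?_)))
    (sat_ex_occ fun l => sat_ex_spot hs fun b j => sat_conj
      ((sat_arrow (by omega) (by omega) (by omega)).trans ?_)
      (sat_all_occ fun c => sat_imp
        (fun X => (sat_treeEdge (by omega) (by omega) (by omega)).trans ?_) ((hN _).trans ?_)))
  all_goals simp (disch := omega) [argEnv_zero, argEnv_succ]

/-- `Arena.Step` as a formula. -/
def step (f t c a i b j : ℕ) : Fml :=
  disj
    (ex f (conj (edge (f + 1) 1 t f c) (conj (arrow (f + 1) a i f b j) (all (f + 1)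
      (disj (edge (f + 2) 1 t f (f + 1)).neg (disj (same (f + 2) (f + 1) c)
        (call 2 [f + 1, b, j])))))))
    (conj (lin true [] 2 b) (disj
      (ex f (ex (f + 1) (ex (f + 2) (conj (arrow (f + 3) a i f (f + 1) (f + 2))
        (conj (edge (f + 3) 1 t f c).neg (all (f + 3)
          (disj (edge (f + 4) 1 t f (f + 3)).neg (call 2 [f + 3, f + 1, f + 2]))))))))
      (disj
        (ex f (ex (f + 1) (conj (same (f + 2) (f + 1) c).neg (conj (edge (f + 2) 1 t f (f + 1))
          (all (f + 2) (all (f + 3) (disj (arrow (f + 4) a i f (f + 2) (f + 3)).neg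
            (call 2 [f + 1, f + 2, f + 3]))))))))
        (ex f (conj (edge (f + 1) 1 t f c) (all (f + 1) (all (f + 2)
          (disj (arrow (f + 3) a i f (f + 1) (f + 2)).neg (ex (f + 3)
            (conj (same (f + 4) (f + 3) c).neg (conj (edge (f + 4) 1 t f (f + 3))
              (conj (call 3 [f + 3, f + 1, f + 2])
                (ex (f + 4) (conj (isZero (f + 4)) (call 2 [f + 3, f + 4, c])))))))))))))))

omit hs hN in
theorem spot_eq_bot_iff {a : ℕ} {x : Occ s} : spot s a x = (arena s).bot ↔ 2 ≤ a := by
  rcases a with _ | _ | a <;> simp [spot, arena]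

include hB

theorem sat_step {t c a b : ℕ} (ht : t < f) (hc : c < f) (ha : a < f) (hi : i < f) (hb : b < f)
    (hj : j < f) : (step f t c a i b j).Sat (bits s) X e ↔
      (arena s).Step N B (occ s (e t)) (occ s (e c)) (spot s (e a) (occ s (e i)))
        (spot s (e b) (occ s (e j))) := by
  refine sat_disj
    (sat_ex_occ fun l => sat_conj ((sat_treeEdge (by omega) (by omega) (by omega)).trans ?_)
      (sat_conj ((sat_arrow (by omega) (by omega) (by omega)).trans ?_) (sat_all_occ fun d => sat_imp
        (fun X => (sat_treeEdge (by omega) (by omega) (by omega)).trans ?_)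
        (sat_disj ((sat_same_occ (by omega) (by omega)).trans ?_) ((hN _).trans ?_)))))
    (sat_conj (sat_lin.trans ?_) (sat_disj
      (sat_ex_occ fun l => sat_ex_spot hs fun x y => sat_conj
        ((sat_arrow (by omega) (by omega) (by omega)).trans ?_)
        (sat_conj (sat_not fun X => (sat_treeEdge (by omega) (by omega) (by omega)).trans ?_)
          (sat_all_occ fun d => sat_imp
            (fun X => (sat_treeEdge (by omega) (by omega) (by omega)).trans ?_) ((hN _).trans ?_))))
      (sat_disj
        (sat_ex_occ fun l => sat_ex_occ fun d => sat_conj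
          (sat_not fun X => (sat_same_occ (by omega) (by omega)).trans ?_)
          (sat_conj ((sat_treeEdge (by omega) (by omega) (by omega)).trans ?_)
            (sat_all_spot hs fun x y => sat_imp
              (fun X => (sat_arrow (by omega) (by omega) (by omega)).trans ?_) ((hN _).trans ?_))))
        (sat_ex_occ fun l => sat_conj ((sat_treeEdge (by omega) (by omega) (by omega)).trans ?_)
          (sat_all_spot hs fun x y => sat_imp
            (fun X => (sat_arrow (by omega) (by omega) (by omega)).trans ?_)
            (sat_ex_occ fun d => sat_conj
              (sat_not fun X => (sat_same_occ (by omega) (by omega)).trans ?_)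
              (sat_conj ((sat_treeEdge (by omega) (by omega) (by omega)).trans ?_)
                (sat_conj ((hB _).trans ?_) ?emb))))))))
  -- The node `T.emb c` has graph number `0`. Calls take variables only, so a variable with value
  -- `0` is quantified.
  case emb =>
    refine Iff.trans (sat_ex_of (P := fun z => z = 0 ∧ N (occ s d) (spot s z (occ s (e c))))
      (fun z _ => sat_conj (sat_isZero.trans ?_) ((hN _).trans ?_))
      fun z h => by omega) (by simp [arena, spot])
    · simp
    · simp (disch := omega) [argEnv_zero, argEnv_succ]
  all_goals simp (disch := omega) [argEnv_zero, argEnv_succ, spot_eq_bot_iff]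

omit hs hN hB

/-- `c` is a child of `t`. -/
def child (f t c : ℕ) : Fml := ex f (edge (f + 1) 1 t f c)

theorem sat_child {t c : ℕ} (ht : t < f) (hc : c < f) :
    (child f t c).Sat (bits s) X e ↔ (arena s).Child (occ s (e t)) (occ s (e c)) := by
  refine sat_ex_occ fun l => (sat_treeEdge (by omega) (by omega) (by omega)).trans ?_
  simp (disch := omega)

/-- The rule for the descendants. -/
def belowRule : Fml := disj (child 2 0 1) (ex 2 (conj (call 1 [0, 2]) (call 1 [2, 1])))

/-- The rule for being not bisimilar. -/
def apartRule : Fml := disj (differ 3 0 1 2) (ex 3 (conj (call 1 [0, 3])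
  (ex 4 (ex 5 (conj (call 4 [0, 1, 2, 3, 4, 5]) (call 2 [3, 4, 5]))))))

/-- The rule for being bisimilar. -/
def alikeRule : Fml := disj (differ 3 0 1 2).neg (ex 3 (conj (call 1 [0, 3])
  (all 4 (all 5 (disj (call 5 [0, 1, 2, 3, 4, 5]) (call 3 [3, 4, 5]))))))

/-- The rule for possible reductions. -/
def pathRule : Fml := disj (conj (child 6 0 3) (step 6 0 3 1 2 4 5)) (ex 6 (conj (call 1 [0, 6])
  (conj (call 1 [6, 3]) (ex 7 (ex 8 (conj (call 4 [0, 1, 2, 6, 7, 8])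
    (call 4 [6, 7, 8, 3, 4, 5])))))))

/-- The rule for impossible reductions. -/
def noPathRule : Fml := disj (conj (child 6 0 3) (step 6 0 3 1 2 4 5).neg) (ex 6
  (conj (call 1 [0, 6]) (conj (call 1 [6, 3]) (all 7 (all 8 (disj (call 5 [0, 1, 2, 6, 7, 8])
    (call 5 [6, 7, 8, 3, 4, 5])))))))

/-- The rules of inference. -/
def rules : List Fml := [belowRule, apartRule, alikeRule, pathRule, noPathRule]

/-- The rules express `Arena.infer`. -/
theorem sat_rules (hs : 0 < s.length) {c : Prop} (F : Facts (Occ s) (Spot s)) (r : ℕ)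
    (hr : r < 5) : (rules.getD r (.lin true [] 0 0)).Sat (bits s) (meaning s c F) e ↔
      meaning s c ((arena s).infer F) (r + 1) e := by
  interval_cases r
  · refine sat_disj (sat_child (by omega) (by omega)) (sat_ex_occ fun d => sat_conj
      (show meaning s c F 1 _ ↔ _ from ?_) (show meaning s c F 1 _ ↔ _ from ?_)) <;>
      simp [meaning, argEnv_zero, argEnv_succ]
  · refine sat_disj (sat_differ hs (fun e => Iff.rfl) (by omega) (by omega) (by omega))
      (sat_ex_occ fun d => sat_conj (show meaning s c F 1 _ ↔ _ from ?_) (sat_ex_spot hs fun a b =>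
        sat_conj (show meaning s c F 4 _ ↔ _ from ?_) (show meaning s c F 2 _ ↔ _ from ?_))) <;>
      simp [meaning, argEnv_zero, argEnv_succ]
  -- Under `neg`, calls of `2` become calls of `3`, so `differ` is evaluated with the negation of
  -- `B` in place of `N`, as in `Arena.infer`.
  · refine sat_disj (sat_neg.trans (not_congr
        (sat_differ hs (fun e => Iff.rfl) (by omega) (by omega) (by omega))))
      (sat_ex_occ fun d => sat_conj (show meaning s c F 1 _ ↔ _ from ?_)
        (Iff.trans (sat_all_spot hs (P := fun h => F.Pn (occ s (e 0)) (spot s (e 1) (occ s (e 2)))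
          (occ s d) h ∨ F.B (occ s d) h) fun a b =>
        sat_disj (show meaning s c F 5 _ ↔ _ from ?_) (show meaning s c F 3 _ ↔ _ from ?_)) ?_))
    · simp [meaning, argEnv_zero, argEnv_succ]
    · simp [meaning, argEnv_zero, argEnv_succ]
    · simp [meaning, argEnv_zero, argEnv_succ]
    · push Not
      simp only [or_iff_not_imp_left]
  · refine sat_disj (sat_conj (sat_child (by omega) (by omega))
        (sat_step hs (fun e => Iff.rfl) (fun e => Iff.rfl) (by omega) (by omega) (by omega) (by omega)
          (by omega) (by omega)))
      (sat_ex_occ fun d => sat_conj (show meaning s c F 1 _ ↔ _ from ?_)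
        (sat_conj (show meaning s c F 1 _ ↔ _ from ?_) (sat_ex_spot hs fun a b =>
        sat_conj (show meaning s c F 4 _ ↔ _ from ?_) (show meaning s c F 4 _ ↔ _ from ?_)))) <;>
      simp [meaning, argEnv_zero, argEnv_succ]
  · refine sat_disj (sat_conj (sat_child (by omega) (by omega)) (sat_neg.trans (not_congr
        (sat_step hs (fun e => Iff.rfl) (fun e => Iff.rfl) (by omega) (by omega) (by omega) (by omega)
          (by omega) (by omega)))))
      (sat_ex_occ fun d => sat_conj (show meaning s c F 1 _ ↔ _ from ?_)
        (sat_conj (show meaning s c F 1 _ ↔ _ from ?_) (Iff.trans (sat_all_spot hs (P := fun h =>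
          F.Pn (occ s (e 0)) (spot s (e 1) (occ s (e 2))) (occ s d) h ∨
            F.Pn (occ s d) h (occ s (e 3)) (spot s (e 4) (occ s (e 5)))) fun a b =>
        sat_disj (show meaning s c F 5 _ ↔ _ from ?_) (show meaning s c F 5 _ ↔ _ from ?_)) ?_)))
    · simp [meaning, argEnv_zero, argEnv_succ]
    · simp [meaning, argEnv_zero, argEnv_succ]
    · simp [meaning, argEnv_zero, argEnv_succ]
    · simp [meaning, argEnv_zero, argEnv_succ]
    · push Not
      simp only [or_iff_not_imp_left]

end Fml

end BisimAC

namespace BisimAC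

open Relation

/-! ### Trees and bisimilarity in disjoint unions -/

namespace LGraph

variable {V A : Type} {G : LGraph V A}

theorem isPath_singleton (r : V) : G.IsPath r r [r] := by simp [IsPath]

theorem IsPath.snoc {r u v : V} {p : List V} (h : G.IsPath r u p) (hv : G.Succ u v) :
    G.IsPath r v (p ++ [v]) := by
  obtain ⟨h1, h2, h3⟩ := h
  refine ⟨?_, by simp, ?_⟩
  · rw [List.head?_append, h1]
    rfl
  · rw [List.isChain_append]
    refine ⟨h3, by simp, ?_⟩
    intro x hx y hy
    rw [h2] at hx
    simp only [Option.mem_def, Option.some.injEq, List.head?_cons] at hx hy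
    subst hx hy
    exact hv

/-- A path is trivial, or it is a path and a last edge. -/
theorem IsPath.cases_snoc {r v : V} {p : List V} (h : G.IsPath r v p) :
    p = [r] ∧ r = v ∨ ∃ q u, p = q ++ [v] ∧ G.IsPath r u q ∧ G.Succ u v := by
  obtain ⟨h1, h2, h3⟩ := h
  obtain ⟨q, rfl⟩ : ∃ q, p = q ++ [v] := by
    rw [List.getLast?_eq_some_iff] at h2
    exact h2
  rcases q.eq_nil_or_concat with rfl | ⟨q', u, rfl⟩
  · simp only [List.nil_append, List.head?_cons, Option.some.injEq] at h1
    subst h1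
    exact .inl ⟨rfl, rfl⟩
  · refine .inr ⟨_, u, rfl, ⟨?_, by simp, ?_⟩, ?_⟩
    · rw [List.head?_append_of_ne_nil _ (by simp)] at h1
      exact h1
    · exact (List.isChain_append.1 h3).1
    · exact (List.isChain_append.1 h3).2.2 u (by simp) v (by simp)

theorem IsPath.reflTransGen {r v : V} {p : List V} (h : G.IsPath r v p) :
    ReflTransGen G.Succ r v := by
  induction p using List.reverseRecOn generalizing v with
  | nil => simp [IsPath] at h
  | append_singleton p x ih =>
    rcases h.cases_snoc with ⟨_, rfl⟩ | ⟨q, u, hq, h1, h2⟩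
    · exact .refl
    · obtain ⟨rfl, -⟩ := List.append_inj' hq rfl
      exact (ih h1).tail h2

/-- Trees in terms of parents and descendants. -/
theorem isTree_iff : G.IsTree ↔ (∀ u v a b, G.E u a v → G.E u b v → a = b) ∧
    (∀ u u' v, G.Succ u v → G.Succ u' v → u = u') ∧
    ∃ r, (∀ u, ¬ G.Succ u r) ∧ ∀ v, r = v ∨ TransGen G.Succ r v := by
  refine and_congr_right fun _ => ?_
  constructor
  · rintro ⟨r, h⟩
    refine ⟨fun u u' v hu hu' => ?_, r, fun u hu => ?_, fun v => ?_⟩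
    -- Two parents of `v` give two paths to `v`; these are equal, hence so are their last nodes but
    -- one.
    · obtain ⟨p, hp, -⟩ := h u
      obtain ⟨p', hp', -⟩ := h u'
      have h1 := (h v).unique (hp.snoc hu) (hp'.snoc hu')
      obtain ⟨rfl, -⟩ := List.append_inj' h1 rfl
      exact Option.some.inj (hp.2.1.symm.trans hp'.2.1)
    -- An edge into the root would give a second path from the root to itself.
    · obtain ⟨p, hp, -⟩ := h u
      have h1 := (h r).unique (hp.snoc hu) (isPath_singleton r)
      have h2 : p = [] := by simpa using h1
      subst h2
      simp [IsPath] at hp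
    · obtain ⟨p, hp, -⟩ := h v
      exact (reflTransGen_iff_eq_or_transGen.1 hp.reflTransGen).imp_left Eq.symm
  · rintro ⟨h1, r, h2, h3⟩
    refine ⟨r, fun v => ?_⟩
    have hex : ∃ p, G.IsPath r v p := by
      have h4 : ReflTransGen G.Succ r v := reflTransGen_iff_eq_or_transGen.2 ((h3 v).imp_left Eq.symm)
      induction h4 with
      | refl => exact ⟨_, isPath_singleton r⟩
      | tail _ h ih =>
        obtain ⟨p, hp⟩ := ih
        exact ⟨_, hp.snoc h⟩
    obtain ⟨p, hp⟩ := hex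
    refine ⟨p, hp, fun p' hp' => ?_⟩
    -- The two paths are compared from their ends, where the last edge is determined by the
    -- uniqueness of parents.
    induction p using List.reverseRecOn generalizing v p' with
    | nil => simp [IsPath] at hp
    | append_singleton p x ih =>
      rcases hp.cases_snoc with ⟨h4, rfl⟩ | ⟨q, u, hq, h5, h6⟩
      · rcases hp'.cases_snoc with ⟨h5, -⟩ | ⟨_, _, _, _, h5⟩
        · rw [h4, h5]
        · exact absurd h5 (h2 _)
      · obtain ⟨rfl, h7⟩ := List.append_inj' hq rfl
        rcases hp'.cases_snoc with ⟨_, rfl⟩ | ⟨q', u', rfl, h8, h9⟩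
        · exact absurd h6 (h2 _)
        · obtain rfl := h1 _ _ _ h6 h9
          rw [ih _ h5 _ h8, h7]

/-- Bisimilarity is the same in a graph and in a copy of it that is closed under successors. -/
theorem bisimilar_map_iff {W B : Type} {H : LGraph W B} (f : V → W) (l : B → A)
    (hf : ∀ x b y, H.E (f x) b y ↔ ∃ y', y = f y' ∧ G.E x (l b) y')
    (hl : ∀ x a y, G.E x a y → ∃ b, l b = a) {x y : V} :
    G.Bisimilar x y ↔ H.Bisimilar (f x) (f y) := by
  constructor
  · rintro ⟨R, hR, hxy⟩
    refine ⟨fun p q => ∃ x y, p = f x ∧ q = f y ∧ R x y, ?_, x, y, rfl, rfl, hxy⟩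
    rintro _ _ ⟨x, y, rfl, rfl, h⟩
    refine ⟨fun b p hp => ?_, fun b p hp => ?_⟩
    · obtain ⟨x', rfl, hx⟩ := (hf _ _ _).1 hp
      obtain ⟨y', hy, h'⟩ := (hR _ _ h).1 _ _ hx
      exact ⟨_, (hf _ _ _).2 ⟨y', rfl, hy⟩, x', y', rfl, rfl, h'⟩
    · obtain ⟨y', rfl, hy⟩ := (hf _ _ _).1 hp
      obtain ⟨x', hx, h'⟩ := (hR _ _ h).2 _ _ hy
      exact ⟨_, (hf _ _ _).2 ⟨x', rfl, hx⟩, x', y', rfl, rfl, h'⟩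
  · rintro ⟨R, hR, hxy⟩
    refine ⟨fun x y => R (f x) (f y), ?_, hxy⟩
    intro x y h
    refine ⟨fun a x' hx => ?_, fun a y' hy => ?_⟩
    · obtain ⟨b, rfl⟩ := hl _ _ _ hx
      obtain ⟨q, hq, h'⟩ := (hR _ _ h).1 b _ ((hf _ _ _).2 ⟨x', rfl, hx⟩)
      obtain ⟨y', rfl, hy⟩ := (hf _ _ _).1 hq
      exact ⟨y', hy, h'⟩
    · obtain ⟨b, rfl⟩ := hl _ _ _ hy
      obtain ⟨q, hq, h'⟩ := (hR _ _ h).2 b _ ((hf _ _ _).2 ⟨y', rfl, hy⟩)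
      obtain ⟨x', rfl, hx⟩ := (hf _ _ _).1 hq
      exact ⟨x', hx, h'⟩

end LGraph

/-! ### Stages of inference -/

namespace Arena

variable {V M A : Type} {T : Arena V M A}

theorem Differ.mono {N N' : V → M → Prop} (h : ∀ {t h}, N t h → N' t h) {t : V} {x : M}
    (hd : T.Differ N t x) : T.Differ N' t x := by
  rcases hd with ⟨a, c, hc, h1⟩ | ⟨a, x', hx, h1⟩
  · exact .inl ⟨a, c, hc, fun y hy => h (h1 y hy)⟩
  · exact .inr ⟨a, x', hx, fun y hy => h (h1 y hy)⟩

theorem Step.mono {N N' B B' : V → M → Prop} (h : ∀ {t h}, N t h → N' t h)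
    (h' : ∀ {t h}, B t h → B' t h) {t c : V} {x y : M} (hs : T.Step N B t c x y) :
    T.Step N' B' t c x y := by
  rcases hs with ⟨a, h1, h2, h3⟩ | ⟨hy, ⟨a, x', h1, h2, h3⟩ | ⟨a, s, h1, h2, h3⟩ | ⟨a, h1, h2⟩⟩
  · exact .inl ⟨a, h1, h2, fun s hs => (h3 s hs).imp_right h⟩
  · exact .inr ⟨hy, .inl ⟨a, x', h1, h2, fun s hs => h (h3 s hs)⟩⟩
  · exact .inr ⟨hy, .inr (.inl ⟨a, s, h1, h2, fun s hs => h (h3 s hs)⟩)⟩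
  · refine .inr ⟨hy, .inr (.inr ⟨a, h1, fun z hz => ?_⟩)⟩
    obtain ⟨s, h3, h4, h5, h6⟩ := h2 z hz
    exact ⟨s, h3, h4, h' h5, h h6⟩

/-- All facts occur positively in the rules; negations of facts come in nested pairs. -/
theorem infer_mono {F F' : Facts V M} (h : F.Le F') : (T.infer F).Le (T.infer F') where
  D := Or.imp_right fun ⟨w, h1, h2⟩ => ⟨w, h.D h1, h.D h2⟩
  N := Or.imp (Differ.mono h.N) fun ⟨u, h1, h', h2, h3⟩ => ⟨u, h.D h1, h', h.P h2, h.N h3⟩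
  B := Or.imp (mt (Differ.mono (mt h.B))) fun ⟨u, h1, h2⟩ =>
    ⟨u, h.D h1, fun ⟨h', h3, h4⟩ => h2 ⟨h', mt h.Pn h3, mt h.B h4⟩⟩
  P := Or.imp (And.imp_right (Step.mono h.N h.B)) fun ⟨w, h1, h2, h', h3, h4⟩ =>
    ⟨w, h.D h1, h.D h2, h', h.P h3, h.P h4⟩
  Pn := Or.imp (And.imp_right (mt (Step.mono (mt h.B) (mt h.N)))) fun ⟨w, h1, h2, h3⟩ =>
    ⟨w, h.D h1, h.D h2, fun ⟨h', h4, h5⟩ => h3 ⟨h', mt h.Pn h4, mt h.Pn h5⟩⟩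

variable (T)

/-- The facts that are inferred in `k` rounds. -/
def stage : ℕ → Facts V M
  | 0 => ⟨fun _ _ => False, fun _ _ => False, fun _ _ => False, fun _ _ _ _ => False,
      fun _ _ _ _ => False⟩
  | k + 1 => T.infer (stage k)

variable {T}

theorem stage_le_succ (k : ℕ) : (T.stage k).Le (T.stage (k + 1)) := by
  induction k with
  | zero => exact ⟨False.elim, False.elim, False.elim, False.elim, False.elim⟩
  | succ k ih => exact infer_mono ih

theorem Forest.stage_le_truth (hT : T.Forest) [Finite V] [Nonempty A] (k : ℕ) :
    (T.stage k).Le T.truth := by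
  induction k with
  | zero => exact ⟨False.elim, False.elim, False.elim, False.elim, False.elim⟩
  | succ k ih =>
    have h := infer_mono (T := T) ih
    obtain ⟨h1, h2, h3, h4, h5⟩ := hT.infer_truth
    exact ⟨fun x => h1 _ _ (h.D x), fun x => h2 _ _ (h.N x), fun x => h3 _ _ (h.B x),
      fun x => h4 _ _ _ _ (h.P x), fun x => h5 _ _ _ _ (h.Pn x)⟩

/-- All facts about trees and descendants are known after logarithmically many rounds. -/
theorem Forest.known_stage (hT : T.Forest) [Finite V] [Nonempty A] {j : ℕ}
    (hj : Nat.card V ≤ 2 ^ j) : (∀ t, T.KnownTree (T.stage (5 * j + 1)) t) ∧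
      ∀ t u, TransGen T.Child t u → (T.stage (5 * j + 1)).D t u := by
  have hw : ∀ t, T.weight t ≤ 2 ^ j := fun t => by
    refine le_trans ?_ hj
    rw [weight, ← Set.ncard_univ]
    exact Set.ncard_le_ncard (Set.subset_univ _)
  obtain ⟨h1, h2⟩ := hT.known stage_le_succ
    (fun k => ⟨id, id, id, id, id⟩) hT.stage_le_truth j
  exact ⟨fun t => h1 t (hw t), fun t u htu => (h2 t u htu ((hw t).trans (by omega))).1⟩

/-- Edges with at most one parent of each node, all reachable from a root, form a forest. -/
theorem forest_of_root (hp : ∀ t t' c, T.Child t c → T.Child t' c → t = t') (r : V)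
    (hr : ∀ t, ¬ T.Child t r) (hre : ∀ t c, T.Child t c → ReflTransGen T.Child r c) : T.Forest where
  parent_unique := hp _ _ _
  acyclic := by
    have key : ∀ t, ReflTransGen T.Child r t → ¬ TransGen T.Child t t := by
      intro t ht
      -- A cycle through a node passes through its only parent, so it could be pushed up to the
      -- root, which has no parent.
      induction ht with
      | refl =>
        intro h
        obtain ⟨x, -, hx⟩ := TransGen.tail'_iff.1 h
        exact hr x hx
      | tail _ hpt ih =>
        intro h
        obtain ⟨x, hx, hxt⟩ := TransGen.tail'_iff.1 h
        obtain rfl := hp _ _ _ hpt hxt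
        exact ih (TransGen.head' hpt hx)
    intro t ht
    obtain ⟨x, -, hx⟩ := TransGen.tail'_iff.1 ht
    exact key t (hre _ _ hx) ht

end Arena

end BisimAC

namespace BisimAC

open Relation

/-! ### The root formula -/

/-- A word describes two graphs and two nodes, and the first graph is a tree, where `D` is the
relation between nodes of the first graph and their descendants. -/
structure Valid (s : List Sym) (D : Occ s → Occ s → Prop) : Prop where
  nodes₁ : OnlyItems nameSyms s 0
  edges₁ : OnlyItems edgeSyms s 1
  nodes₂ : OnlyItems nameSyms s 2
  edges₂ : OnlyItems edgeSyms s 3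
  closed₁ : ∀ u a v : Occ s, HasItem edgeSyms s 1 (u.1, a.1, v.1) →
    HasItem nameSyms s 0 u.1 ∧ HasItem nameSyms s 0 v.1
  closed₂ : ∀ u a v : Occ s, HasItem edgeSyms s 3 (u.1, a.1, v.1) →
    HasItem nameSyms s 2 u.1 ∧ HasItem nameSyms s 2 v.1
  labels : ∀ u a v b, (arena s).E u a v → (arena s).E u b v → a = b
  parents : ∀ u v w, (arena s).Child u w → (arena s).Child v w → u = v
  root : ∃ r : Occ s, HasItem nameSyms s 0 r.1 ∧ (∀ u, ¬ (arena s).Child u r) ∧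
    ∀ v : Occ s, HasItem nameSyms s 0 v.1 → r = v ∨ D r v

/-- The nodes to be compared are in the relation `B`. -/
def Answer (s : List Sym) (B : Occ s → Spot s → Prop) : Prop :=
  ∃ u v : Occ s, HasEnd s 4 u.1 v.1 ∧ HasItem nameSyms s 0 u.1 ∧ HasItem nameSyms s 2 v.1 ∧
    B u (.inr (.inl v))

namespace Fml

/-- The ends of the edges of list `k` are in list `l`. -/
def closed (k l : ℕ) : Fml :=
  all 0 (all 1 (all 2 (disj (edge 3 k 0 1 2).neg (conj (node 3 l 0) (node 3 l 2)))))

/-- Edges between the same nodes have the same label. -/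
def uniqueLabels : Fml := all 0 (all 1 (all 2 (all 3 (disj (edge 4 1 0 1 2).neg
  (disj (edge 4 1 0 3 2).neg (same 4 1 3))))))

/-- A node has at most one parent. -/
def uniqueParents : Fml := all 0 (all 1 (all 2 (disj (child 3 0 2).neg
  (disj (child 3 1 2).neg (same 3 0 1)))))

/-- There is a root from which all nodes descend. -/
def rooted : Fml := ex 0 (conj (node 1 0 0) (conj (all 1 (child 2 1 0).neg)
  (all 1 (disj (node 2 0 1).neg (disj (same 2 0 1) (call 1 [0, 1]))))))

/-- The nodes to be compared are bisimilar. -/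
def answer : Fml := ex 0 (ex 1 (conj (pair 2 0 1) (conj (node 2 0 0) (conj (node 2 2 1)
  (ex 2 (conj (isOne 2) (call 3 [0, 2, 1])))))))

/-- The input describes two graphs, of which the first is a tree. -/
def valid : Fml := conj (onlyNames 0 0) (conj (onlyEdges 0 1) (conj (onlyNames 0 2)
  (conj (onlyEdges 0 3) (conj (closed 1 0) (conj (closed 3 2) (conj uniqueLabels
    (conj uniqueParents rooted)))))))

variable {s : List Sym} {X : ℕ → (ℕ → ℕ) → Prop} {e : ℕ → ℕ}

/-- The only inductive relation involved is that of descendants, so `X` matters at `1` only. In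
particular, validity can be settled before the other relations are known to be sound. -/
theorem sat_valid {D : Occ s → Occ s → Prop}
    (hD : ∀ e, X 1 e ↔ D (occ s (e 0)) (occ s (e 1))) :
    valid.Sat (bits s) X e ↔ Valid s D := by
  have hc : ∀ k l, (closed k l).Sat (bits s) X e ↔
      ∀ u a v : Occ s, HasItem edgeSyms s k (u.1, a.1, v.1) →
        HasItem nameSyms s l u.1 ∧ HasItem nameSyms s l v.1 := fun k l => by
    refine sat_all_occ fun u => sat_all_occ fun a => sat_all_occ fun v => sat_imp
      (fun X => (sat_edge (by omega) (by omega) (by omega)).trans ?_)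
      (sat_conj ((sat_node (by omega)).trans ?_) ((sat_node (by omega)).trans ?_)) <;>
    simp [occ]
  have hl : uniqueLabels.Sat (bits s) X e ↔
      ∀ u a v b, (arena s).E u a v → (arena s).E u b v → a = b := by
    refine sat_all_occ fun u => sat_all_occ fun a => sat_all_occ fun v => sat_all_occ fun b => sat_imp
      (fun X => (sat_treeEdge (by omega) (by omega) (by omega)).trans ?_) (sat_imp
      (fun X => (sat_treeEdge (by omega) (by omega) (by omega)).trans ?_)
      ((sat_same_occ (by omega) (by omega)).trans ?_)) <;>
    simp
  have hp : uniqueParents.Sat (bits s) X e ↔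
      ∀ u v w, (arena s).Child u w → (arena s).Child v w → u = v := by
    refine sat_all_occ fun u => sat_all_occ fun a => sat_all_occ fun v => sat_imp
      (fun X => (sat_child (by omega) (by omega)).trans ?_) (sat_imp
      (fun X => (sat_child (by omega) (by omega)).trans ?_)
      ((sat_same_occ (by omega) (by omega)).trans ?_)) <;>
    simp
  have hr : rooted.Sat (bits s) X e ↔
      ∃ r : Occ s, HasItem nameSyms s 0 r.1 ∧ (∀ u, ¬ (arena s).Child u r) ∧
        ∀ v : Occ s, HasItem nameSyms s 0 v.1 → r = v ∨ D r v := by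
    refine sat_ex_occ fun r => sat_conj ((sat_node (by omega)).trans ?_)
      (sat_conj (sat_all_occ fun u => sat_not fun X => (sat_child (by omega) (by omega)).trans ?_)
        (sat_all_occ fun v => sat_imp (fun X => (sat_node (by omega)).trans ?_)
          (sat_disj ((sat_same_occ (by omega) (by omega)).trans ?_) ((hD _).trans ?_)))) <;>
    simp [occ, argEnv_zero, argEnv_succ]
  refine (sat_conj sat_onlyNames (sat_conj sat_onlyEdges (sat_conj sat_onlyNames
    (sat_conj sat_onlyEdges (sat_conj (hc 1 0) (sat_conj (hc 3 2) (sat_conj hl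
      (sat_conj hp hr)))))))).trans ?_
  exact ⟨fun ⟨h1, h2, h3, h4, h5, h6, h7, h8, h9⟩ => ⟨h1, h2, h3, h4, h5, h6, h7, h8, h9⟩,
    fun ⟨h1, h2, h3, h4, h5, h6, h7, h8, h9⟩ => ⟨h1, h2, h3, h4, h5, h6, h7, h8, h9⟩⟩

theorem sat_answer (hs : 0 < s.length) {B : Occ s → Spot s → Prop}
    (hB : ∀ e, X 3 e ↔ B (occ s (e 0)) (spot s (e 1) (occ s (e 2)))) :
    answer.Sat (bits s) X e ↔ Answer s B := by
  refine sat_ex_occ fun u => sat_ex_occ fun v => sat_conj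
    ((sat_pair (by omega) (by omega)).trans ?_) (sat_conj ((sat_node (by omega)).trans ?_)
      (sat_conj ((sat_node (by omega)).trans ?_) ?_))
  · simp [occ]
  · simp [occ]
  · simp [occ]
  · refine Iff.trans (sat_ex_of (P := fun z => z = 1 ∧ B (occ s u) (spot s z (occ s v)))
      (fun z _ => sat_conj (sat_isOne.trans ?_) ((hB _).trans ?_))
      fun z h => by rw [length_bits]; omega) (by simp [spot])
    · simp
    · simp [argEnv_zero, argEnv_succ]

end Fml

theorem length_pos_of_onlyNames {s : List Sym} (h : OnlyItems nameSyms s 0) : 0 < s.length := by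
  rcases s with _ | ⟨a, s⟩
  · rcases h 0 (entry_zero _) with ⟨l, h⟩ | ⟨x, l, h⟩ <;> simp at h
  · simp

/-! ### The correctness of the root formula -/

theorem HasItem.exists_occ_name {s : List Sym} {k : ℕ} {u : Name} (h : HasItem nameSyms s k u) :
    ∃ x : Occ s, x.1 = u := by
  obtain ⟨p, l, -, h⟩ := h
  exact ⟨occ s p, (exists_drop_eq_nameSyms_iff.1 ⟨l, h⟩).1⟩

theorem HasItem.exists_occ_edge {s : List Sym} {k : ℕ} {u a v : Name}
    (h : HasItem edgeSyms s k (u, a, v)) :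
    ∃ x b y : Occ s, x.1 = u ∧ b.1 = a ∧ y.1 = v := by
  obtain ⟨p, l, -, h⟩ := h
  obtain ⟨h1, q, -, h2, q', -, h3, -⟩ := exists_drop_eq_edgeSyms_iff.1 ⟨l, h⟩
  exact ⟨occ s p, occ s (q + 1), occ s (q' + 1), h1, h2, h3⟩

/-- A word describes the graphs `G₁` and `G₂`. -/
structure Describes (s : List Sym) (G₁ G₂ : PointerGraph) : Prop where
  nodes₁ : ∀ u, HasItem nameSyms s 0 u ↔ u ∈ G₁.nodes
  edges₁ : ∀ e, HasItem edgeSyms s 1 e ↔ e ∈ G₁.edges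
  nodes₂ : ∀ u, HasItem nameSyms s 2 u ↔ u ∈ G₂.nodes
  edges₂ : ∀ e, HasItem edgeSyms s 3 e ↔ e ∈ G₂.edges

/-! ### The graphs of an instance and their copies in the arena. -/

namespace Describes

variable {s : List Sym} {G₁ G₂ : PointerGraph} (h : Describes s G₁ G₂)

include h

/-- The copy of a node of the first graph. -/
noncomputable def node₁ (u : G₁.Vertex) : Occ s := ((h.nodes₁ u.1).2 u.2).exists_occ_name.choose

theorem node₁_val (u : G₁.Vertex) : (h.node₁ u).1 = u.1 :=
  ((h.nodes₁ u.1).2 u.2).exists_occ_name.choose_spec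

/-- The copy of a node of the second graph. -/
noncomputable def node₂ (u : G₂.Vertex) : Occ s := ((h.nodes₂ u.1).2 u.2).exists_occ_name.choose

theorem node₂_val (u : G₂.Vertex) : (h.node₂ u).1 = u.1 :=
  ((h.nodes₂ u.1).2 u.2).exists_occ_name.choose_spec

theorem node₁_injective : Function.Injective h.node₁ := fun u v huv => by
  have := congrArg Subtype.val huv
  rw [node₁_val, node₁_val] at this
  exact Subtype.ext this

theorem E_node₁ (u v : G₁.Vertex) (a : Occ s) :
    (arena s).E (h.node₁ u) a (h.node₁ v) ↔ G₁.toLGraph.E u a.1 v := by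
  change HasItem _ _ _ _ ↔ _
  rw [node₁_val, node₁_val, h.edges₁]
  rfl

theorem E_node₁_name (u v : G₁.Vertex) (a : Name) : G₁.toLGraph.E u a v ↔
    ∃ b : Occ s, b.1 = a ∧ (arena s).E (h.node₁ u) b (h.node₁ v) := by
  constructor
  · intro he
    obtain ⟨_, b, _, -, rfl, -⟩ := ((h.edges₁ _).2 he).exists_occ_edge
    exact ⟨b, rfl, (h.E_node₁ _ _ _).2 he⟩
  · rintro ⟨b, rfl, he⟩
    exact (h.E_node₁ _ _ _).1 he

theorem exists_of_E {x a y : Occ s} (he : (arena s).E x a y) :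
    ∃ u v, x = h.node₁ u ∧ y = h.node₁ v ∧ G₁.toLGraph.E u a.1 v := by
  have he' := (h.edges₁ _).1 he
  exact ⟨⟨x.1, G₁.source_mem _ he'⟩, ⟨y.1, G₁.target_mem _ he'⟩,
    Subtype.ext (h.node₁_val ⟨x.1, _⟩).symm, Subtype.ext (h.node₁_val ⟨y.1, _⟩).symm, he'⟩

theorem child_node₁ (u v : G₁.Vertex) :
    (arena s).Child (h.node₁ u) (h.node₁ v) ↔ G₁.toLGraph.Succ u v := by
  constructor
  · rintro ⟨a, ha⟩
    exact ⟨a.1, (h.E_node₁ _ _ _).1 ha⟩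
  · rintro ⟨a, ha⟩
    obtain ⟨b, -, hb⟩ := (h.E_node₁_name _ _ _).1 ha
    exact ⟨b, hb⟩

theorem exists_of_child {x y : Occ s} (he : (arena s).Child x y) :
    ∃ u v, x = h.node₁ u ∧ y = h.node₁ v ∧ G₁.toLGraph.Succ u v := by
  obtain ⟨a, ha⟩ := he
  obtain ⟨u, v, h1, h2, h3⟩ := h.exists_of_E ha
  exact ⟨u, v, h1, h2, a.1, h3⟩

theorem below_node₁ (u v : G₁.Vertex) :
    TransGen (arena s).Child (h.node₁ u) (h.node₁ v) ↔ TransGen G₁.toLGraph.Succ u v := by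
  constructor
  · intro ht
    generalize hy : h.node₁ v = y at ht
    induction ht generalizing v with
    | single hc =>
      subst hy
      exact .single ((h.child_node₁ _ _).1 hc)
    | tail _ hc ih =>
      obtain ⟨x, z, rfl, rfl, h2⟩ := h.exists_of_child hc
      obtain rfl := h.node₁_injective hy
      exact (ih x rfl).tail h2
  · exact fun ht => ht.lift h.node₁ fun a b hab => (h.child_node₁ a b).2 hab

theorem exists_node₁ {x : Occ s} (hx : HasItem nameSyms s 0 x.1) : ∃ u, x = h.node₁ u :=
  ⟨⟨x.1, (h.nodes₁ _).1 hx⟩, Subtype.ext (h.node₁_val ⟨x.1, _⟩).symm⟩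

theorem hasItem_node₁ (u : G₁.Vertex) : HasItem nameSyms s 0 (h.node₁ u).1 := by
  rw [node₁_val, h.nodes₁]
  exact u.2

/-- The conditions of `Valid` hold if and only if the first graph is a tree. -/
theorem isTree_iff : G₁.toLGraph.IsTree ↔
    (∀ u a v b, (arena s).E u a v → (arena s).E u b v → a = b) ∧
    (∀ u v w, (arena s).Child u w → (arena s).Child v w → u = v) ∧
    ∃ r : Occ s, HasItem nameSyms s 0 r.1 ∧ (∀ u, ¬ (arena s).Child u r) ∧
      ∀ v : Occ s, HasItem nameSyms s 0 v.1 → r = v ∨ TransGen (arena s).Child r v := by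
  rw [LGraph.isTree_iff]
  refine and_congr ?_ (and_congr ?_ ?_)
  · constructor
    · intro hl u a v b ha hb
      obtain ⟨x, y, rfl, rfl, h1⟩ := h.exists_of_E ha
      exact Subtype.ext (hl _ _ _ _ h1 ((h.E_node₁ _ _ _).1 hb))
    · intro hl u v a b ha hb
      obtain ⟨a', rfl, ha'⟩ := (h.E_node₁_name _ _ _).1 ha
      obtain ⟨b', rfl, hb'⟩ := (h.E_node₁_name _ _ _).1 hb
      rw [hl _ _ _ _ ha' hb']
  · constructor
    · intro hp u v w hu hv
      obtain ⟨x, y, rfl, rfl, h1⟩ := h.exists_of_child hu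
      obtain ⟨x', y', rfl, hy, h2⟩ := h.exists_of_child hv
      obtain rfl := h.node₁_injective hy
      rw [hp _ _ _ h1 h2]
    · intro hp u v w hu hv
      exact h.node₁_injective (hp _ _ _ ((h.child_node₁ _ _).2 hu) ((h.child_node₁ _ _).2 hv))
  · constructor
    · rintro ⟨r, hr, hv⟩
      refine ⟨h.node₁ r, h.hasItem_node₁ r, fun x hx => ?_, fun x hx => ?_⟩
      · obtain ⟨u, v, rfl, hv, h1⟩ := h.exists_of_child hx
        obtain rfl := h.node₁_injective hv
        exact hr _ h1
      · obtain ⟨u, rfl⟩ := h.exists_node₁ hx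
        exact (hv u).imp (congrArg _) (h.below_node₁ _ _).2
    · rintro ⟨r, hr, hc, hv⟩
      obtain ⟨r, rfl⟩ := h.exists_node₁ hr
      refine ⟨r, fun u hu => hc _ ((h.child_node₁ _ _).2 hu), fun v => ?_⟩
      exact (hv _ (h.hasItem_node₁ v)).imp (fun h' => h.node₁_injective h') (h.below_node₁ _ _).1

/-- The copies of the two graphs are closed under successors in the arena, so the surplus names and
the node `bot` have no influence on bisimilarity. -/
theorem bisimilar_iff (u : G₁.Vertex) (v : G₂.Vertex) :
    (G₁.toLGraph.disjUnion G₂.toLGraph).Bisimilar (.inl u) (.inr v) ↔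
      (arena s).Alike (h.node₁ u) (.inr (.inl (h.node₂ v))) := by
  refine LGraph.bisimilar_map_iff (H := (arena s).G)
    (Sum.elim (fun u => .inl (h.node₁ u)) fun v => .inr (.inl (h.node₂ v))) Subtype.val ?_ ?_
  · rintro (x | x) b y
    · refine ((arena s).emb_edge (h.node₁ x) b y).trans ⟨?_, ?_⟩
      · rintro ⟨v, rfl, hv⟩
        obtain ⟨x', y', hx, rfl, he⟩ := h.exists_of_E hv
        obtain rfl := h.node₁_injective hx
        exact ⟨.inl y', rfl, .inl he⟩
      · rintro ⟨_, rfl, he⟩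
        cases he with
        | inl he => exact ⟨_, rfl, (h.E_node₁ _ _ _).2 he⟩
    · constructor
      · rcases y with y | y | y
        · exact False.elim
        · intro he
          change HasItem _ _ _ _ at he
          rw [node₂_val, h.edges₂] at he
          have e1 : y = h.node₂ ⟨y.1, G₂.target_mem _ he⟩ :=
            Subtype.ext (h.node₂_val ⟨y.1, _⟩).symm
          exact ⟨.inr ⟨y.1, G₂.target_mem _ he⟩, congrArg _ (congrArg _ e1), .inr he⟩
        · exact False.elim
      · rintro ⟨_, rfl, he⟩
        cases he with
        | inr he =>
          change HasItem _ _ _ _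
          rw [node₂_val, node₂_val, h.edges₂]
          exact he
  · rintro (x | x) a (y | y) (he | he)
    · obtain ⟨_, b, _, -, rfl, -⟩ := ((h.edges₁ _).2 he).exists_occ_edge
      exact ⟨b, rfl⟩
    · obtain ⟨_, b, _, -, rfl, -⟩ := ((h.edges₂ _).2 he).exists_occ_edge
      exact ⟨b, rfl⟩

end Describes

/-- `Valid` says nothing about the end of the word; this comes from the answer. -/
theorem Valid.exists_describes {s : List Sym} {D : Occ s → Occ s → Prop} (h : Valid s D)
    {B : Occ s → Spot s → Prop} (ha : Answer s B) : ∃ G₁ G₂ v₁ v₂, Describes s G₁ G₂ ∧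
      (∀ u v, HasEnd s 4 u v ↔ u = v₁ ∧ v = v₂) ∧ bits s = encodeInstance G₁ G₂ v₁ v₂ := by
  obtain ⟨u, v, hend, -⟩ := ha
  obtain ⟨N₁, E₁, N₂, E₂, v₁, v₂, hs⟩ := exists_layout_iff.2
    ⟨h.nodes₁, h.edges₁, h.nodes₂, h.edges₂, _, _, hend⟩
  have hspec := layout_spec N₁ E₁ N₂ E₂ v₁ v₂
  rw [← hs] at hspec
  obtain ⟨h1, h2, h3, h4, h5⟩ := hspec
  have c1 : ∀ e ∈ E₁, e.1 ∈ N₁ ∧ e.2.2 ∈ N₁ := by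
    rintro ⟨u, a, v⟩ he
    rw [← h2] at he
    obtain ⟨u, a, v, rfl, rfl, rfl⟩ := he.exists_occ_edge
    exact (h.closed₁ u a v he).imp (h1 _).1 (h1 _).1
  have c2 : ∀ e ∈ E₂, e.1 ∈ N₂ ∧ e.2.2 ∈ N₂ := by
    rintro ⟨u, a, v⟩ he
    rw [← h4] at he
    obtain ⟨u, a, v, rfl, rfl, rfl⟩ := he.exists_occ_edge
    exact (h.closed₂ u a v he).imp (h3 _).1 (h3 _).1
  refine ⟨⟨N₁, E₁, fun e he => (c1 e he).1, fun e he => (c1 e he).2⟩,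
    ⟨N₂, E₂, fun e he => (c2 e he).1, fun e he => (c2 e he).2⟩, v₁, v₂, ⟨h1, h2, h3, h4⟩, h5, ?_⟩
  rw [encodeInstance_eq, hs]
  rfl

/-- Names that are not nodes carry no edges, so it is enough that the root reaches all nodes. -/
theorem Valid.forest {s : List Sym} (h : Valid s (TransGen (arena s).Child)) :
    (arena s).Forest := by
  obtain ⟨r, -, hr, hre⟩ := h.root
  refine Arena.forest_of_root h.parents r hr fun t c ⟨a, hc⟩ => ?_
  exact reflTransGen_iff_eq_or_transGen.2 ((hre c (h.closed₁ t a c hc).2).imp_left Eq.symm)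

/-- The language in terms of the graph of all names in the input. -/
theorem mem_bisim_iff {w : List Bool} : w ∈ bisim trees graphs ↔ ∃ s, w = bits s ∧
    Valid s (TransGen (arena s).Child) ∧ Answer s (arena s).Alike := by
  constructor
  · rintro ⟨G₁, hG, G₂, -, v₁, v₂, hw, hb⟩
    rw [encodeInstance_eq] at hw
    have hspec := layout_spec G₁.nodes G₁.edges G₂.nodes G₂.edges v₁.1 v₂.1
    have hlay := exists_layout_iff.1 ⟨G₁.nodes, G₁.edges, G₂.nodes, G₂.edges, v₁.1, v₂.1, rfl⟩
    refine ⟨_, hw, ?_⟩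
    generalize layout G₁.nodes G₁.edges G₂.nodes G₂.edges v₁.1 v₂.1 = s at hspec hlay
    obtain ⟨h1, h2, h3, h4, h5⟩ := hspec
    obtain ⟨l1, l2, l3, l4, -⟩ := hlay
    have h : Describes s G₁ G₂ := ⟨h1, h2, h3, h4⟩
    obtain ⟨t1, t2, t3⟩ := h.isTree_iff.1 hG
    refine ⟨⟨l1, l2, l3, l4, fun u a v he => ?_, fun u a v he => ?_, t1, t2, t3⟩,
      h.node₁ v₁, h.node₂ v₂, ?_, h.hasItem_node₁ v₁, ?_, (h.bisimilar_iff v₁ v₂).1 hb⟩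
    · rw [h2] at he
      exact ⟨(h1 _).2 (G₁.source_mem _ he), (h1 _).2 (G₁.target_mem _ he)⟩
    · rw [h4] at he
      exact ⟨(h3 _).2 (G₂.source_mem _ he), (h3 _).2 (G₂.target_mem _ he)⟩
    · rw [h5]
      exact ⟨h.node₁_val v₁, h.node₂_val v₂⟩
    · rw [h.node₂_val, h3]
      exact v₂.2
  · rintro ⟨s, rfl, hv, ha⟩
    obtain ⟨G₁, G₂, v₁, v₂, h, hend, hbits⟩ := hv.exists_describes ha
    obtain ⟨u, v, h1, h2, h3, h4⟩ := ha
    rw [hend] at h1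
    rw [h.nodes₁] at h2
    rw [h.nodes₂] at h3
    have e1 : h.node₁ ⟨u.1, h2⟩ = u := Subtype.ext (h.node₁_val _)
    have e2 : h.node₂ ⟨v.1, h3⟩ = v := Subtype.ext (h.node₂_val _)
    refine ⟨G₁, h.isTree_iff.2 ⟨hv.labels, hv.parents, hv.root⟩, G₂, trivial, ⟨u.1, h2⟩, ⟨v.1, h3⟩,
      ?_, ?_⟩
    · rw [hbits, h1.1, h1.2]
    · rw [h.bisimilar_iff, e1, e2]
      exact h4

/-! ### The circuits for the bisimulation problem -/

/-- The formulas that decide the bisimulation problem. -/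
def system : FmlSystem := FmlSystem.ofList (.conj .blocks (.conj .valid .answer) :: Fml.rules)
  (by simp)

theorem system_defs_zero : system.defs 0 = .conj .blocks (.conj .valid .answer) := by
  rw [system, FmlSystem.defs_ofList]
  rfl

theorem system_defs_succ (r : ℕ) : system.defs (r + 1) = Fml.rules.getD r (.lin true [] 0 0) := by
  rw [system, FmlSystem.defs_ofList]
  rfl

theorem meaning_of_le {s : List Sym} {c : Prop} {F : Facts (Occ s) (Spot s)} {r : ℕ} (hr : 5 ≤ r)
    {e : ℕ → ℕ} : meaning s c F (r + 1) e ↔ c := by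
  obtain ⟨r, rfl⟩ := Nat.exists_eq_add_of_le' hr
  rfl

theorem meaning_mono {s : List Sym} {c : Prop} {F F' : Facts (Occ s) (Spot s)} (h : F.Le F')
    {r : ℕ} {e : ℕ → ℕ} (hm : meaning s c F r e) : meaning s c F' r e := by
  match r with
  | 0 => exact hm
  | 1 => exact h.D hm
  | 2 => exact h.N hm
  | 3 => exact h.B hm
  | 4 => exact h.P hm
  | 5 => exact h.Pn hm
  | _ + 6 => exact hm

/-- Facts that are closed under inference are a model of the system. -/
theorem sat_of_ev_system {s : List Sym} (hs : 0 < s.length) {F : Facts (Occ s) (Spot s)}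
    (hF : ((arena s).infer F).Le F) {t : ℕ} {φ : Fml} {e : ℕ → ℕ}
    (h : φ.ev (bits s) system.defs t e) : φ.Sat (bits s) (meaning s True F) e := by
  refine Fml.sat_of_ev (fun r e hr => ?_) h
  rcases r with _ | r
  · trivial
  · by_cases h5 : r < 5
    · rw [system_defs_succ, Fml.sat_rules hs F r h5] at hr
      exact meaning_mono hF hr
    · exact (meaning_of_le (by omega)).2 trivial

/-- The numbers outside `1` to `5` mean `False` here, so that stage `0` is empty, whereas soundness
lets them mean `True`, which is closed under any definition. -/
theorem ev_of_stage_system {s : List Sym} (hs : 0 < s.length) {d : ℕ}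
    (hd : ∀ r, (system.defs r).depth ≤ d) {k : ℕ} {φ : Fml} {e : ℕ → ℕ}
    (h : φ.Sat (bits s) (meaning s False ((arena s).stage k)) e) :
    φ.ev (bits s) system.defs (k * d + φ.depth) e := by
  refine Fml.ev_of_sat (h.mono fun r e hr => ?_)
  refine Fml.ev_of_stage (X := fun k => meaning s False ((arena s).stage k)) ?_ ?_ hd k r e hr
  · intro r e
    match r with
    | 0 | 1 | 2 | 3 | 4 | 5 | _ + 6 => exact id
  · intro k r e h
    rcases r with _ | r
    · exact h.elim
    · by_cases h5 : r < 5
      · rw [system_defs_succ, Fml.sat_rules hs _ r h5]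
        exact h
      · exact ((meaning_of_le (by omega)).1 h).elim

theorem exists_depth_le : ∃ d, ∀ r, (system.defs r).depth ≤ d := by
  refine ⟨((system.rels.map Fml.depth).sum) + 1, fun r => ?_⟩
  rw [FmlSystem.defs, List.getD_eq_getElem?_getD]
  rcases h : system.rels[r]? with _ | φ
  · simp [Fml.depth]
  · have := List.single_le_sum (by simp) _
      (List.mem_map_of_mem (f := Fml.depth) (List.mem_of_getElem? h))
    simp only [Option.getD_some]
    omega

/-- Soundness compares the evaluation with facts closed under inference, completeness with the
stages of inference. -/
theorem ev_system_iff {d : ℕ} (hd : ∀ r, (system.defs r).depth ≤ d) (w : List Bool) :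
    (system.defs 0).ev w system.defs (FmlSystem.numRounds (7 * d) w.length) (fun _ => 0) ↔
      w ∈ bisim trees graphs := by
  rw [mem_bisim_iff]
  constructor
  · intro h
    -- Reading all calls as true is a model for every word. It already yields the block structure,
    -- without which there is no `s` to speak about.
    have h0 : (system.defs 0).Sat w (fun _ _ => True) (fun _ => 0) :=
      Fml.sat_of_ev (fun _ _ _ => trivial) h
    rw [system_defs_zero] at h0
    obtain ⟨s, rfl⟩ := Fml.sat_blocks.1 h0.1
    have hs : 0 < s.length := length_pos_of_onlyNames (Fml.sat_onlyNames.1 h0.2.1.1)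
    -- The true facts are known to be closed under inference only over a forest. Taking all
    -- relations but `D` to be everything gives a model in any case, and this one proves validity.
    have h1 := sat_of_ev_system hs (F := ⟨TransGen (arena s).Child, fun _ _ => True,
      fun _ _ => True, fun _ _ _ _ => True, fun _ _ _ _ => True⟩) ⟨?_, fun _ => trivial,
      fun _ => trivial, fun _ => trivial, fun _ => trivial⟩ h
    · rw [system_defs_zero] at h1
      have hv := (Fml.sat_valid (fun _ => Iff.rfl)).1 h1.2.1
      obtain ⟨t1, t2, t3, t4, t5⟩ := hv.forest.infer_truth
      -- Now the first graph is known to be a tree, so the true facts are a model as well.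
      have h2 := sat_of_ev_system hs (F := (arena s).truth)
        ⟨t1 _ _, t2 _ _, t3 _ _, t4 _ _ _ _, t5 _ _ _ _⟩ h
      rw [system_defs_zero] at h2
      exact ⟨s, rfl, hv, (Fml.sat_answer hs fun _ => Iff.rfl).1 h2.2.2⟩
    · rintro t u (h | ⟨x, h, h'⟩)
      exacts [.single h, h.trans h']
  · rintro ⟨s, rfl, hv, ha⟩
    have hs : 0 < s.length := length_pos_of_onlyNames hv.nodes₁
    have hj : Nat.card (Occ s) ≤ 2 ^ Nat.size (bits s).length := by
      have := Nat.lt_size_self (bits s).length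
      have := card_occ_le s
      have := length_bits s
      omega
    obtain ⟨h1, h2⟩ := hv.forest.known_stage hj
    set k := 5 * Nat.size (bits s).length + 1
    have h3 : (system.defs 0).Sat (bits s) (meaning s False ((arena s).stage k)) (fun _ => 0) := by
      rw [system_defs_zero]
      refine ⟨Fml.sat_blocks.2 ⟨s, rfl⟩, (Fml.sat_valid (D := ((arena s).stage k).D) fun _ => Iff.rfl).2 ?_,
        (Fml.sat_answer hs (B := ((arena s).stage k).B) fun _ => Iff.rfl).2 ?_⟩
      · obtain ⟨r, r1, r2, r3⟩ := hv.root
        exact { hv with root := ⟨r, r1, r2, fun v hv => (r3 v hv).imp_right (h2 _ _)⟩ }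
      · obtain ⟨u, v, a1, a2, a3, a4⟩ := ha
        exact ⟨u, v, a1, a2, a3, ((h1 u _).2).2 a4⟩
    refine Fml.ev_mono ?_ (ev_of_stage_system hs hd h3)
    have := hd 0
    -- There are `5 * size + 1` stages of at most `d` rounds each, and the root formula takes at
    -- most `d` more; `7 * d * (size + 1)` is enough.
    have h4 : 7 * d * Nat.size (bits s).length + 7 * d =
        k * d + (2 * (d * Nat.size (bits s).length) + 6 * d) := by
      simp only [k]
      ring
    rw [FmlSystem.numRounds, h4]
    omega

theorem bisim_trees_graphs_mem_AC : bisim trees graphs ∈ AC 1 := by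
  obtain ⟨d, hd⟩ := exists_depth_le
  exact system.mem_AC (7 * d) _ (ev_system_iff hd)

end BisimAC

theorem mainTheorem4 : BisimAC.bisim BisimAC.trees BisimAC.graphs ∈ BisimAC.AC 1 :=
  BisimAC.bisim_trees_graphs_mem_AC
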